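/- Let $\tau$ be a finite first-order vocabulary of relation and function symbols, and let $\varphi$ be a first-order formula over $\tau$ in negation normal form, i.e. built from the literals $t_1=t_2$, $t_1\neq t_2$, $R(t_1,\dots,t_r)$, $\lnot R(t_1,\dots,t_r)$ by $\land,\lor,\exists x,\forall x$. Let $\mathrm{Fr}(\varphi)$ be its set of free variables. A team over a set $X$ of variables in a $\tau$-structure $\mathcal A$ with universe $A$ is a set of assignments $s\colon X\to A$. For a team $T$ over $X\supseteq \mathrm{Fr}(\varphi)$, the relation $\mathcal A,T\models\varphi$ (team semantics) is defined as follows: a literal holds in $T$ iff it holds under every $s\in T$; $\mathcal A,T\models\varphi_0\land\varphi_1$ iff $\mathcal A,T\models\varphi_0$ and $\mathcal A,T\models\varphi_1$; $\mathcal A,T\models\varphi_0\lor\varphi_1$ iff there are $T_0,T_1$ with $T=T_0\cup T_1$, $\mathcal A,T_0\models\varphi_0$ and $\mathcal A,T_1\models\varphi_1$; $\mathcal A,T\models\exists x\,\psi$ iff there is $f\colon T\to\mathcal P(A)\setminus\{\emptyset\}$ with $\mathcal A,\{s^x_a\mid s\in T,\ a\in f(s)\}\models\psi$; and $\mathcal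 A,T\models\forall x\,\psi$ iff $\mathcal A,\{s^x_a\mid s\in T,\ a\in A\}\models\psi$. Here $s^x_a$ maps $x$ to $a$ and agrees with $s$ on all other variables. The (unparameterized) weighted team definability problem $\mathrm{WT}_\varphi$ is the following: given a finite nonempty $\tau$-structure $\mathcal A$ and $k\in\mathbb N$, is there a team $T$ over exactly $\mathrm{Fr}(\varphi)$ with $|T|=k$ and $\mathcal A,T\models\varphi$? Instances are encoded as binary strings: for universe $\{0,\dots,m-1\}$, the string $1^m0$, followed by the characteristic strings of the relations and of the graphs of the functions of $\mathcal A$ (in a fixed order of the symbols), followed by $k$ in binary. Theorem. For every such $\tau$ and $\varphi$, the problem $\mathrm{WT}_\varphi$ is in DLOGTIME-uniform $\mathrm{TC}^0$. That is, it is decided by a family $(C_n)_{n\in\mathbb N}$ of Boolean circuits with unbounded fan-in AND, OR and MAJORITY gates and with NOT gates, of polynomial size and constant depth, whose direct connection language is decidable in time $O(\log N)$, on inputs of length $N$, by a deterministic random-access Turing machine. The direct connection language consists of the tuples $\langle t,a,b,y\rangle$ such that, for $n=|y|$, in $C_n$ gate $b$ is a child of gate $a$, or gate $a$ is labelled by the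 $b$-th input variable, or gate $a$ is the output gate or has a given type, as specified by the tag $t$; gate numbers are written in binary. -/

import Mathlib

universe u v w

namespace WeightedTeam

/-! ## First-order formulas under team semantics -/

/-- First-order formulas in negation normal form over the vocabulary `L`, with the natural numbers
as the countably infinite set of variables. -/
inductive FOFormula (L : FirstOrder.Language.{u, v}) : Type (max u v)
  | eq (t₁ t₂ : L.Term ℕ) : FOFormula L
  | neq (t₁ t₂ : L.Term ℕ) : FOFormula L
  | rel {r : ℕ} (R : L.Relations r) (ts : Fin r → L.Term ℕ) : FOFormula L
  | nrel {r : ℕ} (R : L.Relations r) (ts : Fin r → L.Term ℕ) : FOFormula L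
  | and (φ ψ : FOFormula L) : FOFormula L
  | or (φ ψ : FOFormula L) : FOFormula L
  | ex (x : ℕ) (φ : FOFormula L) : FOFormula L
  | all (x : ℕ) (φ : FOFormula L) : FOFormula L

/-- The set of free variables of a formula. -/
def FOFormula.freeVars {L : FirstOrder.Language.{u, v}} : FOFormula L → Finset ℕ
  | .eq t₁ t₂ => t₁.varFinset ∪ t₂.varFinset
  | .neq t₁ t₂ => t₁.varFinset ∪ t₂.varFinset
  | .rel _ ts => Finset.univ.biUnion fun i => (ts i).varFinset
  | .nrel _ ts => Finset.univ.biUnion fun i => (ts i).varFinset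
  | .and φ ψ => φ.freeVars ∪ ψ.freeVars
  | .or φ ψ => φ.freeVars ∪ ψ.freeVars
  | .ex x φ => φ.freeVars.erase x
  | .all x φ => φ.freeVars.erase x

/-- A team in `A` with domain `X` is a set of assignments `X → A`. -/
abbrev Team (X : Finset ℕ) (A : Type w) : Type w := Set (X → A)

/-- The assignment that maps `x` to `a` and agrees with `s` on all other variables of its domain. -/
def updateAssignment {X : Finset ℕ} {A : Type w} (s : X → A) (x : ℕ) (a : A) :
    ↥(insert x X) → A :=
  fun y => if h : (y : ℕ) = x then a else s ⟨y, Finset.mem_of_mem_insert_of_ne y.2 h⟩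

/-- The supplemented team: every `s ∈ T` is extended or modified at `x` by all values in `f s`. -/
def supplement {X : Finset ℕ} {A : Type w} (T : Team X A) (x : ℕ) (f : (X → A) → Set A) :
    Team (insert x X) A :=
  {s' | ∃ s ∈ T, ∃ a ∈ f s, s' = updateAssignment s x a}

/-- The value of a term, all of whose variables lie in `X`, under an assignment with domain `X`. -/
def termValue {L : FirstOrder.Language.{u, v}} {A : Type w} [L.Structure A] {X : Finset ℕ}
    (s : X → A) (t : L.Term ℕ) (h : t.varFinset ⊆ X) : A :=
  (t.restrictVar fun y => (⟨y, h y.2⟩ : X)).realize s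

/-- Team semantics: `TeamSat A φ X h T` says that the team `T` with domain `X` (which contains the
free variables of `φ`) satisfies `φ` in the structure `A`. The disjunction splits the team
(with overlap allowed), and the existential quantifier is the lax one. -/
def TeamSat {L : FirstOrder.Language.{u, v}} (A : Type w) [L.Structure A] :
    (φ : FOFormula L) → (X : Finset ℕ) → φ.freeVars ⊆ X → Team X A → Prop
  | .eq t₁ t₂, _, h, T =>
      ∀ s ∈ T, termValue s t₁ (Finset.union_subset_left h) =
        termValue s t₂ (Finset.union_subset_right h)
  | .neq t₁ t₂, _, h, T =>
      ∀ s ∈ T, termValue s t₁ (Finset.union_subset_left h) ≠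
        termValue s t₂ (Finset.union_subset_right h)
  | .rel R ts, _, h, T =>
      ∀ s ∈ T, FirstOrder.Language.Structure.RelMap R fun i =>
        termValue s (ts i) (Finset.biUnion_subset.1 h i (Finset.mem_univ i))
  | .nrel R ts, _, h, T =>
      ∀ s ∈ T, ¬ FirstOrder.Language.Structure.RelMap R fun i =>
        termValue s (ts i) (Finset.biUnion_subset.1 h i (Finset.mem_univ i))
  | .and φ ψ, X, h, T =>
      TeamSat A φ X (Finset.union_subset_left h) T ∧ TeamSat A ψ X (Finset.union_subset_right h) T
  | .or φ ψ, X, h, T =>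
      ∃ T₀ T₁ : Team X A, T₀ ∪ T₁ = T ∧ TeamSat A φ X (Finset.union_subset_left h) T₀ ∧
        TeamSat A ψ X (Finset.union_subset_right h) T₁
  | .ex x φ, X, h, T =>
      ∃ f : (X → A) → Set A, (∀ s ∈ T, (f s).Nonempty) ∧
        TeamSat A φ (insert x X) (Finset.subset_insert_iff.2 h) (supplement T x f)
  | .all x φ, X, h, T =>
      TeamSat A φ (insert x X) (Finset.subset_insert_iff.2 h) (supplement T x fun _ => Set.univ)

/-! ## The weighted team definability problem as a language -/

/-- `(A, k)` is a yes-instance of weighted team definability for `φ`: some team over exactly the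
free variables of `φ` has cardinality `k` and satisfies `φ` in `A`. -/
def HasTeamOfSize {L : FirstOrder.Language.{u, v}} (φ : FOFormula L) (A : Type w) [L.Structure A]
    (k : ℕ) : Prop :=
  ∃ T : Team φ.freeVars A, T.Finite ∧ T.ncard = k ∧ TeamSat A φ φ.freeVars (Finset.Subset.refl _) T

/-- An enumeration of the symbols of a finite vocabulary; it fixes the order in which the
interpretations of the symbols are listed in an encoding. -/
structure SymbolOrder (L : FirstOrder.Language.{u, v}) where
  numRel : ℕ
  numFun : ℕ
  relAt : Fin numRel ≃ Σ r, L.Relations r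
  funAt : Fin numFun ≃ Σ r, L.Functions r

/-- The characteristic string of an `r`-ary relation on `{0, …, m - 1}`, of length `m ^ r`. The
entry of `(a₀, …, a_{r-1})` has index `∑ aᵢ * m ^ i`. -/
noncomputable def relationTable (m r : ℕ) (P : (Fin r → Fin m) → Prop) : List Bool :=
  open Classical in
  List.ofFn fun i : Fin (m ^ r) => decide (P (finFunctionFinEquiv.symm i))

/-- The binary encoding of an instance: a structure with universe `{0, …, m - 1}` and a number `k`.
It consists of `m` in unary, the delimiter `0`, the characteristic strings of the relations, the
characteristic strings of the graphs of the functions, and the binary digits of `k`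
(least significant first, without leading zeros). -/
noncomputable def encodeInstance {L : FirstOrder.Language.{u, v}} (e : SymbolOrder L) (m : ℕ)
    [L.Structure (Fin m)] (k : ℕ) : List Bool :=
  List.replicate m true ++ [false] ++
    (List.ofFn fun i : Fin e.numRel => relationTable m (e.relAt i).1
      fun a => FirstOrder.Language.Structure.RelMap (e.relAt i).2 a).flatten ++
    (List.ofFn fun i : Fin e.numFun => relationTable m ((e.funAt i).1 + 1)
      fun a => FirstOrder.Language.Structure.funMap (e.funAt i).2 (Fin.init a) =
        a (Fin.last _)).flatten ++
    k.bits

/-- The problem `WT_φ`: the set of encodings of pairs `(A, k)`, where `A` is a finite nonempty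
structure that has a team of size `k` for `φ` over the free variables of `φ`. -/
def WT {L : FirstOrder.Language.{u, v}} (e : SymbolOrder L) (φ : FOFormula L) : Language Bool :=
  {w | ∃ (m : ℕ) (_ : 0 < m) (_ : L.Structure (Fin m)) (k : ℕ),
    w = encodeInstance e m k ∧ HasTeamOfSize φ (Fin m) k}

/-! ## Random-access Turing machines and DLOGTIME -/

/-- Head movements. -/
inductive Move
  | left
  | stay
  | right

/-- A deterministic multitape Turing machine with random access to a read-only input over `σ`.
It has an index tape with the alphabet `{0, 1}` (where `0` also serves as the blank) and finitely
many two-way infinite work tapes. In every step it sees the input symbol at the position whose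
binary expansion (least significant digit in cell `0`) is on the index tape, or `none` if that
position is not less than the length of the input. -/
structure RandomAccessTM (σ : Type) where
  State : Type
  TapeSymbol : Type
  finite_state : Finite State
  finite_tapeSymbol : Finite TapeSymbol
  blank : TapeSymbol
  numTapes : ℕ
  start : State
  /-- `some true` on accepting states, `some false` on rejecting ones, `none` on all others. -/
  verdict : State → Option Bool
  /-- From the state, the visible input symbol, the scanned bit of the index tape and the scanned
  symbols of the work tapes to the new state, and to what is written and how the head moves on the
  index tape and on each work tape. -/
  trans : State → Option σ → Bool → (Fin numTapes → TapeSymbol) →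
    State × (Bool × Move) × (Fin numTapes → TapeSymbol × Move)

/-- A configuration. The index tape, whose cells are numbered `0, 1, …`, is given by the finite set
of its cells that hold `1`. -/
structure RandomAccessTM.Config {σ : Type} (M : RandomAccessTM σ) where
  state : M.State
  indexOnes : Finset ℕ
  indexHead : ℕ
  tape : Fin M.numTapes → ℤ → M.TapeSymbol
  head : Fin M.numTapes → ℤ

/-- A head movement on the one-way infinite index tape; at cell `0`, `left` has no effect. -/
def Move.onNat : Move → ℕ → ℕ
  | .left, p => p - 1
  | .stay, p => p
  | .right, p => p + 1

/-- A head movement on a two-way infinite work tape. -/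
def Move.onInt : Move → ℤ → ℤ
  | .left, p => p - 1
  | .stay, p => p
  | .right, p => p + 1

namespace RandomAccessTM

/-- The initial configuration: all tapes are blank. -/
def init {σ : Type} (M : RandomAccessTM σ) : M.Config where
  state := M.start
  indexOnes := ∅
  indexHead := 0
  tape := fun _ _ => M.blank
  head := fun _ => 0

/-- The number on the index tape. -/
def Config.address {σ : Type} {M : RandomAccessTM σ} (c : M.Config) : ℕ :=
  ∑ j ∈ c.indexOnes, 2 ^ j

/-- One step on the input `x`; accepting and rejecting configurations do not change any more. -/
def step {σ : Type} (M : RandomAccessTM σ) (x : List σ) (c : M.Config) : M.Config :=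
  match M.verdict c.state with
  | some _ => c
  | none =>
    let out := M.trans c.state x[c.address]? (decide (c.indexHead ∈ c.indexOnes))
      fun i => c.tape i (c.head i)
    { state := out.1
      indexOnes := if out.2.1.1 then insert c.indexHead c.indexOnes
        else c.indexOnes.erase c.indexHead
      indexHead := out.2.1.2.onNat c.indexHead
      tape := fun i => Function.update (c.tape i) (c.head i) (out.2.2 i).1
      head := fun i => (out.2.2 i).2.onInt (c.head i) }

/-- The verdict of `M` on the input `x` after `t` steps (`none` if it is still running). -/
def verdictAfter {σ : Type} (M : RandomAccessTM σ) (x : List σ) (t : ℕ) : Option Bool :=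
  M.verdict ((M.step x)^[t] M.init).state

end RandomAccessTM

/-- DLOGTIME: `K` is decided by a deterministic random-access Turing machine in time
`O(log n)` on inputs of length `n`. -/
def InDLOGTIME {σ : Type} (K : Language σ) : Prop :=
  ∃ (M : RandomAccessTM σ) (c : ℕ), ∀ x : List σ, ∃ t ≤ c * (Nat.log 2 x.length + 1),
    (x ∈ K → M.verdictAfter x t = some true) ∧ (x ∉ K → M.verdictAfter x t = some false)

/-! ## Circuits with majority gates and DLOGTIME-uniform TC⁰ -/

/-- The kinds of gates in a circuit with `n` inputs. -/
inductive GateKind (n : ℕ)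
  | input (i : Fin n)
  | not
  | and
  | or
  | maj

/-- A Boolean circuit with `n` inputs over unbounded fan-in conjunction, disjunction and majority,
and negation. The gates are numbered `0, …, size - 1`, in any order; `children a` is the set of
gates that feed gate `a`. -/
structure Circuit (n : ℕ) where
  size : ℕ
  kind : Fin size → GateKind n
  children : Fin size → Finset (Fin size)
  output : Fin size
  input_children : ∀ a i, kind a = .input i → children a = ∅
  not_children : ∀ a, kind a = .not → (children a).card = 1
  acyclic : WellFounded fun b a => b ∈ children a

/-- The value of a gate on the circuit input `x`, given the values `val` of its children. A majority
gate is true if at least half of its children are. -/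
def GateKind.value {n : ℕ} (x : Fin n → Bool) {ι : Type} [Fintype ι] (val : ι → Bool) :
    GateKind n → Bool
  | .input i => x i
  | .not => decide (∃ j, val j = false)
  | .and => decide (∀ j, val j = true)
  | .or => decide (∃ j, val j = true)
  | .maj => decide (Fintype.card ι ≤ 2 * (Finset.univ.filter fun j => val j = true).card)

namespace Circuit

/-- The value of each gate on the circuit input `x`. -/
noncomputable def eval {n : ℕ} (C : Circuit n) (x : Fin n → Bool) : Fin C.size → Bool :=
  C.acyclic.fix fun a ih => (C.kind a).value x fun b : C.children a => ih b b.2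

theorem eval_eq {n : ℕ} (C : Circuit n) (x : Fin n → Bool) (a : Fin C.size) :
    C.eval x a = (C.kind a).value x fun b : C.children a => C.eval x b :=
  C.acyclic.fix_eq _ a

/-- The length of the longest path that leads down from a gate. -/
noncomputable def gateDepth {n : ℕ} (C : Circuit n) : Fin C.size → ℕ :=
  C.acyclic.fix fun a ih => (C.children a).attach.sup fun b => ih b b.2 + 1

theorem gateDepth_eq {n : ℕ} (C : Circuit n) (a : Fin C.size) :
    C.gateDepth a = (C.children a).attach.sup fun b => C.gateDepth b + 1 :=
  C.acyclic.fix_eq _ a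

/-- The depth of a circuit: the length of a longest path. -/
noncomputable def depth {n : ℕ} (C : Circuit n) : ℕ :=
  Finset.univ.sup C.gateDepth

end Circuit

/-- The kinds of facts about a circuit that its direct connection language lists. -/
inductive ConnTag
  | output
  | input
  | not
  | and
  | or
  | maj
  | child

/-- The fact with tag `t` holds for the numbers `a` and `b` in the circuit `C`: `b` is (the number
of) a child of gate `a`; gate `a` is labelled by the input variable number `b`; or gate `a` is
the output gate or is of the given kind (in these cases `b = 0` is only a placeholder). -/
def Circuit.Conn {n : ℕ} (C : Circuit n) (t : ConnTag) (a b : ℕ) : Prop :=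
  ∃ ha : a < C.size,
    match t with
    | .output => C.output = ⟨a, ha⟩ ∧ b = 0
    | .input => ∃ hb : b < n, C.kind ⟨a, ha⟩ = .input ⟨b, hb⟩
    | .not => C.kind ⟨a, ha⟩ = .not ∧ b = 0
    | .and => C.kind ⟨a, ha⟩ = .and ∧ b = 0
    | .or => C.kind ⟨a, ha⟩ = .or ∧ b = 0
    | .maj => C.kind ⟨a, ha⟩ = .maj ∧ b = 0
    | .child => ∃ hb : b < C.size, (⟨b, hb⟩ : Fin C.size) ∈ C.children ⟨a, ha⟩

/-- The alphabet of direct connection languages. -/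
inductive ConnSymbol
  | tag (t : ConnTag)
  | bit (d : Bool)
  | sep

/-- The word for the tuple `⟨t, a, b, y⟩`, with `a` and `b` in binary. -/
def connWord (t : ConnTag) (a b : ℕ) (y : List ConnSymbol) : List ConnSymbol :=
  .tag t :: (a.bits.map .bit ++ .sep :: (b.bits.map .bit ++ .sep :: y))

/-- The direct connection language of a circuit family: all `⟨t, a, b, y⟩`, where `y` is any word
whose length is the number of inputs of the circuit in which the fact `⟨t, a, b⟩` holds. -/
def directConnectionLanguage (C : (n : ℕ) → Circuit n) : Language ConnSymbol :=
  {x | ∃ (t : ConnTag) (a b : ℕ) (y : List ConnSymbol),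
    (C y.length).Conn t a b ∧ x = connWord t a b y}

/-- DLOGTIME-uniform TC⁰: the languages decided by a family of circuits with majority gates that
has polynomial size and constant depth and whose direct connection language is in DLOGTIME. -/
def InDLOGTIMEUniformTC0 (K : Language Bool) : Prop :=
  ∃ C : (n : ℕ) → Circuit n,
    (∀ x : List Bool, x ∈ K ↔ (C x.length).eval x.get (C x.length).output = true) ∧
    (∃ c : ℕ, ∀ n, (C n).size ≤ n ^ c + c) ∧
    (∃ d : ℕ, ∀ n, (C n).depth ≤ d) ∧
    InDLOGTIME (directConnectionLanguage C)

end WeightedTeam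

namespace WeightedTeam

/-! ## Binary expansions and interleaved tracks -/

/-! First-order team semantics is flat (`teamSat_iff`): a team satisfies a formula iff each of its
assignments satisfies it classically. The satisfying teams are thus the subsets of the set of
satisfying assignments, and one of size `k` exists iff `k` is at most the number of satisfying
assignments (`hasTeamOfSize_iff`). What remains is to count the satisfying assignments of a fixed
formula, which majority gates can do; the real work lies in the uniformity.

The link is a logic over words with a single quantifier (`MF`, `Def`). Its variables range below
`bnd n`, which is polynomial in the length `n` of the word; its atoms are input bits and relations
that a finite automaton decides on the binary expansions of `n` and the variables (`AutoRel`);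
`count` compares the numbers of tuples that satisfy two formulas. Connectives, quantifiers,
addition, multiplication and powers of two are all obtained by counting. This suffices to locate the
tables of an encoded structure, to check the encoding and to evaluate formulas (`def_WT`). The
weight can exceed the range of one variable, so it is represented by `D` variables that hold its
interleaved bits (tracks); it is compared with the number of assignments through the `D`-tuples that
precede it, of which there are exactly `k`.

Every definable language is in uniform TC⁰ (`inDLOGTIMEUniformTC0_of_def`). A gate is a subformula
with a negation flag and values for the variables. A counting formula becomes one majority gate over
the instances of one subformula and the negated instances of the other; an automatic atom becomes a
constant gate, whose value is left to the machine that decides the direct connection language. Gate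
numbers interleave the values with marks for the subformula, so that every fact about the circuit is
an automatic relation between tracks (`Layout.autoRel_connRel`).

The machine (`inDLOGTIME_of_autoRel`) copies both numbers of a connection word to a work tape with
the tracks side by side, obtains the length of the last component by subtraction, and runs the
automaton over the cells. The time stays logarithmic because the length of the word is found bit by
bit on the index tape and because incrementing an address has constant amortized cost. -/

theorem exists_bits_eq_iff (d : List Bool) : (∃ a : ℕ, a.bits = d) ↔ d.getLast? ≠ some false := by
  constructor
  · rintro ⟨a, rfl⟩
    induction a using Nat.binaryRec' with
    | zero => simp
    | bit b n h ih =>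
      rw [Nat.bits_append_bit n b h]
      cases hn : n.bits with
      | nil =>
        have : n = 0 := by
          have := congrArg List.length hn
          rw [Nat.size_eq_bits_len] at this
          exact Nat.size_eq_zero.1 this
        simp [h this]
      | cons x l => rw [hn] at ih; simpa using ih
  · induction d with
    | nil => exact fun _ => ⟨0, by simp⟩
    | cons b d ih =>
      intro h
      cases d with
      | nil =>
        have : b = true := by simpa using h
        exact ⟨1, by simp [this]⟩
      | cons x l =>
        obtain ⟨a, ha⟩ := ih (by simpa using h)
        refine ⟨Nat.bit b a, ?_⟩
        rw [Nat.bits_append_bit, ha]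
        rintro rfl
        simp at ha

theorem testBit_eq_getD_bits (a j : ℕ) : a.testBit j = a.bits.getD j false := by
  rw [Nat.testBit_eq_inth]
  rfl

theorem testBit_eq_false_of_size_le {a j : ℕ} (h : a.size ≤ j) : a.testBit j = false :=
  Nat.testBit_lt_two_pow ((Nat.size_le).1 h)

/-- The number whose bit `j` is bit `j * c + i` of `a`. -/
def track (c a i : ℕ) : ℕ := Nat.ofBits fun j : Fin a.size => a.testBit (j * c + i)

theorem testBit_track {c : ℕ} (hc : 0 < c) (a i j : ℕ) :
    (track c a i).testBit j = a.testBit (j * c + i) := by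
  rw [track, Nat.testBit_ofBits]
  split_ifs with h
  · rfl
  · refine (testBit_eq_false_of_size_le ?_).symm
    nlinarith

theorem track_lt {c ℓ a i : ℕ} (hc : 0 < c) (h : a < 2 ^ (c * ℓ)) : track c a i < 2 ^ ℓ := by
  refine Nat.lt_pow_two_of_testBit _ fun j hj => ?_
  rw [testBit_track hc]
  refine Nat.testBit_lt_two_pow (h.trans_le (Nat.pow_le_pow_right (by norm_num) ?_))
  nlinarith

theorem lt_two_pow_of_track_lt {c ℓ a : ℕ} (hc : 0 < c) (h : ∀ i < c, track c a i < 2 ^ ℓ) :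
    a < 2 ^ (c * ℓ) := by
  refine Nat.lt_pow_two_of_testBit _ fun k hk => ?_
  have h1 : k = k / c * c + k % c := by rw [mul_comm]; exact (Nat.div_add_mod k c).symm
  rw [h1, ← testBit_track hc]
  refine Nat.testBit_lt_two_pow ((h _ (Nat.mod_lt _ hc)).trans_le
    (Nat.pow_le_pow_right (by norm_num) ?_))
  rw [Nat.le_div_iff_mul_le hc, mul_comm]
  exact hk

theorem eq_of_track_eq {c a b : ℕ} (hc : 0 < c) (h : ∀ i < c, track c a i = track c b i) :
    a = b := by
  refine Nat.eq_of_testBit_eq fun k => ?_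
  have h1 : k = k / c * c + k % c := by rw [mul_comm]; exact (Nat.div_add_mod k c).symm
  rw [h1, ← testBit_track hc, ← testBit_track hc, h _ (Nat.mod_lt _ hc)]

/-- The number below `2 ^ (c * ℓ)` with the given tracks. -/
def merge {c : ℕ} (ℓ : ℕ) (v : Fin c → ℕ) : ℕ :=
  Nat.ofBits fun k : Fin (c * ℓ) =>
    if h : 0 < c then (v ⟨k % c, Nat.mod_lt _ h⟩).testBit (k / c) else false

theorem merge_lt {c : ℕ} (ℓ : ℕ) (v : Fin c → ℕ) : merge ℓ v < 2 ^ (c * ℓ) :=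
  Nat.ofBits_lt_two_pow _

theorem track_merge {c ℓ : ℕ} {v : Fin c → ℕ} (hv : ∀ i, v i < 2 ^ ℓ) (i : Fin c) :
    track c (merge ℓ v) i = v i := by
  have hc : 0 < c := i.pos
  refine Nat.eq_of_testBit_eq fun j => ?_
  rw [testBit_track hc, merge, Nat.testBit_ofBits]
  have e1 : (j * c + i) % c = i := by
    rw [add_comm, Nat.add_mul_mod_self_right]; exact Nat.mod_eq_of_lt i.2
  have e2 : (j * c + i) / c = j := by
    rw [add_comm, Nat.add_mul_div_right _ _ hc, Nat.div_eq_of_lt i.2, zero_add]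
  split_ifs with h
  · simp only [e1, e2]
  · refine (Nat.testBit_lt_two_pow ((hv i).trans_le (Nat.pow_le_pow_right (by norm_num) ?_))).symm
    by_contra hlt
    have := i.2
    push Not at h hlt
    nlinarith

/-- Splitting a number into `c` interleaved tracks. -/
def trackEquiv (c ℓ : ℕ) (hc : 0 < c) : Fin (2 ^ (c * ℓ)) ≃ (Fin c → Fin (2 ^ ℓ)) where
  toFun a i := ⟨track c a i, track_lt hc a.2⟩
  invFun v := ⟨merge ℓ fun i => (v i : ℕ), merge_lt _ _⟩
  left_inv a := by
    refine Fin.ext (eq_of_track_eq hc fun i hi => ?_)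
    exact track_merge (v := fun i : Fin c => track c a i) (fun i => track_lt hc a.2) ⟨i, hi⟩
  right_inv v := by
    funext i
    exact Fin.ext (track_merge (v := fun i => (v i : ℕ)) (fun i => (v i).2) i)

/-! ## Relations decided by finite automata on binary expansions -/

/-- A finite automaton that reads a parameter and a family of numbers bit by bit. -/
structure Auto (ι : Type) where
  Q : Type
  finite : Finite Q
  start : Q
  step : Q → Bool → (ι → Bool) → Q
  acc : Q → Prop

/-- The state after the first `j` bits of the streams `s` and `t`. -/
def Auto.run {ι : Type} (A : Auto ι) (s : ℕ → Bool) (t : ι → ℕ → Bool) : ℕ → A.Q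
  | 0 => A.start
  | j + 1 => A.step (A.run s t j) (s j) fun i => t i j

/-- A relation between a parameter and a family of numbers is automatic if a finite automaton
decides it on the binary expansions, whatever the number of leading zeros. -/
def AutoRel {ι : Type} (R : ℕ → (ι → ℕ) → Prop) : Prop :=
  ∃ A : Auto ι, ∀ n v j, n < 2 ^ j → (∀ i, v i < 2 ^ j) →
    (R n v ↔ A.acc (A.run n.testBit (fun i => (v i).testBit) j))

namespace AutoRel

variable {ι κ : Type}

theorem congr {R S : ℕ → (ι → ℕ) → Prop} (h : AutoRel R) (e : ∀ n v, S n v ↔ R n v) :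
    AutoRel S := by
  obtain ⟨A, hA⟩ := h
  exact ⟨A, fun n v j hn hv => (e n v).trans (hA n v j hn hv)⟩

/-- Boolean combinations. -/
theorem comb {α : Type} [Finite α] (f : (α → Prop) → Prop) {R : α → ℕ → (ι → ℕ) → Prop}
    (h : ∀ a, AutoRel (R a)) : AutoRel fun n v => f fun a => R a n v := by
  choose A hA using h
  have := fun a => (A a).finite
  let P : Auto ι :=
    { Q := ∀ a, (A a).Q
      finite := inferInstance
      start := fun a => (A a).start
      step := fun q b t a => (A a).step (q a) b t
      acc := fun q => f fun a => (A a).acc (q a) }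
  have hrun : ∀ s t j, P.run s t j = fun a => (A a).run s t j := by
    intro s t j
    induction j with
    | zero => rfl
    | succ j ih => simp only [Auto.run, ih]; rfl
  refine ⟨P, fun n v j hn hv => ?_⟩
  rw [hrun]
  have : (fun a => R a n v) = fun a => (A a).acc ((A a).run n.testBit (fun i => (v i).testBit) j) :=
    funext fun a => propext (hA a n v j hn hv)
  simp only [this]
  rfl

theorem not {R : ℕ → (ι → ℕ) → Prop} (h : AutoRel R) : AutoRel fun n v => ¬ R n v :=
  comb (α := Unit) (fun p => ¬ p ()) (R := fun _ => R) fun _ => h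

theorem and {R S : ℕ → (ι → ℕ) → Prop} (h : AutoRel R) (h' : AutoRel S) :
    AutoRel fun n v => R n v ∧ S n v :=
  comb (α := Bool) (fun p => p true ∧ p false) (R := fun b => if b then R else S)
    fun b => by cases b <;> simpa

theorem or {R S : ℕ → (ι → ℕ) → Prop} (h : AutoRel R) (h' : AutoRel S) :
    AutoRel fun n v => R n v ∨ S n v :=
  comb (α := Bool) (fun p => p true ∨ p false) (R := fun b => if b then R else S)
    fun b => by cases b <;> simpa

theorem exists_finite {α : Type} [Finite α] {R : α → ℕ → (ι → ℕ) → Prop} (h : ∀ a, AutoRel (R a)) :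
    AutoRel fun n v => ∃ a, R a n v :=
  comb (fun p => ∃ a, p a) h

theorem forall_finite {α : Type} [Finite α] {R : α → ℕ → (ι → ℕ) → Prop} (h : ∀ a, AutoRel (R a)) :
    AutoRel fun n v => ∀ a, R a n v :=
  comb (fun p => ∀ a, p a) h

theorem const (p : Prop) : AutoRel fun (_ : ℕ) (_ : ι → ℕ) => p :=
  comb (α := Empty) (fun _ => p) (R := fun _ _ _ => True) fun a => a.elim

theorem comap {R : ℕ → (κ → ℕ) → Prop} (h : AutoRel R) (σ : κ → ι) :
    AutoRel fun n (v : ι → ℕ) => R n (v ∘ σ) := by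
  obtain ⟨A, hA⟩ := h
  let P : Auto ι :=
    { Q := A.Q
      finite := A.finite
      start := A.start
      step := fun q b t => A.step q b (t ∘ σ)
      acc := A.acc }
  have hrun : ∀ s t j, P.run s t j = A.run s (t ∘ σ) j := by
    intro s t j
    induction j with
    | zero => rfl
    | succ j ih => simp only [Auto.run, ih]; rfl
  refine ⟨P, fun n v j hn hv => ?_⟩
  rw [hrun]
  exact hA n (v ∘ σ) j hn fun i => hv (σ i)

/-- Replacing the parameter `n` by `2 * n + 1`. -/
theorem two_mul_add_one {R : ℕ → (ι → ℕ) → Prop} (h : AutoRel R) :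
    AutoRel fun n v => R (2 * n + 1) v := by
  obtain ⟨A, hA⟩ := h
  have := A.finite
  let P : Auto ι :=
    { Q := A.Q × Bool
      finite := inferInstance
      -- The stored bit is the next bit of `2 * n + 1` to be read. It lags one place behind `n`: it
      -- starts as the lowest bit `1`, and `acc` reads the last one, beside which all other numbers
      -- have a zero.
      start := (A.start, true)
      step := fun q b t => (A.step q.1 q.2 t, b)
      acc := fun q => A.acc (A.step q.1 q.2 fun _ => false) }
  refine ⟨P, fun n v j hn hv => ?_⟩
  have hrun : ∀ j, P.run n.testBit (fun i => (v i).testBit) j =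
      (A.run (2 * n + 1).testBit (fun i => (v i).testBit) j, (2 * n + 1).testBit j) := by
    intro j
    induction j with
    | zero => simp [Auto.run, P]
    | succ j ih =>
      simp only [Auto.run, ih, P, Nat.testBit_succ]
      rw [show (2 * n + 1) / 2 = n by omega]
  have hv' : ∀ i, v i < 2 ^ (j + 1) := fun i => (hv i).trans (by rw [pow_succ]; omega)
  refine (hA (2 * n + 1) v (j + 1) (by rw [pow_succ]; omega) hv').trans ?_
  rw [hrun]
  simp only [Auto.run, P]
  have : (fun i => (v i).testBit j) = fun _ => false :=
    funext fun i => Nat.testBit_lt_two_pow (hv i)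
  rw [this]

/-- At some position the bits satisfy `p`, and at all higher positions they satisfy `q`. -/
theorem exists_top (p q : Bool → (ι → Bool) → Prop) (hp : ¬ p false fun _ => false)
    (hq : q false fun _ => false) :
    AutoRel fun n (v : ι → ℕ) => ∃ j, p (n.testBit j) (fun i => (v i).testBit j) ∧
      ∀ j' > j, q (n.testBit j') fun i => (v i).testBit j' := by
  -- The state is the truth of the claim for the bits read so far: a position with `p` establishes
  -- it, and one with `q` preserves it.
  let P : Auto ι :=
    { Q := Prop
      finite := inferInstance
      start := False
      step := fun s b t => p b t ∨ (s ∧ q b t)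
      acc := id }
  refine ⟨P, fun n v j hn hv => ?_⟩
  have hrun : ∀ j, P.run n.testBit (fun i => (v i).testBit) j ↔
      ∃ k < j, p (n.testBit k) (fun i => (v i).testBit k) ∧
        ∀ j', k < j' → j' < j → q (n.testBit j') fun i => (v i).testBit j' := by
    intro j
    induction j with
    | zero => simp [Auto.run, P]
    | succ j ih =>
      have : P.run n.testBit (fun i => (v i).testBit) (j + 1) =
        (p (n.testBit j) (fun i => (v i).testBit j) ∨
          (P.run n.testBit (fun i => (v i).testBit) j ∧
            q (n.testBit j) fun i => (v i).testBit j)) := rfl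
      rw [this, ih]
      constructor
      · rintro (h | ⟨⟨k, hk, h1, h2⟩, h3⟩)
        · exact ⟨j, by omega, h, fun j' _ _ => by omega⟩
        · refine ⟨k, by omega, h1, fun j' h4 h5 => ?_⟩
          rcases (Nat.lt_succ_iff_lt_or_eq.1 h5) with h6 | rfl
          · exact h2 j' h4 h6
          · exact h3
      · rintro ⟨k, hk, h1, h2⟩
        rcases (Nat.lt_succ_iff_lt_or_eq.1 hk) with h6 | rfl
        · exact Or.inr ⟨⟨k, h6, h1, fun j' h4 h5 => h2 j' h4 (by omega)⟩, h2 j h6 (by omega)⟩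
        · exact Or.inl h1
  -- Above position `j` only zeros follow; by `hp` they provide no witness and by `hq` they destroy
  -- none.
  have hz : ∀ k, j ≤ k → n.testBit k = false ∧ (fun i => (v i).testBit k) = fun _ => false := by
    intro k hk
    have := Nat.pow_le_pow_right (show 0 < 2 by norm_num) hk
    exact ⟨Nat.testBit_lt_two_pow (hn.trans_le this),
      funext fun i => Nat.testBit_lt_two_pow ((hv i).trans_le this)⟩
  refine Iff.trans ?_ (hrun j).symm
  constructor
  · rintro ⟨k, h1, h2⟩
    refine ⟨k, ?_, h1, fun j' h3 _ => h2 j' h3⟩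
    by_contra hk
    rw [(hz k (by omega)).1, (hz k (by omega)).2] at h1
    exact hp h1
  · rintro ⟨k, hk, h1, h2⟩
    refine ⟨k, h1, fun j' h3 => ?_⟩
    by_cases h : j' < j
    · exact h2 j' h3 h
    · rw [(hz j' (by omega)).1, (hz j' (by omega)).2]
      exact hq

/-- At all positions the bits satisfy `q`. -/
theorem forall_bits (q : Bool → (ι → Bool) → Prop) (hq : q false fun _ => false) :
    AutoRel fun n (v : ι → ℕ) => ∀ j, q (n.testBit j) (fun i => (v i).testBit j) := by
  refine (exists_top (fun b t => ¬ q b t) (fun _ _ => True) (by simpa) trivial).not.congr ?_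
  simp

theorem eq (i j : ι) : AutoRel fun _ v => v i = v j :=
  (forall_bits (fun _ t => t i = t j) rfl).congr fun _ _ => Nat.eq_iff_testBit_eq

theorem eq_param (i : ι) : AutoRel fun n v => v i = n :=
  (forall_bits (fun b t => t i = b) rfl).congr fun _ _ => Nat.eq_iff_testBit_eq

theorem eq_zero (i : ι) : AutoRel fun _ v => v i = 0 :=
  (forall_bits (fun _ t => t i = false) rfl).congr fun _ _ => by simp [Nat.eq_iff_testBit_eq]

end AutoRel

/-- The highest bit at which two numbers differ decides their order. In this form
`AutoRel.exists_top` makes comparison automatic. -/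
theorem lt_iff_exists_testBit (x y : ℕ) :
    x < y ↔ ∃ j, (x.testBit j = false ∧ y.testBit j = true) ∧
      ∀ j' > j, x.testBit j' = y.testBit j' := by
  constructor
  · intro h
    have hne : x ≠ y := h.ne
    have hb : ∃ N, ∀ k ≥ N, x.testBit k = y.testBit k := by
      refine ⟨y.size, fun k hk => ?_⟩
      rw [testBit_eq_false_of_size_le hk,
        testBit_eq_false_of_size_le ((Nat.size_le_size h.le).trans hk)]
    classical
    -- `N` is the least position from which on all bits agree, so the deciding bit is at `N - 1`.
    let N := Nat.find hb
    have hN := Nat.find_spec hb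
    obtain ⟨j, hj⟩ : ∃ j, N = j + 1 := by
      refine Nat.exists_eq_succ_of_ne_zero fun h0 => hne (Nat.eq_of_testBit_eq fun k => ?_)
      exact hN k (by change N ≤ k; omega)
    have hd : x.testBit j ≠ y.testBit j := by
      intro he
      refine Nat.find_min hb (show j < N by omega) fun k hk => ?_
      rcases eq_or_lt_of_le hk with rfl | hk
      · exact he
      · exact hN k (by change N ≤ k; omega)
    have htop : ∀ j' > j, x.testBit j' = y.testBit j' :=
      fun j' h' => hN j' (by change N ≤ j'; omega)
    refine ⟨j, ?_, htop⟩
    cases hx : x.testBit j <;> cases hy : y.testBit j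
    · simp [hx, hy] at hd
    · exact ⟨rfl, rfl⟩
    · exact absurd (Nat.lt_of_testBit j hy hx fun k hk => (htop k hk).symm) (by omega)
    · simp [hx, hy] at hd
  · rintro ⟨j, ⟨h1, h2⟩, h3⟩
    exact Nat.lt_of_testBit j h1 h2 h3

namespace AutoRel

variable {ι : Type}

theorem lt (i j : ι) : AutoRel fun _ v => v i < v j :=
  (exists_top (fun _ t => t i = false ∧ t j = true) (fun _ t => t i = t j) (by simp) rfl).congr
    fun _ _ => lt_iff_exists_testBit _ _

theorem lt_param (i : ι) : AutoRel fun n v => v i < n :=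
  (exists_top (fun b t => t i = false ∧ b = true) (fun b t => t i = b) (by simp) rfl).congr
    fun _ _ => lt_iff_exists_testBit _ _

theorem testBit_common (i j : ι) : AutoRel fun _ v => ∃ k, (v i).testBit k ∧ (v j).testBit k :=
  (exists_top (fun _ t => t i = true ∧ t j = true) (fun _ _ => True) (by simp) trivial).congr
    fun _ _ => by simp

/-- `v i` reaches `2 ^ n.size` iff it has a one at a position from which on `n` has only zeros,
which is a condition of the form treated by `exists_top`. -/
theorem lt_two_pow_size (i : ι) : AutoRel fun n v => v i < 2 ^ n.size := by
  refine (exists_top (fun b t => t i = true ∧ b = false) (fun b _ => b = false)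
    (by simp) rfl).not.congr fun n v => ?_
  rw [← not_le, not_iff_not]
  constructor
  · intro h
    obtain ⟨k, hk, hb⟩ := Nat.exists_ge_and_testBit_of_ge_two_pow h
    exact ⟨k, ⟨hb, testBit_eq_false_of_size_le hk⟩,
      fun j' hj => testBit_eq_false_of_size_le (by omega)⟩
  · rintro ⟨k, ⟨h1, h2⟩, h3⟩
    refine le_trans (Nat.pow_le_pow_right (by norm_num) ?_) (Nat.ge_two_pow_of_testBit h1)
    rw [Nat.size_le]
    refine Nat.lt_pow_two_of_testBit _ fun j hj => ?_
    rcases eq_or_lt_of_le hj with rfl | hj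
    · exact h2
    · exact h3 j hj

/-- Comparison of two numbers that are given by their tracks. -/
theorem lt_of_tracks {D : ℕ} (σ τ : Fin D → ι) :
    AutoRel fun _ (v : ι → ℕ) => ∃ j, ∃ i : Fin D,
      ((v (σ i)).testBit j = false ∧ (v (τ i)).testBit j = true ∧
        ∀ i' > i, (v (σ i')).testBit j = (v (τ i')).testBit j) ∧
      ∀ j' > j, ∀ i', (v (σ i')).testBit j' = (v (τ i')).testBit j' := by
  refine (exists_top (fun _ t => ∃ i : Fin D, t (σ i) = false ∧ t (τ i) = true ∧
      ∀ i' > i, t (σ i') = t (τ i')) (fun _ t => ∀ i', t (σ i') = t (τ i'))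
      (by simp) fun _ => rfl).congr fun n v => ?_
  refine exists_congr fun j => ?_
  rw [exists_and_right]

end AutoRel

/-- Bit `j * D + i` of a number is bit `j` of track `i`, so the highest differing bit is found by
comparing `j` first and `i` second. -/
theorem lt_iff_tracks {D : ℕ} (hD : 0 < D) (x y : ℕ) :
    x < y ↔ ∃ j, ∃ i : Fin D,
      ((track D x i).testBit j = false ∧ (track D y i).testBit j = true ∧
        ∀ i' > i, (track D x i').testBit j = (track D y i').testBit j) ∧
      ∀ j' > j, ∀ i' : Fin D, (track D x i').testBit j' = (track D y i').testBit j' := by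
  rw [lt_iff_exists_testBit]
  simp only [testBit_track hD]
  constructor
  · rintro ⟨k, ⟨h1, h2⟩, h3⟩
    have e : k / D * D + k % D = k := by rw [mul_comm]; exact Nat.div_add_mod k D
    refine ⟨k / D, ⟨k % D, Nat.mod_lt _ hD⟩, ⟨?_, ?_, fun i' hi' => ?_⟩, fun j' hj' i' => ?_⟩
    · simpa [e] using h1
    · simpa [e] using h2
    · refine h3 _ ?_
      have : k % D < i' := hi'
      omega
    · refine h3 _ ?_
      have : (k / D + 1) * D ≤ j' * D := Nat.mul_le_mul_right _ hj'
      have := Nat.mod_lt k hD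
      rw [add_mul] at *
      omega
  · rintro ⟨j, i, ⟨h1, h2, h3⟩, h4⟩
    refine ⟨j * D + i, ⟨h1, h2⟩, fun k hk => ?_⟩
    have e : k / D * D + k % D = k := by rw [mul_comm]; exact Nat.div_add_mod k D
    have hm := Nat.mod_lt k hD
    have hi := i.2
    have hj : j ≤ k / D := by
      rw [Nat.le_div_iff_mul_le hD]; omega
    rw [← e]
    rcases eq_or_lt_of_le hj with hj | hj
    · rw [← hj]
      refine h3 ⟨k % D, hm⟩ ?_
      change (i : ℕ) < k % D
      rw [← hj] at e
      omega
    · exact h4 _ hj ⟨k % D, hm⟩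

/-! ## A logic with counting quantifiers over words -/

/-- The bound on the values of variables over words of length `n`. -/
def bnd (n : ℕ) : ℕ := 2 ^ (n.size + 1)

theorem lt_bnd (n : ℕ) : n < bnd n :=
  (Nat.lt_size_self n).trans_le (Nat.pow_le_pow_right (by norm_num) (Nat.le_succ _))

theorem bnd_pos (n : ℕ) : 0 < bnd n := by unfold bnd; positivity

/-- The range of the variables over the word `x`. -/
abbrev Val (x : List Bool) : Type := Fin (bnd x.length)

instance (x : List Bool) : NeZero (bnd x.length) := ⟨(bnd_pos _).ne'⟩

/-- Formulas with `k` free variables. The quantifier `count d φ θ` says that at least as many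
`d`-tuples satisfy `φ` as `θ`. -/
inductive MF : ℕ → Type
  | atom {k : ℕ} (R : ℕ → (Fin k → ℕ) → Prop) (h : AutoRel R) : MF k
  | input {k : ℕ} (i : Fin k) : MF k
  | count {k : ℕ} (d : ℕ) (φ θ : MF (k + d)) : MF k

namespace MF

def Sat : {k : ℕ} → MF k → (x : List Bool) → (Fin k → Val x) → Prop
  | _, .atom R _, x, v => R x.length fun i => v i
  | _, .input i, x, v => x[(v i : ℕ)]? = some true
  | _, .count d φ θ, x, v => {u : Fin d → Val x | θ.Sat x (Fin.append v u)}.ncard ≤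
      {u : Fin d → Val x | φ.Sat x (Fin.append v u)}.ncard

/-- Renaming of the free variables. -/
def rename : {k k' : ℕ} → MF k → (Fin k → Fin k') → MF k'
  | _, _, .atom R h, ρ => .atom (fun n v => R n (v ∘ ρ)) (h.comap ρ)
  | _, _, .input i, ρ => .input (ρ i)
  | _, k', .count d φ θ, ρ =>
    let ρ' := Fin.addCases (fun i => Fin.castAdd d (ρ i)) fun j => Fin.natAdd k' j
    .count d (φ.rename ρ') (θ.rename ρ')

theorem sat_rename {k k' : ℕ} (φ : MF k) (ρ : Fin k → Fin k') (x : List Bool)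
    (v : Fin k' → Val x) : (φ.rename ρ).Sat x v ↔ φ.Sat x (v ∘ ρ) := by
  induction φ generalizing k' with
  | atom R h => rfl
  | input i => rfl
  | @count k d φ θ ih₁ ih₂ =>
    have e : ∀ u : Fin d → Val x, Fin.append v u ∘ (Fin.addCases (motive := fun _ => Fin (k' + d))
        (fun i => Fin.castAdd d (ρ i)) fun j => Fin.natAdd k' j) = Fin.append (v ∘ ρ) u := by
      intro u
      funext i
      refine Fin.addCases (fun i => ?_) (fun j => ?_) i <;> simp
    simp only [rename, Sat, ih₁, ih₂, e]

end MF

/-- A predicate of a word and a family of variables is definable if a formula defines it. -/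
def Def {ι : Type} (P : (x : List Bool) → (ι → Val x) → Prop) : Prop :=
  ∃ (k : ℕ) (σ : Fin k → ι) (φ : MF k), ∀ x v, P x v ↔ φ.Sat x (v ∘ σ)

namespace Def

variable {ι κ : Type}

theorem congr {P P' : (x : List Bool) → (ι → Val x) → Prop} (h : Def P)
    (e : ∀ x v, P' x v ↔ P x v) : Def P' := by
  obtain ⟨k, σ, φ, hφ⟩ := h
  exact ⟨k, σ, φ, fun x v => (e x v).trans (hφ x v)⟩

theorem comp {P : (x : List Bool) → (κ → Val x) → Prop} (h : Def P) (σ : κ → ι) :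
    Def fun x (v : ι → Val x) => P x fun i => v (σ i) := by
  obtain ⟨k, τ, φ, hφ⟩ := h
  exact ⟨k, σ ∘ τ, φ, fun x v => hφ x _⟩

theorem input (i : ι) : Def fun x (v : ι → Val x) => x[(v i : ℕ)]? = some true :=
  ⟨1, fun _ => i, .input 0, fun _ _ => Iff.rfl⟩

theorem exists_rename [Finite ι] {P : (x : List Bool) → (ι → Val x) → Prop} (h : Def P) {k : ℕ}
    (e : ι ≃ Fin k) : ∃ φ : MF k, ∀ x v, P x v ↔ φ.Sat x (v ∘ e.symm) := by
  obtain ⟨l, σ, φ, hφ⟩ := h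
  refine ⟨φ.rename (e ∘ σ), fun x v => ?_⟩
  rw [MF.sat_rename, hφ]
  congr! 1
  funext i
  simp

theorem option_comp {P : (x : List Bool) → (ι → Val x) → Val x → Prop}
    (hP : Def fun x (v : Option ι → Val x) => P x (fun i => v (some i)) (v none)) :
    Def fun x (v : ι ⊕ Unit → Val x) => P x (fun i => v (.inl i)) (v (.inr ())) :=
  hP.comp fun o => Option.elim o (Sum.inr ()) Sum.inl

variable [Finite ι]

theorem atom {R : ℕ → (ι → ℕ) → Prop} (h : AutoRel R) :
    Def fun x (v : ι → Val x) => R x.length fun i => v i := by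
  obtain ⟨k, ⟨e⟩⟩ := Finite.exists_equiv_fin ι
  refine ⟨k, e.symm, .atom _ (h.comap e), fun x v => ?_⟩
  simp only [MF.Sat]
  congr! 1
  funext i
  simp

theorem count [Finite κ] {P Q : (x : List Bool) → (ι → Val x) → (κ → Val x) → Prop}
    (hP : Def fun x (v : ι ⊕ κ → Val x) => P x (fun i => v (.inl i)) fun j => v (.inr j))
    (hQ : Def fun x (v : ι ⊕ κ → Val x) => Q x (fun i => v (.inl i)) fun j => v (.inr j)) :
    Def fun x (v : ι → Val x) => {u | Q x v u}.ncard ≤ {u | P x v u}.ncard := by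
  obtain ⟨k, ⟨e⟩⟩ := Finite.exists_equiv_fin ι
  obtain ⟨d, ⟨f⟩⟩ := Finite.exists_equiv_fin κ
  obtain ⟨φ, hφ⟩ := hP.exists_rename ((Equiv.sumCongr e f).trans finSumFinEquiv)
  obtain ⟨θ, hθ⟩ := hQ.exists_rename ((Equiv.sumCongr e f).trans finSumFinEquiv)
  refine ⟨k, e.symm, .count d φ θ, fun x v => ?_⟩
  have key : ∀ (P : (x : List Bool) → (ι → Val x) → (κ → Val x) → Prop) (φ : MF (k + d)),
      (∀ x (v : ι ⊕ κ → Val x), P x (fun i => v (.inl i)) (fun j => v (.inr j)) ↔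
        φ.Sat x (v ∘ ((Equiv.sumCongr e f).trans finSumFinEquiv).symm)) →
      {u | P x v u}.ncard = {u : Fin d → Val x | φ.Sat x (Fin.append (v ∘ e.symm) u)}.ncard := by
    intro P φ h
    refine Set.ncard_congr (fun u _ => u ∘ f.symm) ?_ ?_ ?_
    · intro u hu
      have := (h x (Sum.elim v u)).1 hu
      simp only [Set.mem_ofPred_eq]
      convert this using 1
      funext i
      refine Fin.addCases (fun i => ?_) (fun j => ?_) i <;> simp
    · intro u u' _ _ huu
      exact f.symm.surjective.injective_comp_right huu
    · intro u hu
      refine ⟨u ∘ f, (h x (Sum.elim v (u ∘ f))).2 ?_, by funext i; simp⟩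
      simp only [Set.mem_ofPred_eq] at hu
      convert hu using 1
      funext i
      refine Fin.addCases (fun i => ?_) (fun j => ?_) i <;> simp
  simp only [MF.Sat]
  rw [key P φ hφ, key Q θ hθ]

/-- When no variables are counted there is just one tuple, both numbers are `0` or `1`, and `≤`
between them is implication. -/
theorem imp {P Q : (x : List Bool) → (ι → Val x) → Prop} (hP : Def P) (hQ : Def Q) :
    Def fun x v => P x v → Q x v := by
  refine (count (κ := Empty) (P := fun x v _ => Q x v) (Q := fun x v _ => P x v)
    (hQ.comp Sum.inl) (hP.comp Sum.inl)).congr fun x v => ?_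
  by_cases h1 : P x v <;> by_cases h2 : Q x v <;> simp [h1, h2, Set.ncard_univ]

theorem const (p : Prop) : Def fun (x : List Bool) (_ : ι → Val x) => p :=
  atom (AutoRel.const p)

theorem not {P : (x : List Bool) → (ι → Val x) → Prop} (hP : Def P) : Def fun x v => ¬ P x v :=
  hP.imp (const False)

theorem or {P Q : (x : List Bool) → (ι → Val x) → Prop} (hP : Def P) (hQ : Def Q) :
    Def fun x v => P x v ∨ Q x v :=
  (hP.not.imp hQ).congr fun _ _ => or_iff_not_imp_left

theorem and {P Q : (x : List Bool) → (ι → Val x) → Prop} (hP : Def P) (hQ : Def Q) :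
    Def fun x v => P x v ∧ Q x v :=
  (hP.imp hQ.not).not.congr fun _ _ => by tauto

theorem iff {P Q : (x : List Bool) → (ι → Val x) → Prop} (hP : Def P) (hQ : Def Q) :
    Def fun x v => P x v ↔ Q x v :=
  ((hP.imp hQ).and (hQ.imp hP)).congr fun _ _ => by tauto

/-- A witness exists iff it is not the case that `False` holds for at least as many tuples as `P`.
-/
theorem exs [Finite κ] {P : (x : List Bool) → (ι → Val x) → (κ → Val x) → Prop}
    (hP : Def fun x (v : ι ⊕ κ → Val x) => P x (fun i => v (.inl i)) fun j => v (.inr j)) :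
    Def fun x (v : ι → Val x) => ∃ u, P x v u := by
  refine (count (P := fun _ _ _ => False) (const _) hP).not.congr fun x v => ?_
  simp only [Set.ofPred_false, Set.ncard_empty, Nat.le_zero]
  rw [Set.ncard_eq_zero (Set.toFinite _), Set.eq_empty_iff_forall_notMem]
  simp

theorem alls [Finite κ] {P : (x : List Bool) → (ι → Val x) → (κ → Val x) → Prop}
    (hP : Def fun x (v : ι ⊕ κ → Val x) => P x (fun i => v (.inl i)) fun j => v (.inr j)) :
    Def fun x (v : ι → Val x) => ∀ u, P x v u :=
  (exs (P := fun x v u => ¬ P x v u) hP.not).not.congr fun _ _ => by simp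

theorem ex {P : (x : List Bool) → (ι → Val x) → Val x → Prop}
    (hP : Def fun x (v : Option ι → Val x) => P x (fun i => v (some i)) (v none)) :
    Def fun x (v : ι → Val x) => ∃ a, P x v a :=
  (exs (κ := Unit) (P := fun x v u => P x v (u ())) hP.option_comp).congr fun _ _ =>
    ⟨fun ⟨a, h⟩ => ⟨fun _ => a, h⟩, fun ⟨u, h⟩ => ⟨u (), h⟩⟩

theorem all {P : (x : List Bool) → (ι → Val x) → Val x → Prop}
    (hP : Def fun x (v : Option ι → Val x) => P x (fun i => v (some i)) (v none)) :
    Def fun x (v : ι → Val x) => ∀ a, P x v a :=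
  (ex (P := fun x v a => ¬ P x v a) hP.not).not.congr fun _ _ => by simp

/-- Comparison of the numbers of values that satisfy two predicates. -/
theorem count_one {P Q : (x : List Bool) → (ι → Val x) → Val x → Prop}
    (hP : Def fun x (v : Option ι → Val x) => P x (fun i => v (some i)) (v none))
    (hQ : Def fun x (v : Option ι → Val x) => Q x (fun i => v (some i)) (v none)) :
    Def fun x (v : ι → Val x) => {a | Q x v a}.ncard ≤ {a | P x v a}.ncard := by
  refine (count (κ := Unit) (P := fun x v u => P x v (u ())) (Q := fun x v u => Q x v (u ()))
    hP.option_comp hQ.option_comp).congr fun x v => ?_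
  have key : ∀ R : Val x → Prop, {a | R a}.ncard = {u : Unit → Val x | R (u ())}.ncard := by
    intro R
    refine Set.ncard_congr (fun a _ _ => a) (fun a h => h) (fun a b _ _ h => congrFun h ()) ?_
    exact fun u h => ⟨u (), h, rfl⟩
  rw [key, key]

theorem finite_all {α : Type} [Finite α] {P : α → (x : List Bool) → (ι → Val x) → Prop}
    (h : ∀ a, Def (P a)) : Def fun x v => ∀ a, P a x v := by
  have := Fintype.ofFinite α
  classical
  suffices ∀ s : Finset α, Def fun x v => ∀ a ∈ s, P a x v from
    (this Finset.univ).congr fun x v => by simp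
  intro s
  induction s using Finset.induction_on with
  | empty => exact (const True).congr fun x v => by simp
  | insert a s ha ih => exact ((h a).and ih).congr fun x v => by simp

theorem finite_ex {α : Type} [Finite α] {P : α → (x : List Bool) → (ι → Val x) → Prop}
    (h : ∀ a, Def (P a)) : Def fun x v => ∃ a, P a x v :=
  (finite_all fun a => (h a).not).not.congr fun x v => by simp

theorem lt (i j : ι) : Def fun x (v : ι → Val x) => (v i : ℕ) < v j := atom (AutoRel.lt i j)

theorem eq (i j : ι) : Def fun x (v : ι → Val x) => (v i : ℕ) = v j := atom (AutoRel.eq i j)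

theorem le (i j : ι) : Def fun x (v : ι → Val x) => (v i : ℕ) ≤ v j :=
  (lt j i).not.congr fun _ _ => not_lt.symm

theorem eq_length (i : ι) : Def fun x (v : ι → Val x) => (v i : ℕ) = x.length :=
  atom (AutoRel.eq_param i)

theorem eq_zero (i : ι) : Def fun x (v : ι → Val x) => (v i : ℕ) = 0 := atom (AutoRel.eq_zero i)

theorem testBit_common (i j : ι) : Def fun x (v : ι → Val x) =>
    ∃ k, (v i : ℕ).testBit k ∧ (v j : ℕ).testBit k :=
  atom (AutoRel.testBit_common i j)

end Def

/-! ### Arithmetic by counting -/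

theorem ncard_fin_lt {N m : ℕ} (h : m ≤ N) :
    {a : Fin N | (a : ℕ) < m}.ncard = m := by
  have : {a : Fin N | (a : ℕ) < m} = Set.range (Fin.castLE h) := by
    ext a
    simp only [Set.mem_ofPred_eq, Set.mem_range]
    exact ⟨fun ha => ⟨⟨a, ha⟩, rfl⟩, fun ⟨b, hb⟩ => by rw [← hb]; exact b.2⟩
  rw [this, ← Set.image_univ, Set.ncard_image_of_injective _ (Fin.castLE_injective h),
    Set.ncard_univ, Nat.card_eq_fintype_card, Fintype.card_fin]

namespace Def

variable {ι : Type} [Finite ι]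

/-- The interval from `v i` to `v k` is compared in both directions with the interval of length `v
j`. -/
theorem add (i j k : ι) : Def fun x (v : ι → Val x) => (v i : ℕ) + v j = v k := by
  have h1 : Def fun x (v : Option ι → Val x) => (v (some i) : ℕ) ≤ v none ∧
    (v none : ℕ) < v (some k) := (le _ _).and (lt _ _)
  have h2 : Def fun x (v : Option ι → Val x) => (v none : ℕ) < v (some j) := lt _ _
  refine ((le i k).and ((count_one (P := fun x v a => (v i : ℕ) ≤ a ∧ (a : ℕ) < v k)
    (Q := fun x v a => (a : ℕ) < v j) h1 h2).and (count_one (Q := fun x v a => (v i : ℕ) ≤ a ∧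
      (a : ℕ) < v k) (P := fun x v a => (a : ℕ) < v j) h2 h1))).congr fun x v => ?_
  rw [ncard_fin_lt (v j).2.le]
  by_cases hik : (v i : ℕ) ≤ v k
  · have : {a : Val x | (v i : ℕ) ≤ a ∧ (a : ℕ) < v k}.ncard = v k - v i := by
      have e : {a : Val x | (v i : ℕ) ≤ a ∧ (a : ℕ) < v k} =
          {a : Val x | (a : ℕ) < v k} \ {a : Val x | (a : ℕ) < v i} := by
        ext a; simp; omega
      have hs : {a : Val x | (a : ℕ) < v i} ⊆ {a : Val x | (a : ℕ) < v k} :=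
        fun a h => lt_of_lt_of_le h hik
      rw [e, Set.ncard_sdiff hs (Set.toFinite _),
        ncard_fin_lt (v k).2.le, ncard_fin_lt (v i).2.le]
    rw [this]
    omega
  · simp only [hik, false_and, iff_false]
    omega

/-- The rectangle with sides `v i` and `v j` is compared with a strip of length `v k`. The strip is
padded by a coordinate fixed to `0`, because both sides of a comparison count tuples of the same
length. -/
theorem mul (i j k : ι) : Def fun x (v : ι → Val x) => (v i : ℕ) * v j = v k := by
  have h1 : Def fun x (v : ι ⊕ Bool → Val x) => (v (.inr true) : ℕ) < v (.inl i) ∧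
    (v (.inr false) : ℕ) < v (.inl j) := (lt _ _).and (lt _ _)
  have h2 : Def fun x (v : ι ⊕ Bool → Val x) => (v (.inr true) : ℕ) = 0 ∧
    (v (.inr false) : ℕ) < v (.inl k) := (eq_zero _).and (lt _ _)
  refine ((count (κ := Bool) (P := fun x v u => (u true : ℕ) < v i ∧ (u false : ℕ) < v j)
    (Q := fun x v u => (u true : ℕ) = 0 ∧ (u false : ℕ) < v k) h1 h2).and
    (count (κ := Bool) (Q := fun x v u => (u true : ℕ) < v i ∧ (u false : ℕ) < v j)
    (P := fun x v u => (u true : ℕ) = 0 ∧ (u false : ℕ) < v k) h2 h1)).congr fun x v => ?_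
  have key : ∀ A B : Set (Val x), {u : Bool → Val x | u true ∈ A ∧ u false ∈ B}.ncard =
      A.ncard * B.ncard := by
    intro A B
    rw [← Set.ncard_prod]
    refine Set.ncard_congr (fun u _ => (u true, u false)) (fun u h => h) ?_ ?_
    · intro u u' _ _ h
      funext b
      cases b
      · exact congrArg Prod.snd h
      · exact congrArg Prod.fst h
    · rintro ⟨a, b⟩ h
      exact ⟨fun c => if c then a else b, by simpa using h, by simp⟩
  have e1 := key {a | (a : ℕ) < v i} {a | (a : ℕ) < v j}
  have e2 := key {a | (a : ℕ) < 1} {a | (a : ℕ) < v k}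
  rw [ncard_fin_lt (v i).2.le, ncard_fin_lt (v j).2.le] at e1
  rw [ncard_fin_lt (m := 1) (bnd_pos _), ncard_fin_lt (v k).2.le, one_mul] at e2
  simp only [Set.mem_ofPred_eq, Nat.lt_one_iff] at e1 e2
  rw [e1, e2]
  omega

end Def

/-- A number-valued function of a word and a family of variables is definable if its graph is. -/
def DefFun {ι : Type} (f : (x : List Bool) → (ι → Val x) → ℕ) : Prop :=
  Def fun x (v : Option ι → Val x) => f x (fun i => v (some i)) = v none

namespace DefFun

theorem comp {ι κ : Type} {f : (x : List Bool) → (κ → Val x) → ℕ} (h : DefFun f) (σ : κ → ι) :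
    DefFun fun x (v : ι → Val x) => f x fun i => v (σ i) :=
  (Def.comp h (Option.map σ)).congr fun _ _ => Iff.rfl

variable {ι : Type} [Finite ι] {f g : (x : List Bool) → (ι → Val x) → ℕ}

theorem var (i : ι) : DefFun fun x (v : ι → Val x) => (v i : ℕ) := Def.eq (some i) none

theorem zero : DefFun fun x (_ : ι → Val x) => 0 := (Def.eq_zero none).congr fun _ _ => eq_comm

/-- The value of a definable function can be used in place of a variable, provided that the
predicate holds of values in range only. -/
theorem subst (hf : DefFun f) {P : (x : List Bool) → (ι → Val x) → ℕ → Prop}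
    (hP : Def fun x (v : Option ι → Val x) => P x (fun i => v (some i)) (v none))
    (hb : ∀ x v a, P x v a → a < bnd x.length) : Def fun x v => P x v (f x v) := by
  refine (Def.ex (P := fun x v a => f x v = a ∧ P x v a) (hf.and hP)).congr fun x v => ?_
  exact ⟨fun h => ⟨⟨f x v, hb _ _ _ h⟩, rfl, h⟩, fun ⟨a, h1, h2⟩ => h1 ▸ h2⟩

theorem one : DefFun fun x (_ : ι → Val x) => 1 := by
  refine Def.congr (P := fun x (v : Option ι → Val x) => (v none : ℕ) ≠ 0 ∧
    ∀ a : Val x, (a : ℕ) < v none → (a : ℕ) = 0)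
    ((Def.eq_zero none).not.and (Def.all ((Def.lt none (some none)).imp (Def.eq_zero none))))
    fun x v => ?_
  change 1 = (v none : ℕ) ↔ _
  constructor
  · intro h
    rw [← h]
    simp
  · rintro ⟨h1, h2⟩
    by_contra h
    have h3 : 1 < bnd x.length := by have := (v none).2; omega
    exact absurd (h2 ⟨1, h3⟩ (by change 1 < (v none : ℕ); omega)) (by simp)

/-- A sum in range has both summands in range, so quantification over values finds them. -/
theorem add (hf : DefFun f) (hg : DefFun g) : DefFun fun x v => f x v + g x v := by
  refine Def.congr (P := fun x (v : Option ι → Val x) => ∃ a b : Val x,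
    (f x (fun i => v (some i)) = a ∧ g x (fun i => v (some i)) = b) ∧ (a : ℕ) + b = v none)
    (Def.ex (Def.ex (((Def.comp hf (fun o => o.elim (some none) fun i => some (some (some i)))).and
      (Def.comp hg (fun o => o.elim none fun i => some (some (some i))))).and
      (Def.add (some none) none (some (some none)))))) fun x v => ?_
  change f x (fun i => v (some i)) + g x (fun i => v (some i)) = v none ↔ _
  constructor
  · intro h
    have := (v none).2
    exact ⟨⟨f x _, by omega⟩, ⟨g x _, by omega⟩, ⟨rfl, rfl⟩, h⟩
  · rintro ⟨a, b, ⟨h1, h2⟩, h3⟩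
    rw [h1, h2, h3]

/-- If a product is in range and nonzero, so are both factors, and quantification finds them. When
the product is `0`, the other factor may be out of range; hence the separate clause. -/
theorem mul (hf : DefFun f) (hg : DefFun g) : DefFun fun x v => f x v * g x v := by
  have hz : Def fun x (v : Option ι → Val x) => (v none : ℕ) = 0 ∧
      (f x (fun i => v (some i)) = v none ∨ g x (fun i => v (some i)) = v none) :=
    (Def.eq_zero none).and (Def.or hf hg)
  refine Def.congr (P := fun x (v : Option ι → Val x) => (∃ a b : Val x,
    (f x (fun i => v (some i)) = a ∧ g x (fun i => v (some i)) = b) ∧ (a : ℕ) * b = v none) ∨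
      ((v none : ℕ) = 0 ∧ (f x (fun i => v (some i)) = v none ∨ g x (fun i => v (some i)) = v none)))
    ((Def.ex (Def.ex (((Def.comp hf (fun o => o.elim (some none) fun i => some (some (some i)))).and
      (Def.comp hg (fun o => o.elim none fun i => some (some (some i))))).and
      (Def.mul (some none) none (some (some none)))))).or hz) fun x v => ?_
  change f x (fun i => v (some i)) * g x (fun i => v (some i)) = v none ↔ _
  constructor
  · intro h
    by_cases h0 : (v none : ℕ) = 0
    · rw [h0] at h ⊢
      exact Or.inr ⟨rfl, Nat.mul_eq_zero.1 h⟩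
    · refine Or.inl ?_
      have h1 := (v none).2
      have h2 : f x (fun i => v (some i)) ≠ 0 := fun h' => h0 (by rw [← h, h', zero_mul])
      have h3 : g x (fun i => v (some i)) ≠ 0 := fun h' => h0 (by rw [← h, h', mul_zero])
      have h4 := Nat.le_mul_of_pos_right (f x fun i => v (some i)) (Nat.pos_of_ne_zero h3)
      have h5 := Nat.le_mul_of_pos_left (g x fun i => v (some i)) (Nat.pos_of_ne_zero h2)
      exact ⟨⟨f x _, by omega⟩, ⟨g x _, by omega⟩, ⟨rfl, rfl⟩, h⟩
  · rintro (⟨a, b, ⟨h1, h2⟩, h3⟩ | ⟨h1, h2⟩)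
    · rw [h1, h2, h3]
    · rw [h1] at h2 ⊢
      exact Nat.mul_eq_zero.2 h2

theorem const (m : ℕ) : DefFun fun x (_ : ι → Val x) => m := by
  induction m with
  | zero => exact zero
  | succ m ih => exact ih.add one

theorem pow (hf : DefFun f) (m : ℕ) : DefFun fun x v => f x v ^ m := by
  induction m with
  | zero => simpa using one
  | succ m ih => simpa only [pow_succ] using ih.mul hf

theorem sum {α : Type} (s : Finset α) {f : α → (x : List Bool) → (ι → Val x) → ℕ}
    (h : ∀ a ∈ s, DefFun (f a)) : DefFun fun x v => ∑ a ∈ s, f a x v := by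
  classical
  induction s using Finset.induction_on with
  | empty => simpa using zero
  | insert a s ha ih =>
    simp only [Finset.sum_insert ha]
    exact (h a (Finset.mem_insert_self _ _)).add
      (ih fun b hb => h b (Finset.mem_insert_of_mem hb))

theorem getElem_eq_true (hf : DefFun f) : Def fun x v => x[f x v]? = some true := by
  refine hf.subst (P := fun x _ a => x[a]? = some true) (Def.input none) fun x v a h => ?_
  obtain ⟨h, -⟩ := List.getElem?_eq_some_iff.1 h
  exact h.trans (lt_bnd _)

theorem le_length (hf : DefFun f) : Def fun x v => f x v ≤ x.length := by
  refine hf.subst (P := fun x _ a => a ≤ x.length) ?_ fun x v a h => h.trans_lt (lt_bnd _)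
  refine (Def.ex (P := fun x (v : Option ι → Val x) a => (a : ℕ) = x.length ∧ (v none : ℕ) ≤ a)
    ((Def.eq_length none).and (Def.le (some none) none))).congr fun x v => ?_
  exact ⟨fun h => ⟨⟨x.length, lt_bnd _⟩, rfl, h⟩, fun ⟨a, h1, h2⟩ => h2.trans h1.le⟩

theorem eq_length (hf : DefFun f) : Def fun x v => f x v = x.length :=
  hf.subst (P := fun x _ a => a = x.length) (Def.eq_length none)
    fun x _ _ (h : _ = x.length) => h ▸ lt_bnd _

theorem eq_var (hf : DefFun f) (i : ι) : Def fun x v => f x v = v i :=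
  hf.subst (P := fun x v a => a = v i) (Def.eq none (some i)) fun x v a h => h ▸ (v i).2

end DefFun

/-- A nonzero number that is not a power of two shares its leading bit with a smaller number, namely
the power of two of that bit. This avoids any mention of bit positions, which are not yet definable.
-/
theorem exists_eq_two_pow_iff (p : ℕ) : (∃ j, p = 2 ^ j) ↔
    p ≠ 0 ∧ ∀ a < p, ¬ ∃ k, a.testBit k ∧ p.testBit k := by
  constructor
  · rintro ⟨j, rfl⟩
    refine ⟨by positivity, ?_⟩
    rintro a ha ⟨k, h1, h2⟩
    rw [Nat.testBit_two_pow, decide_eq_true_iff] at h2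
    subst h2
    rw [Nat.testBit_lt_two_pow ha] at h1
    exact absurd h1 (by simp)
  · rintro ⟨h0, h⟩
    refine ⟨p.log2, ?_⟩
    by_contra hne
    have h1 := Nat.testBit_log2 h0
    have h2 : 2 ^ p.log2 < p := lt_of_le_of_ne (Nat.ge_two_pow_of_testBit h1) (Ne.symm hne)
    exact h _ h2 ⟨p.log2, Nat.testBit_two_pow_self, h1⟩

namespace Def

variable {ι : Type} [Finite ι]

theorem is_two_pow (i : ι) : Def fun x (v : ι → Val x) => ∃ j, (v i : ℕ) = 2 ^ j := by
  refine ((eq_zero i).not.and (all (P := fun x v a => (a : ℕ) < v i →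
    ¬ ∃ k, (a : ℕ).testBit k ∧ (v i : ℕ).testBit k) ((lt none (some i)).imp
      (testBit_common none (some i)).not))).congr fun x v => ?_
  rw [exists_eq_two_pow_iff]
  refine and_congr Iff.rfl ⟨fun h a ha => h a ha, fun h a ha => ?_⟩
  exact h ⟨a, ha.trans (v i).2⟩ ha

/-- The exponential function is definable by counting the powers of two. -/
theorem eq_two_pow (i j : ι) : Def fun x (v : ι → Val x) => (v i : ℕ) = 2 ^ (v j : ℕ) := by
  have h1 : Def fun x (v : Option ι → Val x) => (∃ k, (v none : ℕ) = 2 ^ k) ∧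
    (v none : ℕ) < v (some i) := (is_two_pow none).and (lt _ _)
  have h2 : Def fun x (v : Option ι → Val x) => (v none : ℕ) < v (some j) := lt _ _
  refine ((is_two_pow i).and ((count_one (P := fun x v a => (∃ k, (a : ℕ) = 2 ^ k) ∧ (a : ℕ) < v i)
    (Q := fun x v a => (a : ℕ) < v j) h1 h2).and (count_one (Q := fun x v a =>
      (∃ k, (a : ℕ) = 2 ^ k) ∧ (a : ℕ) < v i) (P := fun x v a => (a : ℕ) < v j) h2 h1))).congr
      fun x v => ?_
  rw [ncard_fin_lt (v j).2.le]
  -- Below `2 ^ k` there are exactly `k` powers of two, so their number recovers the exponent.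
  have key : ∀ k, (v i : ℕ) = 2 ^ k →
      {a : Val x | (∃ k, (a : ℕ) = 2 ^ k) ∧ (a : ℕ) < v i}.ncard = k := by
    intro k hk
    have hb : ∀ l : Fin k, 2 ^ (l : ℕ) < bnd x.length := fun l =>
      (Nat.pow_lt_pow_right (by norm_num) l.2).trans (hk ▸ (v i).2)
    have : {a : Val x | (∃ k, (a : ℕ) = 2 ^ k) ∧ (a : ℕ) < v i} =
        Set.range fun l : Fin k => (⟨2 ^ (l : ℕ), hb l⟩ : Val x) := by
      ext a
      simp only [Set.mem_ofPred_eq, Set.mem_range]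
      constructor
      · rintro ⟨⟨l, hl⟩, h⟩
        rw [hl, hk, Nat.pow_lt_pow_iff_right (by norm_num)] at h
        exact ⟨⟨l, h⟩, Fin.ext hl.symm⟩
      · rintro ⟨l, rfl⟩
        exact ⟨⟨l, rfl⟩, hk ▸ Nat.pow_lt_pow_right (by norm_num) l.2⟩
    rw [this, ← Set.image_univ, Set.ncard_image_of_injective, Set.ncard_univ,
      Nat.card_eq_fintype_card, Fintype.card_fin]
    intro l l' h
    exact Fin.ext (Nat.pow_right_injective le_rfl (congrArg Fin.val h))
  constructor
  · intro h
    rw [key _ h]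
    exact ⟨⟨_, h⟩, le_rfl, le_rfl⟩
  · rintro ⟨⟨k, hk⟩, h1, h2⟩
    rw [key _ hk] at h1 h2
    rw [hk, le_antisymm h1 h2]

end Def

/-! ## Circuits for formulas with counting quantifiers -/

/-- Formulas with any number of free variables. -/
abbrev Fm : Type := Σ k, MF k

namespace MF

def subs : {k : ℕ} → MF k → Set Fm
  | k, .atom R h => {⟨k, .atom R h⟩}
  | k, .input i => {⟨k, .input i⟩}
  | k, .count d φ θ => insert ⟨k, .count d φ θ⟩ (φ.subs ∪ θ.subs)

theorem finite_subs {k : ℕ} (φ : MF k) : φ.subs.Finite := by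
  induction φ with
  | atom R h => exact Set.finite_singleton _
  | input i => exact Set.finite_singleton _
  | count d φ θ ih₁ ih₂ => exact (ih₁.union ih₂).insert _

theorem self_mem_subs {k : ℕ} (φ : MF k) : (⟨k, φ⟩ : Fm) ∈ φ.subs := by
  cases φ with
  | atom R h => exact rfl
  | input i => exact rfl
  | count d φ θ => exact Set.mem_insert _ _

theorem subs_subset {k k' : ℕ} {φ : MF k} {ψ : MF k'} (h : (⟨k', ψ⟩ : Fm) ∈ φ.subs) :
    ψ.subs ⊆ φ.subs := by
  induction φ with
  | atom R h' =>
    obtain ⟨rfl, h⟩ := Sigma.mk.inj_iff.1 (show (⟨k', ψ⟩ : Fm) = _ from h)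
    obtain rfl := eq_of_heq h
    exact subset_rfl
  | input i =>
    obtain ⟨rfl, h⟩ := Sigma.mk.inj_iff.1 (show (⟨k', ψ⟩ : Fm) = _ from h)
    obtain rfl := eq_of_heq h
    exact subset_rfl
  | count d φ θ ih₁ ih₂ =>
    rcases h with h | h | h
    · obtain ⟨rfl, h⟩ := Sigma.mk.inj_iff.1 h
      obtain rfl := eq_of_heq h
      exact subset_rfl
    · exact (ih₁ h).trans (Set.subset_union_left.trans (Set.subset_insert _ _))
    · exact (ih₂ h).trans (Set.subset_union_right.trans (Set.subset_insert _ _))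

def height : {k : ℕ} → MF k → ℕ
  | _, .atom _ _ => 0
  | _, .input _ => 0
  | _, .count _ φ θ => max φ.height θ.height + 1

/-- The kind of the gate of a formula, as a tag. -/
noncomputable def tag : {k : ℕ} → MF k → (n : ℕ) → (Fin k → ℕ) → ConnTag
  | _, .atom R _, n, v => open Classical in if R n v then .and else .or
  | _, .input i, n, v => if v i < n then .input else .or
  | _, .count _ _ _, _, _ => .maj

/-- The kind of the gate of a formula. -/
noncomputable def kind : {k : ℕ} → MF k → (n : ℕ) → (Fin k → ℕ) → GateKind n
  | _, .atom R _, n, v => open Classical in if R n v then .and else .or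
  | _, .input i, n, v => if h : v i < n then .input ⟨v i, h⟩ else .or
  | _, .count _ _ _, _, _ => .maj

end MF

def GateKind.tag {n : ℕ} : GateKind n → ConnTag
  | .input _ => .input
  | .not => .not
  | .and => .and
  | .or => .or
  | .maj => .maj

theorem MF.tag_kind {k : ℕ} (φ : MF k) (n : ℕ) (v : Fin k → ℕ) : (φ.kind n v).tag = φ.tag n v := by
  cases φ <;> simp only [MF.kind, MF.tag] <;> (try split_ifs) <;> rfl

theorem MF.kind_ne_not {k : ℕ} (φ : MF k) (n : ℕ) (v : Fin k → ℕ) : φ.kind n v ≠ .not := by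
  cases φ <;> simp only [MF.kind] <;> (try split_ifs) <;> simp

/-- A node: a subformula together with a flag that says whether it is negated. -/
abbrev Node (φ₀ : MF 0) : Type := {p : Fm // p ∈ φ₀.subs} × Bool

instance (φ₀ : MF 0) : Finite {p : Fm // p ∈ φ₀.subs} := φ₀.finite_subs

namespace Node

variable {φ₀ : MF 0}

/-- The factor `2` makes room for the negated copy of a node between its plain copy and the formulas
of the next height. -/
def rank (p : Node φ₀) : ℕ := 2 * p.1.1.2.height + p.2.toNat

/-- The gates of node `q` feed gates of node `p`. -/
def Edge (p q : Node φ₀) : Prop :=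
  (p.2 = true ∧ q = (p.1, false)) ∨ (p.2 = false ∧ ∃ (k d : ℕ) (φ θ : MF (k + d)),
    p.1.1 = ⟨k, .count d φ θ⟩ ∧
      ((q.1.1 = ⟨k + d, φ⟩ ∧ q.2 = false) ∨ (q.1.1 = ⟨k + d, θ⟩ ∧ q.2 = true)))

/-- Variable `i` is not quantified at the node. -/
def Fixed (p : Node φ₀) (i : ℕ) : Prop :=
  p.2 = true ∨ ∀ (k d : ℕ) (φ θ : MF (k + d)), p.1.1 = ⟨k, .count d φ θ⟩ → i < k ∨ k + d ≤ i

theorem rank_lt {p q : Node φ₀} (h : Edge p q) : q.rank < p.rank := by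
  have hh : ∀ p q : Fm, p = q → p.2.height = q.2.height := fun p q e => e ▸ rfl
  rcases h with ⟨h1, rfl⟩ | ⟨h1, k, d, φ, θ, h2, ⟨h3, h4⟩ | ⟨h3, h4⟩⟩
  · simp [rank, h1]
  · have := le_max_left φ.height θ.height
    have e1 : p.1.1.2.height = max φ.height θ.height + 1 := hh _ _ h2
    have e2 : q.1.1.2.height = φ.height := hh _ _ h3
    simp only [rank, h1, e1, e2, h4, Bool.toNat_false]
    omega
  · have := le_max_right φ.height θ.height
    have e1 : p.1.1.2.height = max φ.height θ.height + 1 := hh _ _ h2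
    have e2 : q.1.1.2.height = θ.height := hh _ _ h3
    simp only [rank, h1, e1, e2, h4, Bool.toNat_false, Bool.toNat_true]
    omega

end Node

/-- An assignment of tracks of gate numbers to the variables and nodes of a formula. -/
structure Layout (φ₀ : MF 0) where
  V : ℕ
  M : ℕ
  le : ∀ p ∈ φ₀.subs, p.1 ≤ V
  e : Node φ₀ ≃ Fin M

theorem exists_layout (φ₀ : MF 0) : Nonempty (Layout φ₀) := by
  obtain ⟨M, ⟨e⟩⟩ := Finite.exists_equiv_fin (Node φ₀)
  obtain ⟨V, hV⟩ := (φ₀.finite_subs.image Sigma.fst).bddAbove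
  exact ⟨⟨V, M, fun p hp => hV ⟨p, hp, rfl⟩, e⟩⟩

namespace Layout

variable {φ₀ : MF 0} (L : Layout φ₀)

abbrev c : ℕ := L.V + L.M

instance : NeZero L.c :=
  ⟨fun h => by
    have h1 : L.M = 0 := (Nat.add_eq_zero_iff.1 h).2
    exact Fin.elim0 (h1 ▸ L.e (⟨⟨0, φ₀⟩, φ₀.self_mem_subs⟩, false))⟩

def varTrack (i : Fin L.V) : Fin L.c := Fin.castAdd L.M i

def nodeTrack (j : Fin L.M) : Fin L.c := Fin.natAdd L.V j

/-- The node tracks of a gate number contain the code of `p`. -/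
def IsNode (p : Node φ₀) (n : ℕ) (g : Fin L.c → ℕ) : Prop :=
  ∀ j, g (L.nodeTrack j) = if L.e p = j then 2 * n + 1 else 0

theorem isNode_inj {p q : Node φ₀} {n : ℕ} {g : Fin L.c → ℕ} (hp : L.IsNode p n g)
    (hq : L.IsNode q n g) : p = q := by
  have h1 := hp (L.e p)
  rw [hq, if_pos rfl] at h1
  split_ifs at h1 with h
  exact (L.e.injective h).symm

abbrev size (n : ℕ) : ℕ := 2 ^ (L.c * (n.size + 1))

def vec (n : ℕ) : Fin (L.size n) ≃ (Fin L.c → Fin (bnd n)) :=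
  trackEquiv L.c (n.size + 1) (NeZero.pos _)

/-- The tracks of a gate number. -/
def trk {n : ℕ} (a : Fin (L.size n)) : Fin L.c → ℕ := fun i => L.vec n a i

def vars {n : ℕ} (a : Fin (L.size n)) : Fin L.V → Fin (bnd n) := fun i => L.vec n a (L.varTrack i)

open Classical in
noncomputable def nodeOf {n : ℕ} (a : Fin (L.size n)) : Option (Node φ₀) :=
  if h : ∃ p, L.IsNode p n (L.trk a) then some h.choose else none

theorem nodeOf_eq_some {n : ℕ} {a : Fin (L.size n)} {p : Node φ₀} :
    L.nodeOf a = some p ↔ L.IsNode p n (L.trk a) := by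
  unfold nodeOf
  split_ifs with h
  · rw [Option.some_inj]
    exact ⟨fun e => e ▸ h.choose_spec, fun hp => L.isNode_inj h.choose_spec hp⟩
  · simp only [false_iff]
    exact fun hp => h ⟨p, hp⟩

theorem nodeOf_eq_none {n : ℕ} {a : Fin (L.size n)} :
    L.nodeOf a = none ↔ ∀ p, ¬ L.IsNode p n (L.trk a) := by
  rw [Option.eq_none_iff_forall_ne_some]
  exact forall_congr' fun p => not_congr L.nodeOf_eq_some

/-- The mark `2 * n + 1` of a node is never `0`, the value of unmarked tracks. It needs one bit more
than `n`, which is provided by the exponent `n.size + 1` in `bnd`. -/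
theorem code_lt (n : ℕ) : 2 * n + 1 < bnd n := by
  have := Nat.lt_size_self n
  rw [bnd, pow_succ]
  omega

/-- The gate of a node and a family of values of the variables. -/
def enc {n : ℕ} (p : Node φ₀) (v : Fin L.V → Fin (bnd n)) : Fin (L.size n) :=
  (L.vec n).symm (Fin.append v fun j => if L.e p = j then ⟨2 * n + 1, code_lt n⟩
    else ⟨0, bnd_pos n⟩)

theorem vars_enc {n : ℕ} (p : Node φ₀) (v : Fin L.V → Fin (bnd n)) : L.vars (L.enc p v) = v := by
  funext i
  simp only [vars, enc, Equiv.apply_symm_apply]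
  exact Fin.append_left _ _ i

theorem isNode_enc {n : ℕ} (p : Node φ₀) (v : Fin L.V → Fin (bnd n)) :
    L.IsNode p n (L.trk (L.enc p v)) := by
  intro j
  simp only [trk, enc, Equiv.apply_symm_apply, nodeTrack]
  refine (congrArg Fin.val (Fin.append_right _ _ j)).trans ?_
  split_ifs <;> rfl

theorem nodeOf_enc {n : ℕ} (p : Node φ₀) (v : Fin L.V → Fin (bnd n)) :
    L.nodeOf (L.enc p v) = some p := L.nodeOf_eq_some.2 (L.isNode_enc p v)

theorem enc_vars {n : ℕ} {a : Fin (L.size n)} {p : Node φ₀} (h : L.nodeOf a = some p) :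
    L.enc p (L.vars a) = a := by
  rw [enc, Equiv.symm_apply_eq]
  funext i
  refine Fin.addCases (fun i => ?_) (fun j => ?_) i
  · exact Fin.append_left _ _ i
  · refine (Fin.append_right _ _ j).trans (Fin.ext ?_)
    have := L.nodeOf_eq_some.1 h j
    refine Eq.trans ?_ this.symm
    split_ifs <;> rfl

/-- The variables of a subformula. -/
def restrict {n : ℕ} (p : Node φ₀) (v : Fin L.V → Fin (bnd n)) : Fin p.1.1.1 → Fin (bnd n) :=
  fun i => v (Fin.castLE (L.le _ p.1.2) i)

/-- Numbers that code no node are gates as well: disjunctions without children, not connected to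
anything. Thus the gate numbers fill a whole power of two. -/
noncomputable def gateKind {n : ℕ} (a : Fin (L.size n)) : GateKind n :=
  match L.nodeOf a with
  | none => .or
  | some p => if p.2 then .not else p.1.1.2.kind n fun i => L.restrict p (L.vars a) i

/-- Gate `b` feeds gate `a`. -/
def Child {n : ℕ} (a b : Fin (L.size n)) : Prop :=
  ∃ p q, L.nodeOf a = some p ∧ L.nodeOf b = some q ∧ p.Edge q ∧
    ∀ i : Fin L.V, p.Fixed i → L.vars b i = L.vars a i

noncomputable def gateRank {n : ℕ} (a : Fin (L.size n)) : ℕ := ((L.nodeOf a).map Node.rank).getD 0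

/-- This gives acyclicity at once, and constant depth because the finitely many ranks do not depend
on `n`. -/
theorem gateRank_lt {n : ℕ} {a b : Fin (L.size n)} (h : L.Child a b) :
    L.gateRank b < L.gateRank a := by
  obtain ⟨p, q, h1, h2, h3, -⟩ := h
  simpa [gateRank, h1, h2] using Node.rank_lt h3

theorem child_not {n : ℕ} {a b : Fin (L.size n)} {p : {p : Fm // p ∈ φ₀.subs}}
    (h : L.nodeOf a = some (p, true)) : L.Child a b ↔ b = L.enc (p, false) (L.vars a) := by
  constructor
  · rintro ⟨p', q, h1, h2, h3, h4⟩
    obtain rfl := Option.some_inj.1 (h.symm.trans h1)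
    rcases h3 with ⟨-, rfl⟩ | ⟨h3, -⟩
    · rw [← L.enc_vars h2]
      congr 1
      exact funext fun i => h4 i (Or.inl rfl)
    · exact absurd h3 (by simp)
  · rintro rfl
    refine ⟨_, _, h, L.nodeOf_enc _ _, Or.inl ⟨rfl, rfl⟩, fun i _ => ?_⟩
    rw [vars_enc]

open Classical in
noncomputable abbrev circuit (n : ℕ) : Circuit n where
  size := L.size n
  kind := L.gateKind
  children a := Finset.univ.filter (L.Child a)
  output := L.enc (⟨⟨0, φ₀⟩, φ₀.self_mem_subs⟩, false) fun _ => ⟨0, bnd_pos n⟩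
  input_children a i h := by
    rw [Finset.filter_eq_empty_iff]
    rintro b -
    rintro ⟨p, q, h1, h2, h3, -⟩
    simp only [gateKind, h1] at h
    rcases h3 with ⟨h3, -⟩ | ⟨h3, k, d, φ, θ, h4, -⟩
    · rw [h3] at h
      simp at h
    · rw [h3] at h
      obtain ⟨⟨⟨k', ψ⟩, hp⟩, b⟩ := p
      obtain ⟨rfl, h4⟩ := Sigma.mk.inj_iff.1 h4
      obtain rfl := eq_of_heq h4
      simp [MF.kind] at h
  not_children a h := by
    unfold gateKind at h
    split at h
    · simp at h
    · rename_i p hp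
      split_ifs at h with h'
      · obtain ⟨p, b⟩ := p
        obtain rfl : b = true := h'
        have : Finset.univ.filter (L.Child a) = {L.enc (p, false) (L.vars a)} := by
          ext b
          simp [L.child_not hp]
        rw [this, Finset.card_singleton]
      · exact absurd h (MF.kind_ne_not _ _ _)
  acyclic := by
    refine Subrelation.wf (r := InvImage (· < ·) L.gateRank) ?_ (InvImage.wf _ wellFounded_lt)
    intro b a h
    exact L.gateRank_lt (by simpa using h)

theorem mem_children {n : ℕ} (a b : Fin (L.size n)) :
    b ∈ (L.circuit n).children a ↔ L.Child a b := by
  simp [circuit]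

theorem depth_le : ∃ d, ∀ n, (L.circuit n).depth ≤ d := by
  obtain ⟨d, hd⟩ := (Set.finite_range (Node.rank (φ₀ := φ₀))).bddAbove
  have hg : ∀ n (a : Fin (L.size n)), L.gateRank a ≤ d := by
    intro n a
    unfold gateRank
    cases h : L.nodeOf a with
    | none => simp
    | some p => simpa using hd ⟨p, rfl⟩
  have key : ∀ n r (a : Fin (L.size n)), L.gateRank a = r → (L.circuit n).gateDepth a ≤ r := by
    intro n r
    induction r using Nat.strong_induction_on with
    | _ r ih =>
      intro a ha
      rw [Circuit.gateDepth_eq]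
      refine Finset.sup_le fun b _ => ?_
      have hb := L.gateRank_lt ((L.mem_children a b).1 b.2)
      exact (ih _ (ha ▸ hb) b rfl).trans_lt (ha ▸ hb)
  exact ⟨d, fun n => Finset.sup_le fun a _ => (key n _ a rfl).trans (hg n a)⟩

theorem size_le : ∃ e, ∀ n, (L.circuit n).size ≤ n ^ e + e := by
  -- For `n < 2` the additive constant `8 ^ c` is enough, as `n.size + 1 ≤ 3`. For `n ≥ 2` one has
  -- `2 ^ (n.size + 1) ≤ 4 * n ≤ n ^ 4`, which explains the exponent `4 * c`.
  refine ⟨8 ^ L.c + 4 * L.c, fun n => ?_⟩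
  change 2 ^ (L.c * (n.size + 1)) ≤ _
  rw [mul_comm, pow_mul]
  rcases lt_or_ge n 2 with h | h
  · have h1 : n.size + 1 ≤ 3 := by
      have : n.size ≤ 2 := Nat.size_le.2 (by omega)
      omega
    have h2 : 2 ^ (n.size + 1) ≤ 8 := Nat.pow_le_pow_right (by norm_num) h1
    have h3 := Nat.pow_le_pow_left h2 L.c
    omega
  · have h1 : 2 ^ (n.size - 1) ≤ n := by
      have : n.size - 1 < n.size := Nat.sub_lt (Nat.size_pos.2 (by omega)) one_pos
      exact Nat.lt_size.1 this
    have h2 : 2 ^ (n.size + 1) ≤ n ^ 4 := by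
      have h3 : 0 < n.size := Nat.size_pos.2 (by omega)
      have h4 : 2 ^ (n.size + 1) = 4 * 2 ^ (n.size - 1) := by
        rw [show n.size + 1 = 2 + (n.size - 1) by omega, pow_add]; norm_num
      rw [h4]
      calc 4 * 2 ^ (n.size - 1) ≤ (2 * 2) * n := Nat.mul_le_mul_left 4 h1
        _ ≤ (n * n) * n := Nat.mul_le_mul_right _ (Nat.mul_le_mul h h)
        _ = n ^ 3 := by ring
        _ ≤ n ^ 4 := Nat.pow_le_pow_right (by omega) (by norm_num)
    calc (2 ^ (n.size + 1)) ^ L.c ≤ (n ^ 4) ^ L.c := Nat.pow_le_pow_left h2 _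
      _ = n ^ (4 * L.c) := by rw [pow_mul]
      _ ≤ n ^ (8 ^ L.c + 4 * L.c) := Nat.pow_le_pow_right (by omega) (Nat.le_add_left _ _)
      _ ≤ _ := Nat.le_add_right _ _

end Layout

/-- With `N` tuples the gate has `2 * N` children, of which `#P + (N - #Q)` are true. This is at
least half of them iff `#Q ≤ #P`. -/
theorem GateKind.value_maj {n : ℕ} (x : Fin n → Bool) {ι α : Type} [Fintype ι] [Fintype α]
    (val : ι → Bool) (f : α ⊕ α ≃ ι) (P Q : α → Prop) (hP : ∀ u, val (f (.inl u)) = true ↔ P u)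
    (hQ : ∀ u, val (f (.inr u)) = true ↔ ¬ Q u) :
    GateKind.value x val .maj = true ↔ {u | Q u}.ncard ≤ {u | P u}.ncard := by
  classical
  have h1 : Fintype.card ι = 2 * Fintype.card α := by
    rw [← Fintype.card_congr f, Fintype.card_sum]; omega
  have h2 : (Finset.univ.filter fun j => val j = true).card =
      (Finset.univ.filter P).card + (Finset.univ.filter fun u => ¬ Q u).card := by
    rw [← Finset.card_map f.symm.toEmbedding, ← Finset.card_disjSum]
    congr 1
    ext u
    rcases u with u | u
    · simp [Finset.mem_map_equiv, hP]
    · simp [Finset.mem_map_equiv, hQ]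
  have h3 := Finset.card_filter_add_card_filter_not (s := Finset.univ) Q
  have h4 : ∀ R : α → Prop, {u | R u}.ncard = (Finset.univ.filter R).card := by
    intro R
    rw [Set.ncard_eq_toFinset_card']
    congr 1
    ext; simp
  simp only [GateKind.value, decide_eq_true_iff, h1, h2, h4]
  rw [Finset.card_univ] at h3
  omega

/-! ### Evaluation of the circuit -/

namespace Layout

variable {φ₀ : MF 0} (L : Layout φ₀)

/-- Replacing the values of the variables `k, …, k + d - 1`. -/
def override {n : ℕ} (k d : ℕ) (v : Fin L.V → Fin (bnd n)) (u : Fin d → Fin (bnd n)) :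
    Fin L.V → Fin (bnd n) := fun i =>
  if h : k ≤ i ∧ (i : ℕ) < k + d then u ⟨i - k, by omega⟩ else v i

theorem eval_not {n : ℕ} (x : Fin n → Bool) (p : {p : Fm // p ∈ φ₀.subs})
    (v : Fin L.V → Fin (bnd n)) : (L.circuit n).eval x (L.enc (p, true) v) =
      !(L.circuit n).eval x (L.enc (p, false) v) := by
  rw [Circuit.eval_eq]
  have hk : (L.circuit n).kind (L.enc (p, true) v) = .not := by
    change L.gateKind _ = _
    simp [gateKind, nodeOf_enc]
  have hc : ∀ b, b ∈ (L.circuit n).children (L.enc (p, true) v) ↔ b = L.enc (p, false) v := by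
    intro b
    rw [mem_children, L.child_not (L.nodeOf_enc _ _), vars_enc]
  rw [hk, Bool.eq_iff_iff]
  simp only [GateKind.value, decide_eq_true_iff]
  constructor
  · rintro ⟨⟨b, hb⟩, h⟩
    obtain rfl := (hc b).1 hb
    simpa using h
  · intro h
    exact ⟨⟨_, (hc _).2 rfl⟩, by simpa using h⟩

/-- Wires also copy the variables from `k + d` on, which `φ` and `θ` do not use. Hence each tuple
`u` contributes exactly one gate for `φ` and one for the negation of `θ`. -/
theorem child_count {n : ℕ} {k d : ℕ} {φ θ : MF (k + d)}
    (h : (⟨k, .count d φ θ⟩ : Fm) ∈ φ₀.subs) (h₁ : (⟨k + d, φ⟩ : Fm) ∈ φ₀.subs)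
    (h₂ : (⟨k + d, θ⟩ : Fm) ∈ φ₀.subs) (v : Fin L.V → Fin (bnd n)) (b : Fin (L.size n)) :
    L.Child (L.enc (⟨_, h⟩, false) v) b ↔ ∃ u, b = L.enc (⟨_, h₁⟩, false) (L.override k d v u) ∨
      b = L.enc (⟨_, h₂⟩, true) (L.override k d v u) := by
  constructor
  · rintro ⟨p, q, e1, e2, e3, e4⟩
    rw [nodeOf_enc, Option.some_inj] at e1
    subst e1
    rw [vars_enc] at e4
    rcases e3 with ⟨e3, -⟩ | ⟨-, k', d', φ', θ', e5, e6⟩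
    · exact absurd e3 (by simp)
    · obtain ⟨rfl, e5⟩ := Sigma.mk.inj_iff.1 e5
      obtain ⟨rfl, e7, e8⟩ := MF.count.inj (eq_of_heq e5)
      obtain rfl := eq_of_heq e7
      obtain rfl := eq_of_heq e8
      have hk := L.le _ h₁
      have hv : L.vars b = L.override k d v fun i => L.vars b ⟨k + i, by simp at hk; omega⟩ := by
        funext i
        unfold override
        split_ifs with hi
        · congr 1
          refine Fin.ext ?_
          simp
          omega
        · refine e4 i (Or.inr ?_)
          intro k' d' φ' θ' e9
          obtain ⟨rfl, e9⟩ := Sigma.mk.inj_iff.1 e9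
          obtain ⟨rfl, -⟩ := MF.count.inj (eq_of_heq e9)
          omega
      refine ⟨fun i => L.vars b ⟨k + i, by simp at hk; omega⟩, ?_⟩
      rw [← hv, ← L.enc_vars e2, vars_enc]
      obtain ⟨⟨q, hq⟩, t⟩ := q
      rcases e6 with ⟨e6, e7⟩ | ⟨e6, e7⟩
      · simp only at e6 e7
        subst e6 e7
        exact Or.inl rfl
      · simp only at e6 e7
        subst e6 e7
        exact Or.inr rfl
  · rintro ⟨u, rfl | rfl⟩
    all_goals
      refine ⟨_, _, L.nodeOf_enc _ _, L.nodeOf_enc _ _, Or.inr ⟨rfl, k, d, φ, θ, rfl, ?_⟩, ?_⟩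
      · simp
      · rintro i (hi | hi)
        · exact absurd hi (by simp)
        · have := hi k d φ θ rfl
          rw [vars_enc, vars_enc, override, dif_neg (by omega)]

theorem restrict_override {n : ℕ} {k d : ℕ} (hk : k + d ≤ L.V) (v : Fin L.V → Fin (bnd n))
    (u : Fin d → Fin (bnd n)) : (fun i => L.override k d v u (Fin.castLE hk i)) =
      Fin.append (fun i => v (Fin.castLE (by omega) i)) u := by
  funext i
  refine Fin.addCases (fun i => ?_) (fun j => ?_) i
  · simp only [override]
    rw [dif_neg (by simp), Fin.append_left]
    rfl
  · simp [override]

theorem override_injective {n : ℕ} {k d : ℕ} (hk : k + d ≤ L.V) (v : Fin L.V → Fin (bnd n)) :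
    Function.Injective (L.override k d v) := by
  intro u u' h
  have := (L.restrict_override hk v u).symm.trans
    ((congrArg (fun w i => w (Fin.castLE hk i)) h).trans (L.restrict_override hk v u'))
  funext j
  simpa using congrFun this (Fin.natAdd k j)

/-- Induction on the formula. The values of variables that are not free in the subformula are
arbitrary, which is what the inductive step needs. -/
theorem eval_enc (x : List Bool) {k : ℕ} (φ : MF k) (h : (⟨k, φ⟩ : Fm) ∈ φ₀.subs)
    (v : Fin L.V → Val x) : (L.circuit x.length).eval x.get (L.enc (⟨⟨k, φ⟩, h⟩, false) v) = true ↔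
      φ.Sat x fun i => v (Fin.castLE (L.le _ h) i) := by
  induction φ generalizing v with
  | @atom k R hR =>
    rw [Circuit.eval_eq]
    have hk : (L.circuit x.length).kind (L.enc (⟨⟨k, .atom R hR⟩, h⟩, false) v) =
        open Classical in if R x.length fun i => v (Fin.castLE (L.le _ h) i) then .and else .or := by
      change L.gateKind _ = _
      simp only [gateKind, nodeOf_enc, vars_enc]
      rfl
    have hc : ∀ b, b ∉ (L.circuit x.length).children (L.enc (⟨⟨k, .atom R hR⟩, h⟩, false) v) := by
      intro b
      rw [mem_children]
      rintro ⟨p, q, e1, e2, e3, -⟩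
      rw [nodeOf_enc, Option.some_inj] at e1
      subst e1
      rcases e3 with ⟨e3, -⟩ | ⟨-, k', d', φ', θ', e5, -⟩
      · exact absurd e3 (by simp)
      · obtain ⟨rfl, e5⟩ := Sigma.mk.inj_iff.1 e5
        exact absurd (eq_of_heq e5) (by simp)
    -- The atom is a constant: a conjunction without children is true, a disjunction without
    -- children is false.
    rw [hk]
    split_ifs with hR'
    · simp only [GateKind.value, decide_eq_true_iff]
      exact ⟨fun _ => hR', fun _ j => absurd j.2 (hc _)⟩
    · simp only [GateKind.value, decide_eq_true_iff]
      exact ⟨fun ⟨j, _⟩ => absurd j.2 (hc _), fun h' => absurd h' hR'⟩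
  | @input k i =>
    rw [Circuit.eval_eq]
    have hk : (L.circuit x.length).kind (L.enc (⟨⟨k, .input i⟩, h⟩, false) v) =
        if h' : (v (Fin.castLE (L.le _ h) i) : ℕ) < x.length then .input ⟨_, h'⟩ else .or := by
      change L.gateKind _ = _
      simp only [gateKind, nodeOf_enc, vars_enc]
      rfl
    rw [hk]
    split_ifs with h'
    · simp [GateKind.value, MF.Sat, h']
    -- A position outside the word reads as false, and so does the disjunction without children that
    -- replaces its input gate.
    · simp only [GateKind.value, MF.Sat, decide_eq_true_iff]
      rw [List.getElem?_eq_none (by omega)]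
      simp only [reduceCtorEq, iff_false]
      rintro ⟨b, -⟩
      have hb := b.2
      rw [mem_children] at hb
      obtain ⟨p, q, e1, e2, e3, -⟩ := hb
      rw [nodeOf_enc, Option.some_inj] at e1
      subst e1
      rcases e3 with ⟨e3, -⟩ | ⟨-, k', d', φ', θ', e5, -⟩
      · exact absurd e3 (by simp)
      · obtain ⟨rfl, e5⟩ := Sigma.mk.inj_iff.1 e5
        exact absurd (eq_of_heq e5) (by simp)
  | @count k d φ θ ih₁ ih₂ =>
    have h₁ : (⟨k + d, φ⟩ : Fm) ∈ φ₀.subs :=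
      MF.subs_subset h (Set.mem_insert_of_mem _ (Or.inl φ.self_mem_subs))
    have h₂ : (⟨k + d, θ⟩ : Fm) ∈ φ₀.subs :=
      MF.subs_subset h (Set.mem_insert_of_mem _ (Or.inr θ.self_mem_subs))
    have hV := L.le _ h₁
    rw [Circuit.eval_eq]
    have hk : (L.circuit x.length).kind (L.enc (⟨⟨k, .count d φ θ⟩, h⟩, false) v) = .maj := by
      change L.gateKind _ = _
      simp only [gateKind, nodeOf_enc]
      rfl
    rw [hk]
    -- The children are two disjoint copies of the set of tuples: the left one for `φ`, the right
    -- one for the negated `θ`.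
    let g : (Fin d → Val x) ⊕ (Fin d → Val x) →
        (L.circuit x.length).children (L.enc (⟨⟨k, .count d φ θ⟩, h⟩, false) v) :=
      Sum.elim (fun u => ⟨_, (L.mem_children _ _).2 ((L.child_count h h₁ h₂ v _).2
        ⟨u, Or.inl rfl⟩)⟩) (fun u => ⟨_, (L.mem_children _ _).2 ((L.child_count h h₁ h₂ v _).2
        ⟨u, Or.inr rfl⟩)⟩)
    have hg : Function.Bijective g := by
      have hn : ∀ {p q : Node φ₀} {v v' : Fin L.V → Val x}, L.enc p v = L.enc q v' →
          p = q ∧ v = v' := by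
        intro p q v v' hpq
        refine ⟨?_, by rw [← L.vars_enc p v, hpq, L.vars_enc]⟩
        have := congrArg L.nodeOf hpq
        rwa [nodeOf_enc, nodeOf_enc, Option.some_inj] at this
      constructor
      · rintro (u | u) (u' | u') huu
        · rw [L.override_injective hV v (hn (congrArg Subtype.val huu)).2]
        · exact absurd (congrArg Prod.snd (hn (congrArg Subtype.val huu)).1) (by simp)
        · exact absurd (congrArg Prod.snd (hn (congrArg Subtype.val huu)).1) (by simp)
        · rw [L.override_injective hV v (hn (congrArg Subtype.val huu)).2]
      · rintro ⟨b, hb⟩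
        obtain ⟨u, rfl | rfl⟩ := (L.child_count h h₁ h₂ v b).1 ((L.mem_children _ _).1 hb)
        · exact ⟨.inl u, rfl⟩
        · exact ⟨.inr u, rfl⟩
    refine GateKind.value_maj x.get _ (Equiv.ofBijective g hg) _ _ (fun u => ?_) (fun u => ?_)
    · refine (ih₁ h₁ (L.override k d v u)).trans ?_
      rw [L.restrict_override hV]
    · refine Iff.trans ?_ (not_congr ((ih₂ h₂ (L.override k d v u)).trans ?_))
      · change (L.circuit x.length).eval x.get (L.enc (⟨⟨k + d, θ⟩, h₂⟩, true) _) = true ↔ _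
        rw [eval_not]
        simp
      · rw [L.restrict_override hV]

theorem eval_output (x : List Bool) : (L.circuit x.length).eval x.get
    (L.circuit x.length).output = true ↔ φ₀.Sat x Fin.elim0 := by
  refine (L.eval_enc x φ₀ φ₀.self_mem_subs _).trans ?_
  congr! 1

end Layout

/-! ## A random-access machine for direct connection languages -/

namespace ConnMachine

/-- `grow` puts ones on the index tape until the address leaves the input, which yields the number
of bits of the length. `drop` and `test` determine these bits from the top, and `clear` and `ret`
reset the index tape. After `tag`, the phases `inc` and `back` increment the address and return to
cell `0`, and `parse` handles one symbol. `rewind` returns to the start of the main tape after each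
number, and `scan` runs the automaton. During index operations the ruler head moves with the index
head and shows when that head is at cell `0`. -/
inductive Phase
  | start | grow | drop | test | clear | ret | tag | inc | back | parse | rewind | scan | halt

instance : Finite Phase := by
  refine Finite.of_injective (β := Fin 13) (fun p => match p with
    | .start => 0 | .grow => 1 | .drop => 2 | .test => 3 | .clear => 4 | .ret => 5 | .tag => 6
    | .inc => 7 | .back => 8 | .parse => 9 | .rewind => 10 | .scan => 11 | .halt => 12) ?_
  intro p q h
  cases p <;> cases q <;> first | rfl | (exact absurd h (by decide))

/-- The control state. -/
structure St (c : ℕ) (Q : Type) where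
  phase : Phase
  tag : ConnTag
  second : Bool
  cnt : Fin c
  flag : Bool
  q : Q

end ConnMachine

instance : Finite ConnTag := by
  refine Finite.of_injective (β := Fin 7) (fun p => match p with
    | .output => 0 | .input => 1 | .not => 2 | .and => 3 | .or => 4 | .maj => 5 | .child => 6) ?_
  intro p q h
  cases p <;> cases q <;> first | rfl | (exact absurd h (by decide))

namespace ConnMachine

instance {c : ℕ} {Q : Type} [Finite Q] : Finite (St c Q) :=
  Finite.of_injective (β := Phase × ConnTag × Bool × Fin c × Bool × Q)
    (fun s => (s.phase, s.tag, s.second, s.cnt, s.flag, s.q)) (by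
      rintro ⟨⟩ ⟨⟩ h
      simp only [Prod.mk.injEq] at h
      simpa using h)

/-- The contents of a cell: a bit of the length of the word, and one bit of each track of the two
gate numbers. -/
abbrev Cell (c : ℕ) : Type := Option (Bool × (Fin c → Bool) × (Fin c → Bool))

/-- What is done in a step: the new state, and the symbols written and the movements on the
index tape, the main tape and the ruler. -/
structure Act (c : ℕ) (Q : Type) where
  st : St c Q
  ib : Bool
  im : Move
  g : Cell c
  gm : Move
  m : Cell c
  mm : Move

variable {c : ℕ} {Q : Type}

def Act.stay (s : St c Q) (ib : Bool) (g m : Cell c) : Act c Q := ⟨s, ib, .stay, g, .stay, m, .stay⟩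

/-- The number of bits per cell in which a number is stored: the input number is not split
into tracks. -/
def blockSize (c : ℕ) (t : ConnTag) (second : Bool) : ℕ :=
  match t, second with
  | .input, true => 1
  | _, _ => c

def zeroCell (c : ℕ) : Cell c := some (false, fun _ => false, fun _ => false)

/-- The tape with cells `0, …, W - 1` in use. -/
def row (W : ℕ) (X : ℕ → Bool) (A B : ℕ → Fin c → Bool) : ℤ → Cell c := fun z =>
  if 0 ≤ z ∧ z < W then some (X z.toNat, A z.toNat, B z.toNat) else none

/-- The ruler, whose only mark is at cell `0`. -/
def ruler (c : ℕ) : ℤ → Cell c := Function.update (fun _ => none) 0 (zeroCell c)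

theorem row_of_lt {W : ℕ} {X : ℕ → Bool} {A B : ℕ → Fin c → Bool} {j : ℕ} (h : j < W) :
    row W X A B (j : ℤ) = some (X j, A j, B j) := by
  simp [row, h]

theorem row_of_ge {W : ℕ} {X : ℕ → Bool} {A B : ℕ → Fin c → Bool} {j : ℕ} (h : W ≤ j) :
    row W X A B (j : ℤ) = none := by
  simp [row, h]

theorem row_neg_one {W : ℕ} {X : ℕ → Bool} {A B : ℕ → Fin c → Bool} :
    row W X A B (-1) = none := by
  simp [row]

theorem update_row {W : ℕ} {X : ℕ → Bool} {A B : ℕ → Fin c → Bool} {j : ℕ} (h : j < W)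
    (x : Bool) (a b : Fin c → Bool) :
    Function.update (row W X A B) (j : ℤ) (some (x, a, b)) =
      row W (Function.update X j x) (Function.update A j a) (Function.update B j b) := by
  funext z
  by_cases hz : z = j
  · subst hz
    simp [row, h]
  · rw [Function.update_of_ne hz]
    unfold row
    split_ifs with h1
    · have : z.toNat ≠ j := by omega
      simp [Function.update_of_ne this]
    · rfl

theorem ruler_zero : (ruler c) 0 = zeroCell c := by simp [ruler]

theorem ruler_succ (j : ℕ) : (ruler c) ((j : ℤ) + 1) = none := by
  rw [ruler, Function.update_of_ne (by omega)]

variable [NeZero c]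

open Classical in
/-- The transition function. -/
noncomputable def act (start : Q) (step : Q → Bool → (Fin c ⊕ Fin c → Bool) → Q)
    (acc : ConnTag → Q → Prop) (s : St c Q) (sym : Option ConnSymbol) (ib : Bool) (g m : Cell c) :
    Act c Q :=
  match s.phase with
  | .start => .stay { s with phase := .grow } ib g (zeroCell c)
  | .grow =>
    match sym with
    | some _ => ⟨s, true, .right, zeroCell c, .right, m, .right⟩
    | none => if m.isSome then .stay { s with phase := .halt, flag := false } ib g m
      else ⟨{ s with phase := .drop }, ib, .left, zeroCell c, .left, m, .left⟩
  | .drop => .stay { s with phase := .test } false g m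
  | .test =>
    if m.isSome then
      .stay { s with phase := .clear } sym.isSome (g.map fun p => (sym.isSome, p.2)) m
    else ⟨{ s with phase := .drop }, sym.isSome, .left, g.map fun p => (sym.isSome, p.2), .left,
      m, .left⟩
  | .clear =>
    if g.isSome then ⟨s, false, .right, g, .right, m, .right⟩
    else ⟨{ s with phase := .ret }, ib, .left, g, .left, m, .left⟩
  | .ret =>
    if m.isSome then .stay { s with phase := .tag } ib g m
    else ⟨s, ib, .left, g, .left, m, .left⟩
  | .tag =>
    match sym with
    | some (.tag t) => .stay ⟨.inc, t, false, 0, true, s.q⟩ ib g m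
    | _ => .stay { s with phase := .halt, flag := false } ib g m
  | .inc =>
    if ib then ⟨s, false, .right, g, .stay, m, .right⟩
    else .stay { s with phase := .back } true g m
  | .back =>
    if m.isSome then .stay { s with phase := .parse } ib g m
    else ⟨s, ib, .left, g, .stay, m, .left⟩
  | .parse =>
    match sym, g with
    | some (.bit d), some (x, a, b) =>
      let g' := if s.second then some (x, a, Function.update b s.cnt d)
        else some (x, Function.update a s.cnt d, b)
      if (s.cnt : ℕ) + 1 = blockSize c s.tag s.second then
        ⟨{ s with phase := .inc, flag := d, cnt := 0 }, ib, .stay, g', .right, m, .stay⟩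
      else .stay { s with phase := .inc, flag := d, cnt := s.cnt + 1 } ib g' m
    | some .sep, _ =>
      -- The flag is the last bit read, so a leading zero is rejected. It is initially true because
      -- the expansion of `0` is empty.
      if s.flag then ⟨{ s with phase := .rewind, cnt := 0 }, ib, .stay, g, .left, m, .stay⟩
      else .stay { s with phase := .halt, flag := false } ib g m
    | _, _ => .stay { s with phase := .halt, flag := false } ib g m
  | .rewind =>
    if g.isSome then ⟨s, ib, .stay, g, .left, m, .stay⟩
    -- From here on the flag is a borrow. It starts as true: the address is the position of the last
    -- separator, and the length of what follows is the total length minus the address minus one.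
    else if s.second then ⟨{ s with phase := .scan, flag := true, q := start }, ib, .stay, g, .right, m, .stay⟩
    else ⟨{ s with phase := .inc, second := true, flag := true }, ib, .stay, g, .right, m, .stay⟩
  | .scan =>
    match g with
    | some (x, a, b) =>
      ⟨{ s with flag := (!x && (ib || s.flag)) || (ib && s.flag),
                q := step s.q ((x ^^ ib) ^^ s.flag) (Sum.elim a b) },
        ib, .right, g, .right, m, .right⟩
    | none => .stay { s with phase := .halt, flag := decide (acc s.tag s.q) } ib g m
  | .halt => .stay s ib g m

/-- The machine that evaluates an automaton on the two numbers of a connection word and the length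
of its last component. -/
noncomputable def machine (c : ℕ) [NeZero c] {Q : Type} [Finite Q] (start : Q)
    (step : Q → Bool → (Fin c ⊕ Fin c → Bool) → Q) (acc : ConnTag → Q → Prop) :
    RandomAccessTM ConnSymbol where
  State := St c Q
  TapeSymbol := Cell c
  finite_state := inferInstance
  finite_tapeSymbol := inferInstance
  blank := none
  numTapes := 2
  start := ⟨.start, .output, false, 0, false, start⟩
  verdict s := match s.phase with
    | .halt => some s.flag
    | _ => none
  trans s sym ib g :=
    let o := act start step acc s sym ib (g 0) (g 1)
    (o.st, (o.ib, o.im), fun i => if i = 0 then (o.g, o.gm) else (o.m, o.mm))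

variable [Finite Q] {start : Q} {step : Q → Bool → (Fin c ⊕ Fin c → Bool) → Q}
  {acc : ConnTag → Q → Prop}

variable (start step acc) in
/-- The configuration with the given state, index tape, main tape and ruler. -/
noncomputable def cfg (s : St c Q) (S : Finset ℕ) (k : ℕ) (T : ℤ → Cell c) (h : ℤ)
    (U : ℤ → Cell c) (r : ℤ) : (machine c start step acc).Config where
  state := s
  indexOnes := S
  indexHead := k
  tape := fun i : Fin 2 => if i = 0 then T else U
  head := fun i : Fin 2 => if i = 0 then h else r

def adr (S : Finset ℕ) : ℕ := ∑ j ∈ S, 2 ^ j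

theorem step_cfg (x : List ConnSymbol) {s : St c Q} (hs : s.phase ≠ .halt) {S : Finset ℕ} {k : ℕ}
    {T : ℤ → Cell c} {h : ℤ} {U : ℤ → Cell c} {r : ℤ} {o : Act c Q}
    (ho : act start step acc s x[adr S]? (decide (k ∈ S)) (T h) (U r) = o) :
    (machine c start step acc).step x (cfg start step acc s S k T h U r) =
      cfg start step acc o.st (if o.ib then insert k S else S.erase k) (o.im.onNat k)
        (Function.update T h o.g) (o.gm.onInt h) (Function.update U r o.m) (o.mm.onInt r) := by
  have hv : (machine c start step acc).verdict s = none := by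
    unfold machine
    cases hp : s.phase <;> simp_all
  subst ho
  unfold RandomAccessTM.step
  simp only [cfg, hv]
  congr 1
  · refine funext fun i : Fin 2 => ?_
    obtain rfl | rfl : i = 0 ∨ i = 1 := by omega
    · rfl
    · rfl
  · refine funext fun i : Fin 2 => ?_
    obtain rfl | rfl : i = 0 ∨ i = 1 := by omega
    · rfl
    · rfl

variable (start step acc) in
/-- Amortized reachability: the number of ones on the index tape serves as a potential. -/
def Reach (x : List ConnSymbol) (C C' : (machine c start step acc).Config) (b : ℕ) : Prop :=
  ∃ t, t + 2 * C'.indexOnes.card ≤ b + 2 * C.indexOnes.card ∧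
    ((machine c start step acc).step x)^[t] C = C'

variable {x : List ConnSymbol}

theorem Reach.trans {C C' C'' : (machine c start step acc).Config} {b b' : ℕ}
    (h : Reach start step acc x C C' b) (h' : Reach start step acc x C' C'' b') :
    Reach start step acc x C C'' (b + b') := by
  obtain ⟨t, ht, e⟩ := h
  obtain ⟨t', ht', e'⟩ := h'
  refine ⟨t' + t, by omega, ?_⟩
  rw [Function.iterate_add_apply, e, e']

theorem Reach.refl (C : (machine c start step acc).Config) : Reach start step acc x C C 0 :=
  ⟨0, by omega, rfl⟩

theorem Reach.mono {C C' : (machine c start step acc).Config} {b b' : ℕ}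
    (h : Reach start step acc x C C' b) (hb : b ≤ b') : Reach start step acc x C C' b' := by
  obtain ⟨t, ht, e⟩ := h
  exact ⟨t, by omega, e⟩

/-- The cost `3` is one for the step itself and two for the potential of a one that it may write. -/
theorem Reach.single {s : St c Q} (hs : s.phase ≠ .halt) {S : Finset ℕ} {k : ℕ}
    {T : ℤ → Cell c} {h : ℤ} {U : ℤ → Cell c} {r : ℤ} {o : Act c Q}
    (ho : act start step acc s x[adr S]? (decide (k ∈ S)) (T h) (U r) = o)
    {C' : (machine c start step acc).Config}
    (hC : C' = cfg start step acc o.st (if o.ib then insert k S else S.erase k) (o.im.onNat k)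
        (Function.update T h o.g) (o.gm.onInt h) (Function.update U r o.m) (o.mm.onInt r)) :
    Reach start step acc x (cfg start step acc s S k T h U r) C' 3 := by
  refine ⟨1, ?_, ?_⟩
  · subst hC
    change 1 + 2 * (if o.ib then insert k S else S.erase k).card ≤ 3 + 2 * S.card
    have h1 := Finset.card_insert_le k S
    have h2 := Finset.card_erase_le (s := S) (a := k)
    split_ifs <;> omega
  · rw [Function.iterate_one, step_cfg x hs ho, hC]

end ConnMachine
-- Computing the length and incrementing the address
namespace ConnMachine

/-- The positions of the ones in the binary expansion. -/
def ones (n : ℕ) : Finset ℕ := n.bitIndices.toFinset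

theorem mem_ones {n j : ℕ} : j ∈ ones n ↔ n.testBit j = true := by simp [ones]

@[simp] theorem adr_ones (n : ℕ) : adr (ones n) = n := Finset.sum_toFinset_bitIndices_two_pow n

@[simp] theorem ones_adr (S : Finset ℕ) : ones (adr S) = S := Finset.toFinset_bitIndices_sum_two_pow S

theorem testBit_adr (S : Finset ℕ) (j : ℕ) : (adr S).testBit j = decide (j ∈ S) := by
  rw [Bool.eq_iff_iff, ← mem_ones, ones_adr, decide_eq_true_iff]

theorem adr_range (j : ℕ) : adr (Finset.range j) = 2 ^ j - 1 := by
  rw [adr, Nat.geomSum_eq le_rfl]; simp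

/-- The positions from `i` on of the ones in the binary expansion. -/
def onesFrom (n i : ℕ) : Finset ℕ := (ones n).filter (i ≤ ·)

theorem adr_onesFrom (n i : ℕ) : adr (onesFrom n i) = n / 2 ^ i * 2 ^ i := by
  refine Nat.eq_of_testBit_eq fun k => ?_
  rw [testBit_adr, Nat.testBit_mul_two_pow, Bool.eq_iff_iff]
  simp only [onesFrom, Finset.mem_filter, mem_ones, decide_eq_true_eq, Nat.testBit_div_two_pow,
    Bool.and_eq_true]
  constructor
  · rintro ⟨h1, h2⟩
    exact ⟨h2, by rwa [Nat.sub_add_cancel h2]⟩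
  · rintro ⟨h1, h2⟩
    rw [Nat.sub_add_cancel h1] at h2
    exact ⟨h2, h1⟩

/-- This is the test in the search for the length: with the bits of `n` above `i`, a zero at `i` and
ones below, the address is the largest one compatible with bit `i` being zero in place of that of
`n`. It lies inside the word iff bit `i` of `n` is one. -/
theorem adr_test_lt_iff (n i : ℕ) :
    adr (onesFrom n (i + 1) ∪ Finset.range i) < n ↔ n.testBit i = true := by
  have hd : Disjoint (onesFrom n (i + 1)) (Finset.range i) := by
    rw [Finset.disjoint_left]
    intro k h1 h2
    simp only [onesFrom, Finset.mem_filter, Finset.mem_range] at h1 h2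
    omega
  have : adr (onesFrom n (i + 1) ∪ Finset.range i) = n / 2 ^ (i + 1) * 2 ^ (i + 1) + (2 ^ i - 1) := by
    rw [← adr_onesFrom, ← adr_range]
    exact Finset.sum_union hd
  rw [this, Nat.testBit_eq_decide_div_mod_eq, decide_eq_true_iff]
  have h1 := Nat.div_add_mod n (2 ^ (i + 1))
  have h2 := Nat.mod_lt n (show 0 < 2 ^ (i + 1) by positivity)
  have h3 : n / 2 ^ i % 2 = n % 2 ^ (i + 1) / 2 ^ i := by
    rw [pow_succ, Nat.mod_mul_right_div_self]
  have hp : 0 < 2 ^ i := by positivity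
  have h4 : n % 2 ^ (i + 1) / 2 ^ i < 2 := by
    rw [Nat.div_lt_iff_lt_mul hp]; rw [pow_succ] at h2 ⊢; omega
  rw [h3]
  have h5 : n % 2 ^ (i + 1) / 2 ^ i = 1 ↔ 2 ^ i ≤ n % 2 ^ (i + 1) := by
    rw [← Nat.div_pos_iff.trans (and_iff_right hp)]; omega
  rw [h5, mul_comm]
  omega

variable {c : ℕ}

theorem row_zero {X : ℕ → Bool} {A B : ℕ → Fin c → Bool} : row 0 X A B = fun _ => none := by
  funext z
  rw [row, if_neg (by omega)]

theorem update_row_self {W : ℕ} {X : ℕ → Bool} {A B : ℕ → Fin c → Bool} :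
    Function.update (row W X A B) (W : ℤ) (some (X W, A W, B W)) = row (W + 1) X A B := by
  funext z
  by_cases hz : z = W
  · subst hz
    simp [row]
  · rw [Function.update_of_ne hz, row, row]
    split_ifs with h1 h2 h2
    · rfl
    · omega
    · omega
    · rfl

variable (c) in
def noBits : ℕ → Fin c → Bool := fun _ _ => false

theorem ruler_natCast {i : ℕ} (h : i ≠ 0) : ruler c (i : ℤ) = none := by
  obtain ⟨j, rfl⟩ := Nat.exists_eq_succ_of_ne_zero h
  exact_mod_cast ruler_succ j

variable [NeZero c] {Q : Type} [Finite Q] {start : Q}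
  {step : Q → Bool → (Fin c ⊕ Fin c → Bool) → Q} {acc : ConnTag → Q → Prop}
  {x : List ConnSymbol}

theorem keep_ones (S : Finset ℕ) (k : ℕ) :
    S = if decide (k ∈ S) = true then insert k S else S.erase k := by
  split_ifs with hk
  · rw [Finset.insert_eq_of_mem (by simpa using hk)]
  · rw [Finset.erase_eq_of_notMem (by simpa using hk)]

theorem Reach.stay {s s' : St c Q} (hs : s.phase ≠ .halt) {S : Finset ℕ} {k : ℕ}
    {T : ℤ → Cell c} {h : ℤ} {U : ℤ → Cell c} {r : ℤ}
    (ho : act start step acc s x[adr S]? (decide (k ∈ S)) (T h) (U r) =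
      .stay s' (decide (k ∈ S)) (T h) (U r)) :
    Reach start step acc x (cfg start step acc s S k T h U r) (cfg start step acc s' S k T h U r)
      3 := by
  refine Reach.single hs ho ?_
  simp only [Act.stay, Function.update_eq_self, Move.onNat, Move.onInt]
  congr 1
  exact keep_ones S k

theorem Reach.act {s s' : St c Q} (hs : s.phase ≠ .halt) {S S' : Finset ℕ} {k k' : ℕ}
    {T T' : ℤ → Cell c} {h h' : ℤ} {U : ℤ → Cell c} {r r' : ℤ} (ib : Bool) (im : Move)
    (g : Cell c) (gm : Move) (mm : Move)
    (ho : act start step acc s x[adr S]? (decide (k ∈ S)) (T h) (U r) =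
      ⟨s', ib, im, g, gm, U r, mm⟩)
    (hS : S' = if ib then insert k S else S.erase k) (hk : k' = im.onNat k)
    (hT : T' = Function.update T h g) (hh : h' = gm.onInt h) (hr : r' = mm.onInt r) :
    Reach start step acc x (cfg start step acc s S k T h U r)
      (cfg start step acc s' S' k' T' h' U r') 3 := by
  refine Reach.single hs ho ?_
  simp only [Function.update_eq_self, hS, hk, hT, hh, hr]

/-- With ones in the first `j` cells the address is `2 ^ j - 1`, which is less than the length as
long as `j` is less than its number of bits. -/
theorem reach_grow (s : St c Q) (hs : s.phase = .grow) (j : ℕ) (hj : j ≤ x.length.size) :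
    Reach start step acc x (cfg start step acc s ∅ 0 (fun _ => none) 0 (ruler c) 0)
      (cfg start step acc s (Finset.range j) j (row j (fun _ => false) (noBits c) (noBits c)) j
        (ruler c) j) (3 * j) := by
  induction j with
  | zero => rw [row_zero]; exact Reach.refl _
  | succ j ih =>
    refine (ih (by omega)).trans (b' := 3) ?_
    have h1 : 2 ^ j ≤ x.length := Nat.lt_size.1 hj
    have h2 : adr (Finset.range j) < x.length := by
      rw [adr_range]; have : 0 < 2 ^ j := by positivity
      omega
    refine Reach.act (by simp [hs]) true .right (zeroCell c) .right .right ?_ ?_ rfl ?_ ?_ ?_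
    · rw [List.getElem?_eq_getElem h2]
      simp [ConnMachine.act, hs]
    · simp [Finset.range_add_one]
    · exact update_row_self.symm
    · simp [Move.onInt]
    · simp [Move.onInt]

variable (x) in
/-- The bits of the length of the word from position `i` on. -/
def lenFrom (i : ℕ) : ℕ → Bool := fun k => if i ≤ k then x.length.testBit k else false

/-- Invariant: the index cells above `i` already hold bits of the length, and those up to `i` still
hold the ones from `grow`. At the end the index tape holds the length itself. -/
theorem reach_search (s : St c Q) (W : ℕ) (i : ℕ) (hi : i < W) :
    Reach start step acc x
      (cfg start step acc { s with phase := .drop }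
        (onesFrom x.length (i + 1) ∪ Finset.range (i + 1)) i
        (row W (lenFrom x (i + 1)) (noBits c) (noBits c)) i (ruler c) i)
      (cfg start step acc { s with phase := .clear } (ones x.length) 0
        (row W x.length.testBit (noBits c) (noBits c)) 0 (ruler c) 0) (6 * (i + 1)) := by
  induction i with
  | zero =>
    refine Reach.trans (b := 3) (b' := 3)
      (C' := cfg start step acc { s with phase := .test } (onesFrom x.length 1 ∪ Finset.range 0) 0
        (row W (lenFrom x 1) (noBits c) (noBits c)) 0 (ruler c) 0) ?_ ?_
    · refine Reach.act (by simp) false .stay _ .stay .stay rfl ?_ rfl (by simp) rfl rfl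
      ext k
      simp [onesFrom]
    · have h1 := adr_test_lt_iff x.length 0
      refine Reach.act (by simp) (x.length.testBit 0) .stay
        (some (x.length.testBit 0, fun _ => false, fun _ => false)) .stay .stay ?_ ?_ rfl ?_ rfl rfl
      · have h2 : x[adr (onesFrom x.length 1 ∪ Finset.range 0)]?.isSome = x.length.testBit 0 := by
          rw [Bool.eq_iff_iff, ← h1]; simp
        have h3 := row_of_lt (X := lenFrom x 1) (A := noBits c) (B := noBits c) hi
        simp only [Nat.cast_zero] at h3
        simp only [ConnMachine.act, ruler_zero, zeroCell, h2, h3, Act.stay]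
        simp only [Option.isSome_some, if_true, Option.map_some]
        rfl
      · ext k
        rcases k with _ | k
        · split_ifs with h <;> simp_all [onesFrom, mem_ones]
        · split_ifs with h <;> simp_all [onesFrom, mem_ones]
      · have := update_row (c := c) (X := lenFrom x 1) (A := noBits c) (B := noBits c) hi
          (x.length.testBit 0) (fun _ => false) (fun _ => false)
        simp only [Nat.cast_zero] at this
        rw [this]
        congr 1
        · funext k
          rcases k with _ | k
          · simp
          · simp [lenFrom]
        · exact (Function.update_eq_self 0 (noBits c)).symm
        · exact (Function.update_eq_self 0 (noBits c)).symm
  | succ i ih =>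
    refine Reach.mono (Reach.trans (b := 6) ?_ (ih (by omega))) (by omega)
    refine Reach.trans (b := 3) (b' := 3)
      (C' := cfg start step acc { s with phase := .test }
        (onesFrom x.length (i + 1 + 1) ∪ Finset.range (i + 1)) (i + 1)
        (row W (lenFrom x (i + 1 + 1)) (noBits c) (noBits c)) (i + 1 : ℕ) (ruler c) (i + 1 : ℕ)) ?_ ?_
    · refine Reach.act (by simp) false .stay _ .stay .stay rfl ?_ rfl (by simp) rfl rfl
      ext k
      simp [onesFrom]
      grind
    · have h1 := adr_test_lt_iff x.length (i + 1)
      refine Reach.act (by simp) (x.length.testBit (i + 1)) .left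
        (some (x.length.testBit (i + 1), fun _ => false, fun _ => false)) .left .left ?_ ?_ rfl ?_
          ?_ ?_
      · have h2 : x[adr (onesFrom x.length (i + 1 + 1) ∪ Finset.range (i + 1))]?.isSome =
            x.length.testBit (i + 1) := by
          rw [Bool.eq_iff_iff, ← h1]; simp
        have h3 := row_of_lt (X := lenFrom x (i + 1 + 1)) (A := noBits c) (B := noBits c) hi
        simp only [ConnMachine.act, ruler_natCast (Nat.succ_ne_zero i), h2, h3]
        simp only [Option.map_some]
        rfl
      · ext k
        simp only [onesFrom]
        rcases lt_trichotomy k (i + 1) with h | rfl | h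
        · split_ifs with h' <;> simp [mem_ones, h, h.ne]
        · split_ifs with h' <;> simp_all [mem_ones]
        · split_ifs with h' <;> (simp [mem_ones, h, h.ne', not_lt.2 h.le]; intros; omega)
      · rw [update_row hi]
        congr 1
        · funext k
          rcases lt_trichotomy k (i + 1) with h | rfl | h
          · simp [lenFrom, h.ne, not_lt.2 h.le, show ¬ i < k by omega]
          · simp [lenFrom]
          · have h4 : i + 1 < k := h
            simp [lenFrom, h.ne', h4, show i < k by omega]
        · exact (Function.update_eq_self (i + 1) (noBits c)).symm
        · exact (Function.update_eq_self (i + 1) (noBits c)).symm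
      · simp [Move.onInt]
      · simp [Move.onInt]

theorem reach_clear (s : St c Q) (hs : s.phase = .clear) (W : ℕ) (X : ℕ → Bool)
    (A B : ℕ → Fin c → Bool) (n j : ℕ) (hj : j ≤ W) :
    Reach start step acc x (cfg start step acc s (ones n) 0 (row W X A B) 0 (ruler c) 0)
      (cfg start step acc s (onesFrom n j) j (row W X A B) j (ruler c) j) (3 * j) := by
  induction j with
  | zero => 
    have : onesFrom n 0 = ones n := by simp [onesFrom]
    rw [this]; exact Reach.refl _
  | succ j ih =>
    refine (ih (by omega)).trans (b' := 3) ?_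
    refine Reach.act (by simp [hs]) false .right (row W X A B j) .right .right ?_ ?_ rfl ?_ ?_ ?_
    · simp [ConnMachine.act, hs, row_of_lt (show j < W by omega)]
    · ext k
      simp [onesFrom]
      grind
    · simp
    · simp [Move.onInt]
    · simp [Move.onInt]

theorem reach_ret (s : St c Q) (T : ℤ → Cell c) (S : Finset ℕ) (j : ℕ) :
    Reach start step acc x (cfg start step acc { s with phase := .ret } S j T j (ruler c) j)
      (cfg start step acc { s with phase := .tag } S 0 T 0 (ruler c) 0) (3 * (j + 1)) := by
  induction j with
  | zero =>
    refine Reach.stay (by simp) ?_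
    simp [ConnMachine.act, ruler_zero, zeroCell]
  | succ j ih =>
    refine Reach.mono (Reach.trans (b := 3) ?_ ih) (by omega)
    refine Reach.act (by simp) _ .left (T (j + 1 : ℕ)) .left .left ?_ (keep_ones _ _) rfl ?_ ?_ ?_
    · simp only [ConnMachine.act, ruler_natCast (Nat.succ_ne_zero j)]
      simp
    · simp
    · simp [Move.onInt]
    · simp [Move.onInt]

theorem reach_inc_loop (s : St c Q) (hs : s.phase = .inc) (S : Finset ℕ) (T : ℤ → Cell c) (h : ℤ)
    (z : ℕ) (hz : Finset.range z ⊆ S) :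
    ((machine c start step acc).step x)^[z] (cfg start step acc s S 0 T h (ruler c) 0) =
      cfg start step acc s (S \ Finset.range z) z T h (ruler c) z := by
  induction z with
  | zero => simp
  | succ z ih =>
    rw [Function.iterate_succ_apply', ih (fun i hi => hz (by simp at hi ⊢; omega))]
    have hm : z ∈ S \ Finset.range z := by simp [hz (Finset.self_mem_range_succ z)]
    rw [step_cfg x (by simp [hs]) (o := ⟨s, false, .right, T h, .stay, ruler c z, .right⟩)
      (by simp only [ConnMachine.act, hs, hm]; simp)]
    simp only [Function.update_eq_self]
    congr 1
    · ext k
      simp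
      grind

theorem reach_back_loop (s : St c Q) (S : Finset ℕ) (T : ℤ → Cell c)
    (h : ℤ) (z : ℕ) :
    ((machine c start step acc).step x)^[z + 1]
      (cfg start step acc { s with phase := .back } S z T h (ruler c) z) =
      cfg start step acc { s with phase := .parse } S 0 T h (ruler c) 0 := by
  induction z with
  | zero =>
    rw [zero_add, Function.iterate_one, step_cfg x (by simp)
      (o := .stay { s with phase := .parse } (decide (0 ∈ S)) (T h) (ruler c 0))
      (by simp [ConnMachine.act, ruler_zero, zeroCell])]
    simp only [Act.stay, Nat.cast_zero, Function.update_eq_self]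
    congr 1
    exact (keep_ones S 0).symm
  | succ z ih =>
    rw [Function.iterate_succ_apply, step_cfg x (by simp)
      (o := ⟨{ s with phase := .back }, decide (z + 1 ∈ S), .left, T h, .stay,
        ruler c (z + 1 : ℕ), .left⟩)
      (by simp only [ConnMachine.act, ruler_natCast (Nat.succ_ne_zero z)]; simp), ← ih]
    simp only [Function.update_eq_self, ← keep_ones]
    congr 2
    simp [Move.onInt]

/-- `z` is the number of trailing ones. They sum to `2 ^ z - 1`, so adding one replaces them by the
single bit `z`. -/
theorem exists_trailing (n : ℕ) : ∃ z, Finset.range z ⊆ ones n ∧ z ∉ ones n ∧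
    ones (n + 1) = insert z (ones n \ Finset.range z) := by
  classical
  have hex : ∃ z, z ∉ ones n :=
    ⟨n.size, by rw [mem_ones, testBit_eq_false_of_size_le le_rfl]; simp⟩
  have hsub : Finset.range (Nat.find hex) ⊆ ones n := fun i hi => by
    have := Nat.find_min hex (Finset.mem_range.1 hi)
    simpa using this
  refine ⟨Nat.find hex, hsub, Nat.find_spec hex, ?_⟩
  generalize hz : Nat.find hex = z at *
  have hzn : z ∉ ones n := hz ▸ Nat.find_spec hex
  have : n + 1 = adr (insert z (ones n \ Finset.range z)) := by
    have e1 : adr (ones n \ Finset.range z) + adr (Finset.range z) = adr (ones n) :=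
      Finset.sum_sdiff hsub
    rw [adr_range, adr_ones] at e1
    have e2 : adr (insert z (ones n \ Finset.range z)) =
        2 ^ z + adr (ones n \ Finset.range z) :=
      Finset.sum_insert (by simp [hzn])
    have : 0 < 2 ^ z := by positivity
    omega
  rw [this, ones_adr]

/-- With `z` trailing ones the increment takes `2 * z + 2` steps, but it removes `z` ones and adds a
single one. The potential pays for the carry and leaves a constant cost, which keeps the total time
logarithmic. -/
theorem reach_inc (s : St c Q) (n : ℕ) (T : ℤ → Cell c) (h : ℤ) :
    Reach start step acc x
      (cfg start step acc { s with phase := .inc } (ones n) 0 T h (ruler c) 0)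
      (cfg start step acc { s with phase := .parse } (ones (n + 1)) 0 T h (ruler c) 0) 4 := by
  obtain ⟨z, h1, h2, h3⟩ := exists_trailing n
  refine ⟨z + 1 + 1 + z, ?_, ?_⟩
  · change z + 1 + 1 + z + 2 * (ones (n + 1)).card ≤ 4 + 2 * (ones n).card
    have e1 : (ones n \ Finset.range z).card + z = (ones n).card := by
      have := Finset.card_sdiff_add_card_eq_card h1
      simpa using this
    rw [h3, Finset.card_insert_of_notMem (by simp [h2])]
    omega
  · rw [Function.iterate_add_apply, reach_inc_loop _ rfl _ _ _ _ h1, Function.iterate_succ_apply]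
    have hm : z ∉ ones n \ Finset.range z := by simp [h2]
    rw [step_cfg x (by simp) (o := .stay { s with phase := .back } true (T h) (ruler c z))
      (by simp only [ConnMachine.act, hm]; simp)]
    simp only [Act.stay, Function.update_eq_self, h3]
    exact reach_back_loop s _ T h z

end ConnMachine
-- Reading the two numbers
namespace ConnMachine

variable {c : ℕ}

/-- The contents of the cells after the bits `d` of a number have been written in blocks of
length `bs`. -/
def blk (bs : ℕ) (d : List Bool) : ℕ → Fin c → Bool := fun j i =>
  if (i : ℕ) < bs then d.getD (j * bs + i) false else false

theorem blk_nil (bs : ℕ) : (blk bs [] : ℕ → Fin c → Bool) = noBits c := by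
  funext j i
  simp [blk, noBits]

variable [NeZero c]

/-- The next bit has number `d.length`; quotient and remainder by the block length are its cell and
its track. -/
theorem blk_append {bs : ℕ} (h0 : 0 < bs) (hbs : bs ≤ c) (d : List Bool) (e : Bool) :
    (blk bs (d ++ [e]) : ℕ → Fin c → Bool) =
      Function.update (blk bs d) (d.length / bs)
        (Function.update (blk bs d (d.length / bs)) (Fin.ofNat c (d.length % bs)) e) := by
  have hm := Nat.mod_lt d.length h0
  have hdm := Nat.div_add_mod d.length bs
  rw [mul_comm] at hdm
  have hv : ((Fin.ofNat c (d.length % bs) : Fin c) : ℕ) = d.length % bs := by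
    simp only [Fin.val_ofNat]
    exact Nat.mod_eq_of_lt (by omega)
  funext j i
  have key : ∀ (hi : (i : ℕ) < bs), j * bs + i = d.length →
      j = d.length / bs ∧ i = Fin.ofNat c (d.length % bs) := by
    intro hi h
    constructor
    · rw [← h, add_comm, Nat.add_mul_div_right _ _ h0, Nat.div_eq_of_lt hi, zero_add]
    · refine Fin.ext ?_
      rw [hv, ← h, add_comm, Nat.add_mul_mod_self_right, Nat.mod_eq_of_lt hi]
  have happ : ∀ k, k ≠ d.length → (d ++ [e]).getD k false = d.getD k false := by
    intro k hk
    simp only [List.getD_eq_getElem?_getD]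
    rcases lt_or_gt_of_ne hk with h | h
    · rw [List.getElem?_append_left h]
    · rw [List.getElem?_eq_none (by simp; omega), List.getElem?_eq_none (by omega)]
  by_cases hj : j = d.length / bs
  · subst hj
    rw [Function.update_self]
    by_cases hi : i = Fin.ofNat c (d.length % bs)
    · rw [hi, Function.update_self]
      simp only [blk, hv, hm, if_true, hdm]
      simp
    · rw [Function.update_of_ne hi]
      simp only [blk]
      split_ifs with h
      · exact happ _ fun h' => hi (key h h').2
      · rfl
  · rw [Function.update_of_ne hj]
    simp only [blk]
    split_ifs with h
    · exact happ _ fun h' => hj (key h h').1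
    · rfl

variable {Q : Type} [Finite Q] {start : Q} {step : Q → Bool → (Fin c ⊕ Fin c → Bool) → Q}
  {acc : ConnTag → Q → Prop} {x : List ConnSymbol}

theorem init_eq : (machine c start step acc).init =
    cfg start step acc ⟨.start, .output, false, 0, false, start⟩ ∅ 0 (fun _ => none) 0
      (fun _ => none) 0 := by
  unfold RandomAccessTM.init cfg
  congr 1
  · refine funext fun i : Fin 2 => ?_
    obtain rfl | rfl : i = 0 ∨ i = 1 := by omega
    · rfl
    · rfl
  · refine funext fun i : Fin 2 => ?_
    obtain rfl | rfl : i = 0 ∨ i = 1 := by omega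
    · rfl
    · rfl

theorem reach_start (q : Q) : Reach start step acc x
    (cfg start step acc ⟨.start, .output, false, 0, false, q⟩ ∅ 0 (fun _ => none) 0
      (fun _ => none) 0)
    (cfg start step acc ⟨.grow, .output, false, 0, false, q⟩ ∅ 0 (fun _ => none) 0
      (ruler c) 0) 3 := by
  refine Reach.single (by simp) (o := _) rfl ?_
  simp [ConnMachine.act, Act.stay, Move.onInt, Move.onNat, ruler]

theorem reach_setup (hx : x ≠ []) :
    Reach start step acc x (machine c start step acc).init
      (cfg start step acc ⟨.tag, .output, false, 0, false, start⟩ (ones 0) 0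
        (row (x.length.size + 1) x.length.testBit (noBits c) (noBits c)) 0 (ruler c) 0)
      (15 * (x.length.size + 1)) := by
  have hN : 0 < x.length := List.length_pos_iff.2 hx
  obtain ⟨J, hJ⟩ := Nat.exists_eq_succ_of_ne_zero (Nat.size_pos.2 hN).ne'
  have hlt : x.length < 2 ^ (J + 1) := Nat.size_le.1 hJ.le
  have hempty : ∀ i, J + 1 ≤ i → onesFrom x.length i = ∅ := by
    intro i hi
    ext k
    simp only [onesFrom, Finset.mem_filter, mem_ones, Finset.notMem_empty, iff_false, not_and]
    intro h1 h2
    rw [testBit_eq_false_of_size_le (by omega)] at h1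
    exact absurd h1 (by simp)
  have h1 : Reach start step acc x (machine c start step acc).init
      (cfg start step acc ⟨.grow, .output, false, 0, false, start⟩ ∅ 0 (fun _ => none) 0
        (ruler c) 0) 3 := by
    rw [init_eq]
    exact reach_start _
  have h2 := h1.trans (reach_grow ⟨.grow, .output, false, 0, false, start⟩ rfl (J + 1) hJ.ge)
  -- When the address leaves the word, one more cell is written. The tape thus gets `x.length.size +
  -- 1` cells, as many as a track has bits.
  have h3 : Reach start step acc x
      (cfg start step acc ⟨.grow, .output, false, 0, false, start⟩ (Finset.range (J + 1)) (J + 1)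
        (row (J + 1) (fun _ => false) (noBits c) (noBits c)) (J + 1 : ℕ) (ruler c) (J + 1 : ℕ))
      (cfg start step acc ⟨.drop, .output, false, 0, false, start⟩
        (onesFrom x.length (J + 1) ∪ Finset.range (J + 1)) J
        (row (J + 1 + 1) (lenFrom x (J + 1)) (noBits c) (noBits c)) J (ruler c) J) 3 := by
    have hnone : x[adr (Finset.range (J + 1))]? = none := by
      rw [List.getElem?_eq_none_iff, adr_range]; omega
    refine Reach.act (by simp) (decide (J + 1 ∈ Finset.range (J + 1))) .left (zeroCell c) .left .left
      ?_ ?_ rfl ?_ ?_ ?_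
    · simp only [ConnMachine.act, hnone, ruler_natCast (Nat.succ_ne_zero J)]
      simp
    · rw [hempty _ le_rfl, Finset.empty_union]
      exact keep_ones _ _
    · have : lenFrom x (J + 1) = fun _ => false := by
        funext k
        unfold lenFrom
        split_ifs with h
        · exact testBit_eq_false_of_size_le (by omega)
        · rfl
      rw [this]
      exact update_row_self.symm
    · simp [Move.onInt]
    · simp [Move.onInt]
  have h4 := (h2.trans h3).trans (reach_search ⟨.drop, .output, false, 0, false, start⟩ (J + 1 + 1)
    J (by omega))
  have h5 := h4.trans (reach_clear ⟨.clear, .output, false, 0, false, start⟩ rfl (J + 1 + 1)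
    x.length.testBit (noBits c) (noBits c) x.length (J + 1 + 1) le_rfl)
  have h6 : Reach start step acc x
      (cfg start step acc ⟨.clear, .output, false, 0, false, start⟩
        (onesFrom x.length (J + 1 + 1)) (J + 1 + 1)
        (row (J + 1 + 1) x.length.testBit (noBits c) (noBits c)) (J + 1 + 1 : ℕ) (ruler c)
        (J + 1 + 1 : ℕ))
      (cfg start step acc ⟨.ret, .output, false, 0, false, start⟩ (ones 0) (J + 1)
        (row (J + 1 + 1) x.length.testBit (noBits c) (noBits c)) (J + 1 : ℕ) (ruler c)
        (J + 1 : ℕ)) 3 := by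
    rw [hempty _ (by omega)]
    refine Reach.act (by simp) _ .left (row (J + 1 + 1) x.length.testBit (noBits c) (noBits c)
      (J + 1 + 1 : ℕ)) .left .left ?_ (keep_ones _ _) rfl ?_ ?_ ?_
    · simp only [ConnMachine.act, row_of_ge le_rfl]
      simp [ones]
    · simp
    · simp [Move.onInt]
    · simp [Move.onInt]
  have h7 := (h5.trans h6).trans (reach_ret ⟨.ret, .output, false, 0, false, start⟩ _ _ (J + 1))
  rw [hJ]
  refine h7.mono ?_
  simp only [Nat.succ_eq_add_one]
  omega

variable (start step acc) in
/-- From the given configuration the machine rejects. -/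
def Rejects (x : List ConnSymbol) (C : (machine c start step acc).Config) (b : ℕ) : Prop :=
  ∃ C', Reach start step acc x C C' b ∧
    (machine c start step acc).verdict C'.state = some false

theorem Reach.rejects {C C' : (machine c start step acc).Config} {b b' : ℕ}
    (h : Reach start step acc x C C' b) (h' : Rejects start step acc x C' b') :
    Rejects start step acc x C (b + b') := by
  obtain ⟨C'', h1, h2⟩ := h'
  exact ⟨C'', h.trans h1, h2⟩

theorem Rejects.mono {C : (machine c start step acc).Config} {b b' : ℕ}
    (h : Rejects start step acc x C b) (hb : b ≤ b') : Rejects start step acc x C b' := by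
  obtain ⟨C'', h1, h2⟩ := h
  exact ⟨C'', h1.mono hb, h2⟩

theorem Rejects.of_act {s : St c Q} (hs : s.phase ≠ .halt) {S : Finset ℕ} {k : ℕ}
    {T : ℤ → Cell c} {h : ℤ} {U : ℤ → Cell c} {r : ℤ}
    (ho : act start step acc s x[adr S]? (decide (k ∈ S)) (T h) (U r) =
      .stay { s with phase := .halt, flag := false } (decide (k ∈ S)) (T h) (U r)) :
    Rejects start step acc x (cfg start step acc s S k T h U r) 3 :=
  ⟨_, Reach.stay hs ho, rfl⟩

/-- The main tape while a number is read. -/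
def parseTape (sec : Bool) (W : ℕ) (X : ℕ → Bool) (A : ℕ → Fin c → Bool) (bs : ℕ)
    (d : List Bool) : ℤ → Cell c :=
  if sec then row W X A (blk bs d) else row W X (blk bs d) (noBits c)

/-- No leading zero. -/
def canonical (d : List Bool) : Bool := d.getLast?.getD true

theorem canonical_iff (d : List Bool) : canonical d = true ↔ ∃ a : ℕ, a.bits = d := by
  rw [exists_bits_eq_iff, canonical]
  cases d.getLast? with
  | none => simp
  | some b => cases b <;> simp

theorem canonical_append (d : List Bool) (e : Bool) : canonical (d ++ [e]) = e := by
  simp [canonical]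

theorem blockSize_pos (t : ConnTag) (sec : Bool) : 0 < blockSize c t sec := by
  have := NeZero.pos c
  unfold blockSize
  split <;> omega

theorem blockSize_le (t : ConnTag) (sec : Bool) : blockSize c t sec ≤ c := by
  have := NeZero.pos c
  unfold blockSize
  split <;> omega

/-- The state while a number is read of which the bits `d` have been read. -/
def parseSt (p : Phase) (t : ConnTag) (sec : Bool) (q : Q) (d : List Bool) : St c Q :=
  ⟨p, t, sec, Fin.ofNat c (d.length % blockSize c t sec), canonical d, q⟩

variable (start step acc) in
noncomputable def parseCfg (t : ConnTag) (sec : Bool) (q : Q) (W : ℕ) (X : ℕ → Bool)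
    (A : ℕ → Fin c → Bool) (d : List Bool) (v : ℕ) : (machine c start step acc).Config :=
  cfg start step acc (parseSt .parse t sec q d) (ones v) 0
    (parseTape sec W X A (blockSize c t sec) d) (d.length / blockSize c t sec : ℕ) (ruler c) 0

theorem parseTape_apply {sec : Bool} {W : ℕ} {X : ℕ → Bool} {A : ℕ → Fin c → Bool} {bs : ℕ}
    {d : List Bool} {j : ℕ} (hj : j < W) :
    parseTape sec W X A bs d (j : ℤ) =
      if sec then some (X j, A j, blk bs d j) else some (X j, blk bs d j, noBits c j) := by
  unfold parseTape
  split_ifs <;> exact row_of_lt hj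

theorem parseTape_append {sec : Bool} {W : ℕ} {X : ℕ → Bool} {A : ℕ → Fin c → Bool} {bs : ℕ}
    (h0 : 0 < bs) (hbs : bs ≤ c) {d : List Bool} (e : Bool) (hj : d.length / bs < W) :
    parseTape sec W X A bs (d ++ [e]) = Function.update (parseTape sec W X A bs d)
      (d.length / bs : ℕ) (if sec then some (X (d.length / bs), A (d.length / bs),
          Function.update (blk bs d (d.length / bs)) (Fin.ofNat c (d.length % bs)) e)
        else some (X (d.length / bs),
          Function.update (blk bs d (d.length / bs)) (Fin.ofNat c (d.length % bs)) e,
          noBits c (d.length / bs))) := by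
  unfold parseTape
  split_ifs
  · rw [update_row hj, Function.update_eq_self, Function.update_eq_self, blk_append h0 hbs]
  · rw [update_row hj, Function.update_eq_self, Function.update_eq_self, blk_append h0 hbs]

theorem reach_parse_bit (t : ConnTag) (sec : Bool) (q : Q) (W : ℕ) (X : ℕ → Bool)
    (A : ℕ → Fin c → Bool) (d : List Bool) (v : ℕ) (e : Bool) (he : x[v]? = some (.bit e))
    (hd : d.length < W * blockSize c t sec) :
    Reach start step acc x (parseCfg start step acc t sec q W X A d v)
      (parseCfg start step acc t sec q W X A (d ++ [e]) (v + 1)) 7 := by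
  have h0 := blockSize_pos (c := c) t sec
  have hbs := blockSize_le (c := c) t sec
  have hm := Nat.mod_lt d.length h0
  have hj : d.length / blockSize c t sec < W := (Nat.div_lt_iff_lt_mul h0).2 hd
  have hv : ((Fin.ofNat c (d.length % blockSize c t sec) : Fin c) : ℕ) =
      d.length % blockSize c t sec := by
    simp only [Fin.val_ofNat]
    exact Nat.mod_eq_of_lt (by omega)
  refine Reach.trans (b := 3) (b' := 4) ?_ (reach_inc (parseSt .inc t sec q (d ++ [e])) v _ _)
  by_cases hc : d.length % blockSize c t sec + 1 = blockSize c t sec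
  · have hdiv : (d.length + 1) / blockSize c t sec = d.length / blockSize c t sec + 1 := by
      have h1 := Nat.div_add_mod d.length (blockSize c t sec)
      rw [show d.length + 1 = (d.length / blockSize c t sec + 1) * blockSize c t sec by
        rw [add_mul, mul_comm]; omega]
      exact Nat.mul_div_cancel _ h0
    have hmod : (d.length + 1) % blockSize c t sec = 0 := by
      rw [Nat.add_mod, ]
      rcases eq_or_ne (blockSize c t sec) 1 with h1 | h1
      · rw [h1]; simp [Nat.mod_one]
      · rw [Nat.mod_eq_of_lt (show 1 < _ by omega), hc, Nat.mod_self]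
    refine Reach.act (by simp [parseSt]) _ .stay _ .right .stay ?_ (keep_ones _ _) rfl
      (parseTape_append h0 hbs e hj) ?_ rfl
    · simp only [ConnMachine.act, parseSt, adr_ones, he, parseTape_apply hj, List.length_append,
        List.length_singleton, hmod, canonical_append, hv, hc, if_true]
      cases sec <;> simp
    · simp [hdiv, Move.onInt]
  · have hdiv : (d.length + 1) / blockSize c t sec = d.length / blockSize c t sec := by
      rw [Nat.succ_div, if_neg, add_zero]
      rw [Nat.dvd_iff_mod_eq_zero, Nat.add_mod]
      rcases eq_or_ne (blockSize c t sec) 1 with h1 | h1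
      · omega
      · rw [Nat.mod_eq_of_lt (show 1 < _ by omega), Nat.mod_eq_of_lt (by omega)]
        omega
    have hmod : (d.length + 1) % blockSize c t sec = d.length % blockSize c t sec + 1 := by
      rw [Nat.add_mod]
      rw [Nat.mod_eq_of_lt (show 1 < blockSize c t sec by omega), Nat.mod_eq_of_lt (by omega)]
    have hfin : (Fin.ofNat c (d.length % blockSize c t sec + 1) : Fin c) =
        Fin.ofNat c (d.length % blockSize c t sec) + 1 := by
      refine Fin.ext ?_
      simp [Fin.val_add]
    refine Reach.act (by simp [parseSt]) _ .stay _ .stay .stay ?_ (keep_ones _ _) rfl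
      (parseTape_append h0 hbs e hj) ?_ rfl
    · simp only [ConnMachine.act, parseSt, adr_ones, he, parseTape_apply hj, List.length_append,
        List.length_singleton, hmod, hfin, canonical_append, hv, hc, if_false, Act.stay]
      cases sec <;> simp
    · simp [hdiv, Move.onInt]

/-- The alternative is decided symbol by symbol: a separator ends the number, and anything malformed
or a bit that no longer fits into the `W` cells causes rejection. The capacity of the cells bounds
the time of a rejection, however long the run of bits in the word may be. -/
theorem parse_outcome (t : ConnTag) (sec : Bool) (q : Q) (W : ℕ) (X : ℕ → Bool)
    (A : ℕ → Fin c → Bool) (rest : List ConnSymbol) :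
    ∀ (d : List Bool) (v : ℕ), rest = x.drop v → d.length ≤ W * blockSize c t sec →
    (∃ e y, rest = e.map .bit ++ .sep :: y ∧ canonical (d ++ e) = true ∧
      (d ++ e).length ≤ W * blockSize c t sec ∧
      Reach start step acc x (parseCfg start step acc t sec q W X A d v)
        (cfg start step acc ⟨.rewind, t, sec, 0, true, q⟩ (ones (v + e.length)) 0
          (parseTape sec W X A (blockSize c t sec) (d ++ e))
          (((d ++ e).length / blockSize c t sec : ℕ) - 1) (ruler c) 0) (7 * e.length + 3)) ∨
    ((¬ ∃ e y, rest = e.map .bit ++ .sep :: y ∧ canonical (d ++ e) = true ∧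
      (d ++ e).length ≤ W * blockSize c t sec) ∧
      Rejects start step acc x (parseCfg start step acc t sec q W X A d v)
        (7 * (W * blockSize c t sec - d.length) + 3)) := by
  induction rest with
  | nil =>
    intro d v hr hd
    refine Or.inr ⟨by simp, Rejects.mono (Rejects.of_act (by simp [parseSt]) ?_) (by omega)⟩
    have : x[v]? = none := by
      rw [List.getElem?_eq_none_iff]; exact List.drop_eq_nil_iff.1 hr.symm
    simp [ConnMachine.act, parseSt, this]
  | cons s r ih =>
    intro d v hr hd
    have hv : x[v]? = some s := by
      rw [← List.head?_drop, ← hr]; rfl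
    have hr' : r = x.drop (v + 1) := by
      rw [← List.tail_drop, ← hr]; rfl
    cases s with
    | tag t' =>
      refine Or.inr ⟨?_, Rejects.mono (Rejects.of_act (by simp [parseSt]) ?_) (by omega)⟩
      · rintro ⟨e, y, h, -⟩
        cases e <;> simp at h
      · simp [ConnMachine.act, parseSt, hv]
    | sep =>
      by_cases hc : canonical d = true
      · refine Or.inl ⟨[], r, by simp, by simpa, by simpa, ?_⟩
        refine Reach.act (by simp [parseSt]) _ .stay
          (parseTape sec W X A (blockSize c t sec) d (d.length / blockSize c t sec : ℕ)) .left .stay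
          ?_ (keep_ones _ _) rfl ?_ ?_ rfl
        · simp [ConnMachine.act, parseSt, hv, hc]
        · simp
        · simp [Move.onInt]
      · refine Or.inr ⟨?_, Rejects.mono (Rejects.of_act (by simp [parseSt]) ?_) (by omega)⟩
        · rintro ⟨e, y, h, h2, -⟩
          cases e with
          | nil => simp at h2; exact hc h2
          | cons _ _ => simp at h
        · simp [ConnMachine.act, parseSt, hv, hc]
    | bit b =>
      by_cases hlt : d.length < W * blockSize c t sec
      · have hb := reach_parse_bit (start := start) (step := step) (acc := acc) t sec q W X A d v b
          hv hlt
        rcases ih (d ++ [b]) (v + 1) hr' (by simpa using hlt) with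
          ⟨e, y, h1, h2, h3, h4⟩ | ⟨h1, h2⟩
        · refine Or.inl ⟨b :: e, y, by simp [h1], by simpa using h2, by simpa using h3, ?_⟩
          have := hb.trans h4
          simp only [List.append_assoc, List.singleton_append] at this
          rw [show v + (b :: e).length = v + 1 + e.length by simp; omega]
          refine this.mono ?_
          simp
          omega
        · refine Or.inr ⟨?_, (Reach.rejects hb h2).mono ?_⟩
          · rintro ⟨e, y, h3, h4, h5⟩
            cases e with
            | nil => simp at h3
            | cons b' e =>
              simp only [List.map_cons, List.cons_append, List.cons.injEq,
                ConnSymbol.bit.injEq] at h3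
              obtain ⟨rfl, h3⟩ := h3
              exact h1 ⟨e, y, h3, by simpa using h4, by simpa using h5⟩
          · simp
            omega
      · refine Or.inr ⟨?_, Rejects.mono (Rejects.of_act (by simp [parseSt]) ?_) (by omega)⟩
        · rintro ⟨e, y, h, h2, h3⟩
          cases e with
          | nil => simp at h
          | cons _ _ => simp at h3; omega
        · have hj : W ≤ d.length / blockSize c t sec :=
            (Nat.le_div_iff_mul_le (blockSize_pos t sec)).2 (not_lt.1 hlt)
          have : parseTape sec W X A (blockSize c t sec) d (d.length / blockSize c t sec : ℕ) =
              none := by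
            unfold parseTape
            split_ifs <;> exact row_of_ge hj
          simp only [ConnMachine.act, parseSt, adr_ones, hv, this]

end ConnMachine
-- Rewinding, subtraction and the run of the automaton
namespace ConnMachine

variable {c : ℕ} [NeZero c] {Q : Type} [Finite Q] {start : Q}
  {step : Q → Bool → (Fin c ⊕ Fin c → Bool) → Q} {acc : ConnTag → Q → Prop}
  {x : List ConnSymbol}

theorem reach_rewind (s : St c Q) (hs : s.phase = .rewind) (S : Finset ℕ) (W : ℕ) (X : ℕ → Bool)
    (A B : ℕ → Fin c → Bool) (p : ℕ) (hp : p ≤ W) :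
    Reach start step acc x (cfg start step acc s S 0 (row W X A B) ((p : ℤ) - 1) (ruler c) 0)
      (cfg start step acc s S 0 (row W X A B) (-1) (ruler c) 0) (3 * p) := by
  induction p with
  | zero => simpa using Reach.refl _
  | succ p ih =>
    refine Reach.mono (Reach.trans (b := 3) ?_ (ih (by omega))) (by omega)
    refine Reach.act (by simp [hs]) _ .stay (row W X A B p) .left .stay ?_ (keep_ones _ _) rfl ?_ ?_
      rfl
    · simp [ConnMachine.act, hs, row_of_lt (show p < W by omega)]
    · simp
    · simp [Move.onInt]

theorem reach_second (t : ConnTag) (q : Q) (S : Finset ℕ) (W : ℕ) (X : ℕ → Bool)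
    (A B : ℕ → Fin c → Bool) :
    Reach start step acc x
      (cfg start step acc ⟨.rewind, t, false, 0, true, q⟩ S 0 (row W X A B) (-1) (ruler c) 0)
      (cfg start step acc ⟨.inc, t, true, 0, true, q⟩ S 0 (row W X A B) 0 (ruler c) 0) 3 := by
  refine Reach.act (by simp) (decide (0 ∈ S)) .stay (row W X A B (-1)) .right .stay ?_
    (keep_ones _ _) rfl ?_ ?_ rfl
  · simp [ConnMachine.act, row_neg_one]
  · simp
  · simp [Move.onInt]

theorem reach_scan_start (t : ConnTag) (q : Q) (S : Finset ℕ) (W : ℕ) (X : ℕ → Bool)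
    (A B : ℕ → Fin c → Bool) :
    Reach start step acc x
      (cfg start step acc ⟨.rewind, t, true, 0, true, q⟩ S 0 (row W X A B) (-1) (ruler c) 0)
      (cfg start step acc ⟨.scan, t, true, 0, true, start⟩ S 0 (row W X A B) 0 (ruler c) 0) 3 := by
  refine Reach.act (by simp) (decide (0 ∈ S)) .stay (row W X A B (-1)) .right .stay ?_
    (keep_ones _ _) rfl ?_ ?_ rfl
  · simp [ConnMachine.act, row_neg_one]
  · simp
  · simp [Move.onInt]

/-- The borrow in the computation of `n` as `n + y + 1 - y - 1`. -/
def borrow (y n j : ℕ) : Bool := decide (2 ^ j ≤ n % 2 ^ j + y % 2 ^ j + 1)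

/-- The borrow in `(n + y + 1) - y - 1` equals the carry in the sum `n + y + 1`: it occurs at `j`
iff the parts below bit `j`, together with the extra one, reach `2 ^ j`. -/
theorem borrow_spec (y n j : ℕ) :
    (((n + y + 1).testBit j ^^ y.testBit j) ^^ borrow y n j) = n.testBit j ∧
    borrow y n (j + 1) = ((!(n + y + 1).testBit j && (y.testBit j || borrow y n j)) ||
      (y.testBit j && borrow y n j)) := by
  have hP : 0 < 2 ^ j := by positivity
  have e : ∀ a : ℕ, a % 2 ^ (j + 1) = a % 2 ^ j + 2 ^ j * (a / 2 ^ j % 2) := by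
    intro a; rw [pow_succ, Nat.mod_mul]
  simp only [borrow, e, Nat.testBit_eq_decide_div_mod_eq]
  rw [pow_succ]
  have h1 := Nat.div_add_mod n (2 ^ j)
  have h2 := Nat.div_add_mod y (2 ^ j)
  have h3 := Nat.mod_lt n hP
  have h4 := Nat.mod_lt y hP
  generalize n % 2 ^ j = a at *
  generalize y % 2 ^ j = b at *
  have h5 : (n + y + 1) / 2 ^ j = n / 2 ^ j + y / 2 ^ j + (a + b + 1) / 2 ^ j := by
    conv_lhs => rw [← h1, ← h2]
    rw [show 2 ^ j * (n / 2 ^ j) + a + (2 ^ j * (y / 2 ^ j) + b) + 1 =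
      a + b + 1 + 2 ^ j * (n / 2 ^ j + y / 2 ^ j) by ring, Nat.add_mul_div_left _ _ hP]
    omega
  have h6 : (a + b + 1) / 2 ^ j = if 2 ^ j ≤ a + b + 1 then 1 else 0 := by
    split_ifs with h
    · rw [Nat.div_eq_iff hP]; omega
    · exact Nat.div_eq_of_lt (by omega)
  rw [h5, h6]
  generalize n / 2 ^ j = n' at *
  generalize y / 2 ^ j = y' at *
  generalize 2 ^ j = P at *
  rcases Nat.mod_two_eq_zero_or_one n' with hn | hn <;>
  rcases Nat.mod_two_eq_zero_or_one y' with hy | hy <;>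
  by_cases hc : P ≤ a + b + 1 <;>
  simp [hn, hy, hc, Nat.add_mod] <;> omega

theorem borrow_zero (y n : ℕ) : borrow y n 0 = true := by simp [borrow]

/-- The bits of `n` are produced by serial subtraction and fed to the automaton in the same pass.
The map `st` extracts the automaton of interest from a larger control state. -/
theorem reach_scan (t : ConnTag) (W : ℕ) (A B : ℕ → Fin c → Bool) (y n : ℕ) (Au : Auto (Fin c ⊕ Fin c))
    (st : Q → Au.Q) (h0 : st start = Au.start)
    (hst : ∀ q b f, st (step q b f) = Au.step (st q) b f) (j : ℕ) (hj : j ≤ W) :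
    ∃ q, st q = Au.run n.testBit (fun i j => Sum.elim (A j) (B j) i) j ∧
    Reach start step acc x
      (cfg start step acc ⟨.scan, t, true, 0, true, start⟩ (ones y) 0
        (row W (n + y + 1).testBit A B) 0 (ruler c) 0)
      (cfg start step acc ⟨.scan, t, true, 0, borrow y n j, q⟩ (ones y) j
        (row W (n + y + 1).testBit A B) j (ruler c) j) (3 * j) := by
  induction j with
  | zero => exact ⟨start, h0, by rw [borrow_zero]; exact Reach.refl _⟩
  | succ j ih =>
    obtain ⟨q, hq, hr⟩ := ih (by omega)
    refine ⟨step q (n.testBit j) (Sum.elim (A j) (B j)), ?_, hr.trans (b' := 3) ?_⟩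
    · rw [hst, hq]; rfl
    · obtain ⟨e1, e2⟩ := borrow_spec y n j
      have hm : decide (j ∈ ones y) = y.testBit j := by
        rw [Bool.eq_iff_iff, ← mem_ones, decide_eq_true_iff]
      refine Reach.act (by simp) _ .right (row W (n + y + 1).testBit A B j) .right .right ?_
        (keep_ones _ _) rfl ?_ ?_ ?_
      · simp only [ConnMachine.act, hm, row_of_lt (show j < W by omega), e1, e2]
      · simp
      · simp [Move.onInt]
      · simp [Move.onInt]

end ConnMachine

/-- The tracks of a number that is written in blocks of length `bs`. -/
def blockTrack (bs a i : ℕ) : ℕ := if i < bs then track bs a i else 0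

theorem blk_bits {c bs : ℕ} (hbs : 0 < bs) (a j : ℕ) (i : Fin c) :
    ConnMachine.blk bs a.bits j i = (blockTrack bs a i).testBit j := by
  unfold ConnMachine.blk blockTrack
  split_ifs
  · rw [testBit_track hbs, testBit_eq_getD_bits]
  · simp

theorem bits_map_append_inj {e e' : List Bool} {y y' : List ConnSymbol}
    (h : e.map ConnSymbol.bit ++ ConnSymbol.sep :: y = e'.map .bit ++ .sep :: y') :
    e = e' ∧ y = y' := by
  induction e generalizing e' with
  | nil => cases e' <;> simp_all
  | cons b e ih =>
    cases e' with
    | nil => simp at h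
    | cons b' e' =>
      simp only [List.map_cons, List.cons_append, List.cons.injEq, ConnSymbol.bit.injEq] at h
      obtain ⟨rfl, h⟩ := h
      obtain ⟨rfl, rfl⟩ := ih h
      exact ⟨rfl, rfl⟩

theorem bits_injective : Function.Injective Nat.bits := fun a b h =>
  Nat.eq_of_testBit_eq fun j => by rw [testBit_eq_getD_bits, testBit_eq_getD_bits, h]

theorem connWord_inj {t t' : ConnTag} {a a' b b' : ℕ} {y y' : List ConnSymbol}
    (h : connWord t a b y = connWord t' a' b' y') : t = t' ∧ a = a' ∧ b = b' ∧ y = y' := by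
  simp only [connWord, List.cons.injEq, ConnSymbol.tag.injEq] at h
  obtain ⟨rfl, h⟩ := h
  obtain ⟨h1, h2⟩ := bits_map_append_inj h
  obtain ⟨h3, h4⟩ := bits_map_append_inj h2
  exact ⟨rfl, bits_injective h1, bits_injective h3, h4⟩

/-- The relation between the parameter and the two numbers of a connection word. -/
def ConnTracks {c : ℕ} (R : ConnTag → ℕ → (Fin c ⊕ Fin c → ℕ) → Prop) (t : ConnTag) (n a b : ℕ) :
    Prop :=
  R t n (Sum.elim (fun i => blockTrack c a i)
    fun i => blockTrack (ConnMachine.blockSize c t true) b i)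

theorem ConnMachine.blockSize_false (c : ℕ) (t : ConnTag) : blockSize c t false = c := by
  cases t <;> rfl

/-- Related numbers fit into the cells of the machine, so rejecting a longer number is correct. -/
theorem size_le_of_connTracks {c : ℕ} [NeZero c] {R : ConnTag → ℕ → (Fin c ⊕ Fin c → ℕ) → Prop}
    (hb : ∀ t n v, R t n v → ∀ i, v i < 2 ^ (n.size + 1)) {t : ConnTag} {n a b : ℕ}
    (h : ConnTracks R t n a b) :
    a.size ≤ c * (n.size + 1) ∧ b.size ≤ ConnMachine.blockSize c t true * (n.size + 1) := by
  have h' := hb _ _ _ h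
  constructor
  · refine Nat.size_le.2 (lt_two_pow_of_track_lt (NeZero.pos c) fun i hi => ?_)
    simpa [blockTrack, hi] using h' (.inl ⟨i, hi⟩)
  · refine Nat.size_le.2 (lt_two_pow_of_track_lt (ConnMachine.blockSize_pos _ _) fun i hi => ?_)
    simpa [blockTrack, hi] using h' (.inr ⟨i, hi.trans_le (ConnMachine.blockSize_le _ _)⟩)

-- Once the tracks stand side by side, one pass over the logarithmically many cells decides the
-- relation. The bound `hb` allows the machine to discard longer numbers unread.
open ConnMachine in
theorem inDLOGTIME_of_autoRel {c : ℕ} [NeZero c] (R : ConnTag → ℕ → (Fin c ⊕ Fin c → ℕ) → Prop)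
    (hR : ∀ t, AutoRel (R t)) (hb : ∀ t n v, R t n v → ∀ i, v i < 2 ^ (n.size + 1)) :
    InDLOGTIME {x | ∃ t a b y, ConnTracks R t y.length a b ∧ x = connWord t a b y} := by
  classical
  have hc : 0 < c := NeZero.pos c
  choose Au hAu using hR
  have := fun t => (Au t).finite
  -- The automata of all tags run in parallel; the tag selects the one whose verdict counts.
  let Q : Type := ∀ t, (Au t).Q
  let start : Q := fun t => (Au t).start
  let step : Q → Bool → (Fin c ⊕ Fin c → Bool) → Q := fun q b f t => (Au t).step (q t) b f
  let acc : ConnTag → Q → Prop := fun t q => (Au t).acc (q t)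
  have hfin : Finite Q := Pi.finite
  refine ⟨machine c start step acc, 2 * (60 + 20 * c), fun x => ?_⟩
  set K : Set (List ConnSymbol) :=
    {x | ∃ t a b y, ConnTracks R t y.length a b ∧ x = connWord t a b y}
  suffices h : ∃ C', Reach start step acc x (machine c start step acc).init C'
      ((60 + 20 * c) * (x.length.size + 1)) ∧
      (x ∈ K → (machine c start step acc).verdict C'.state = some true) ∧
      (x ∉ K → (machine c start step acc).verdict C'.state = some false) by
    obtain ⟨C', ⟨τ, hτ, he⟩, h1, h2⟩ := h
    refine ⟨τ, ?_, ?_, ?_⟩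
    · have e0 : (machine c start step acc).init.indexOnes.card = 0 := rfl
      have e1 : x.length.size + 1 ≤ 2 * (Nat.log 2 x.length + 1) := by
        have := Nat.size_le.2 (Nat.lt_pow_succ_log_self (b := 2) (by norm_num) x.length)
        omega
      have e2 := Nat.mul_le_mul_left (60 + 20 * c) e1
      rw [e0] at hτ
      nlinarith
    · intro hx
      rw [RandomAccessTM.verdictAfter, he]
      exact h1 hx
    · intro hx
      rw [RandomAccessTM.verdictAfter, he]
      exact h2 hx
  have hrej : ∀ b, Rejects start step acc x (machine c start step acc).init b →
      b ≤ (60 + 20 * c) * (x.length.size + 1) → x ∉ K →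
      ∃ C', Reach start step acc x (machine c start step acc).init C'
      ((60 + 20 * c) * (x.length.size + 1)) ∧
      (x ∈ K → (machine c start step acc).verdict C'.state = some true) ∧
      (x ∉ K → (machine c start step acc).verdict C'.state = some false) := by
    rintro b ⟨C', h1, h2⟩ hle hx
    exact ⟨C', h1.mono hle, fun h => absurd h hx, fun _ => h2⟩
  rcases x with _ | ⟨s0, r⟩
  · refine hrej 6 ?_ (by rw [show ([] : List ConnSymbol).length.size = 0 from rfl]; omega) ?_
    · rw [init_eq]
      refine Reach.rejects (b := 3) (b' := 3) (reach_start _) (Rejects.of_act (by simp) ?_)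
      simp [ConnMachine.act, ruler_zero, zeroCell]
    · rintro ⟨t, a, b, y, -, h⟩
      simp [connWord] at h
  set x := s0 :: r with hx
  have hsetup := reach_setup (start := start) (step := step) (acc := acc) (x := x) (by simp [hx])
  set J := x.length.size
  have hx0 : x[0]? = some s0 := by simp [hx]
  by_cases hs0 : ∃ t, s0 = .tag t
  swap
  · refine hrej _ (hsetup.rejects (Rejects.of_act (by simp) ?_)) (by nlinarith) ?_
    · cases s0 with
      | tag t => exact absurd ⟨t, rfl⟩ hs0
      | bit b => simp [ConnMachine.act, hx0]
      | sep => simp [ConnMachine.act, hx0]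
    · rintro ⟨t, a, b, y, -, h⟩
      simp only [hx, connWord, List.cons.injEq] at h
      exact hs0 ⟨t, h.1⟩
  obtain ⟨t, rfl⟩ := hs0
  have h1 : Reach start step acc x (machine c start step acc).init
      (parseCfg start step acc t false start (J + 1) x.length.testBit (noBits c) [] 1)
      (15 * (J + 1) + 3 + 4) := by
    refine (hsetup.trans (b' := 3) (Reach.stay (by simp) (s' := parseSt .inc t false start []) ?_)
      ).trans ?_
    · simp [ConnMachine.act, hx0, parseSt, canonical]
    · have := reach_inc (start := start) (step := step) (acc := acc) (x := x)
        (parseSt .inc t false start []) 0 (row (J + 1) x.length.testBit (noBits c) (noBits c)) 0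
      simp only [parseCfg, parseTape, blk_nil, List.length_nil, Nat.zero_div, Nat.cast_zero,
        Bool.false_eq_true, if_false]
      exact this
  have hx1 : r = x.drop 1 := by simp [hx]
  have hB : ∀ sec, (J + 1) * blockSize c t sec ≤ c * (J + 1) := by
    intro sec
    rw [mul_comm]
    exact Nat.mul_le_mul_right _ (blockSize_le t sec)
  have hbound : (60 + 20 * c) * (J + 1) = 60 * (J + 1) + 20 * (c * (J + 1)) := by ring
  -- The bound on `a` and `b` is in terms of `y`, while the tape is sized by the whole word `x`; the
  -- latter is longer, so there is room.
  have hsize : ∀ {t' a b y}, ConnTracks R t' y.length a b → x = connWord t' a b y →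
      t' = t ∧ r = a.bits.map .bit ++ .sep :: (b.bits.map .bit ++ .sep :: y) ∧
      a.bits.length ≤ (J + 1) * blockSize c t false ∧
      b.bits.length ≤ (J + 1) * blockSize c t true := by
    intro t' a b y hR h
    simp only [hx, connWord, List.cons.injEq, ConnSymbol.tag.injEq] at h
    obtain ⟨rfl, h⟩ := h
    obtain ⟨g1, g2⟩ := size_le_of_connTracks hb hR
    have g3 : y.length.size ≤ J := by
      refine Nat.size_le_size ?_
      rw [hx, h]
      simp
      omega
    refine ⟨rfl, h, ?_, ?_⟩
    · rw [Nat.size_eq_bits_len, blockSize_false, mul_comm]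
      exact g1.trans (Nat.mul_le_mul_left _ (by omega))
    · rw [Nat.size_eq_bits_len, mul_comm]
      exact g2.trans (Nat.mul_le_mul_left _ (by omega))
  rcases parse_outcome (start := start) (step := step) (acc := acc) (x := x) t false start (J + 1)
    x.length.testBit (noBits c) r [] 1 hx1 (by simp) with
    ⟨e1, r1, hr1, hcan1, hlen1, hreach1⟩ | ⟨hno, hrj⟩
  swap
  · refine hrej _ (h1.rejects hrj) ?_ ?_
    · have := hB false
      simp only [List.length_nil]
      omega
    · rintro ⟨t', a, b, y, hR, h⟩
      obtain ⟨rfl, g1, g2, -⟩ := hsize hR h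
      exact hno ⟨a.bits, _, g1, (canonical_iff _).2 ⟨a, rfl⟩, g2⟩
  simp only [List.nil_append] at hcan1 hlen1 hreach1
  obtain ⟨a, rfl⟩ := (canonical_iff _).1 hcan1
  have hp1 : a.bits.length / blockSize c t false ≤ J + 1 := by
    refine Nat.div_le_of_le_mul ?_
    rwa [mul_comm]
  have h2 : Reach start step acc x (machine c start step acc).init
      (parseCfg start step acc t true start (J + 1) x.length.testBit
        (blk (blockSize c t false) a.bits) [] (1 + a.bits.length + 1))
      (15 * (J + 1) + 3 + 4 + (7 * a.bits.length + 3) +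
        (3 * (a.bits.length / blockSize c t false) + 3) + 4) := by
    refine ((h1.trans hreach1).trans ((reach_rewind _ rfl _ (J + 1) _ _ _ _ hp1).trans
      (reach_second _ _ _ _ _ _ _))).trans (b' := 4) ?_
    have := reach_inc (start := start) (step := step) (acc := acc) (x := x)
        (parseSt .inc t true start []) (1 + a.bits.length) (row (J + 1) x.length.testBit
        (blk (blockSize c t false) a.bits) (noBits c)) 0
    simp only [parseCfg, parseTape, blk_nil, List.length_nil, Nat.zero_div, Nat.cast_zero, if_true]
    exact this
  have hx2 : r1 = x.drop (1 + a.bits.length + 1) := by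
    rw [hx, hr1]
    rw [show 1 + a.bits.length + 1 = (a.bits.length + 1) + 1 by omega, List.drop_succ_cons,
      List.drop_append]
    simp
  rcases parse_outcome (start := start) (step := step) (acc := acc) (x := x) t true start (J + 1)
    x.length.testBit (blk (blockSize c t false) a.bits) r1 [] _ hx2 (by simp) with
    ⟨e2, y, hr2, hcan2, hlen2, hreach2⟩ | ⟨hno, hrj⟩
  swap
  · refine hrej _ (h2.rejects hrj) ?_ ?_
    · have := hB false
      have := hB true
      simp only [List.length_nil]
      omega
    · rintro ⟨t', a', b, y, hR, h⟩
      obtain ⟨rfl, g1, g2, g3⟩ := hsize hR h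
      rw [hr1] at g1
      obtain ⟨-, g1⟩ := bits_map_append_inj g1
      exact hno ⟨b.bits, _, g1, (canonical_iff _).2 ⟨b, rfl⟩, g3⟩
  simp only [List.nil_append] at hcan2 hlen2 hreach2
  obtain ⟨b, rfl⟩ := (canonical_iff _).1 hcan2
  have hp2 : b.bits.length / blockSize c t true ≤ J + 1 := by
    refine Nat.div_le_of_le_mul ?_
    rwa [mul_comm]
  have hlen : x.length = y.length + (1 + a.bits.length + 1 + b.bits.length) + 1 := by
    rw [hx, hr1, hr2]
    simp
    omega
  obtain ⟨q, hq, hscan⟩ := reach_scan (start := start) (step := step) (acc := acc) (x := x) t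
    (J + 1) (blk (blockSize c t false) a.bits) (blk (blockSize c t true) b.bits)
    (1 + a.bits.length + 1 + b.bits.length) y.length (Au t) (fun q => q t) rfl
    (fun _ _ _ => rfl) (J + 1) le_rfl
  rw [← hlen] at hscan
  have h3 := ((h2.trans hreach2).trans (reach_rewind _ rfl _ (J + 1) _ _ _ _ hp2)).trans
    ((reach_scan_start _ _ _ _ _ _ _).trans hscan)
  have h4 := h3.trans (b' := 3) (Reach.stay (by simp) (s' := ⟨.halt, t, true, 0,
    decide (acc t q), q⟩) (by
      simp only [ConnMachine.act, row_of_ge le_rfl]))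
  have hword : x = connWord t a b y := by rw [hx, hr1, hr2, connWord]
  have hiff : x ∈ K ↔ ConnTracks R t y.length a b := by
    constructor
    · rintro ⟨t', a', b', y', hR, h⟩
      obtain ⟨rfl, rfl, rfl, rfl⟩ := connWord_inj (hword.symm.trans h)
      exact hR
    · exact fun h => ⟨t, a, b, y, h, hword⟩
  have hacc : ConnTracks R t y.length a b ↔ acc t q := by
    refine (hAu t y.length _ (J + 1) ?_ ?_).trans ?_
    · have : x.length < 2 ^ J := Nat.lt_size_self _
      rw [pow_succ]
      omega
    · rintro (i | i)
      · simp only [Sum.elim_inl, blockTrack, i.2, if_true]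
        refine track_lt hc (Nat.size_le.1 ?_)
        rwa [blockSize_false, Nat.size_eq_bits_len, mul_comm] at hlen1
      · simp only [Sum.elim_inr, blockTrack]
        split_ifs
        · refine track_lt (blockSize_pos _ _) (Nat.size_le.1 ?_)
          rwa [Nat.size_eq_bits_len, mul_comm] at hlen2
        · positivity
    · change _ ↔ (Au t).acc (q t)
      rw [hq]
      have : (fun (i : Fin c ⊕ Fin c) j => Sum.elim (blk (blockSize c t false) a.bits j)
          (blk (blockSize c t true) b.bits j) i) = fun i => (Sum.elim (fun i : Fin c =>
            blockTrack c a i) (fun i : Fin c => blockTrack (blockSize c t true) b i) i).testBit := by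
        funext i j
        rcases i with i | i
        · simp [blk_bits hc, blockSize_false]
        · simp [blk_bits (blockSize_pos t true)]
      rw [this]
  refine ⟨_, h4.mono ?_, fun h => ?_, fun h => ?_⟩
  · have := hB false
    have := hB true
    omega
  · change some (decide (acc t q)) = some true
    rw [hiff, hacc] at h
    simpa using h
  · change some (decide (acc t q)) = some false
    rw [hiff, hacc] at h
    simpa using h

namespace Layout

variable {φ₀ : MF 0} (L : Layout φ₀)

/-! ## The direct connection language of the circuit of a formula -/

/-- The kind of the gates of a node. -/
noncomputable def nodeTag (p : Node φ₀) (n : ℕ) (g : Fin L.c → ℕ) : ConnTag :=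
  if p.2 then .not else p.1.1.2.tag n fun i => g (L.varTrack (Fin.castLE (L.le _ p.1.2) i))

def HasTag (t : ConnTag) (n : ℕ) (g : Fin L.c → ℕ) : Prop :=
  (∃ p, L.IsNode p n g ∧ L.nodeTag p n g = t) ∨ (∀ p, ¬ L.IsNode p n g) ∧ t = .or

def root (φ₀ : MF 0) : Node φ₀ := (⟨⟨0, φ₀⟩, φ₀.self_mem_subs⟩, false)

/-- The tracks `g`, `h` of gate numbers satisfy the condition of the tag. -/
def TagRel (t : ConnTag) (n : ℕ) (g h : Fin L.c → ℕ) : Prop :=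
  match t with
  | .output => (L.IsNode (root φ₀) n g ∧ ∀ i, g (L.varTrack i) = 0) ∧ ∀ i, h i = 0
  | .input => ∃ (p : {p : Fm // p ∈ φ₀.subs}) (j : Fin L.V),
      (∃ (k : ℕ) (i : Fin k), p.1 = ⟨k, .input i⟩ ∧ (i : ℕ) = j) ∧ L.IsNode (p, false) n g ∧
        g (L.varTrack j) < n ∧ h 0 = g (L.varTrack j)
  | .child => ∃ p q : Node φ₀, p.Edge q ∧ L.IsNode p n g ∧ L.IsNode q n h ∧
      ∀ i : Fin L.V, p.Fixed i → h (L.varTrack i) = g (L.varTrack i)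
  | t => L.HasTag t n g ∧ ∀ i, h i = 0

def connRel (t : ConnTag) (n : ℕ) (w : Fin L.c ⊕ Fin L.c → ℕ) : Prop :=
  (∀ i, w i < 2 ^ (n.size + 1)) ∧ L.TagRel t n (fun i => w (.inl i)) fun i => w (.inr i)

section AutoRel

variable {ι : Type}

/-- `2 * n + 1` has exactly one bit more than `n`. -/
theorem _root_.WeightedTeam.AutoRel.lt_two_pow_size_succ (i : ι) :
    AutoRel fun n v => v i < 2 ^ (n.size + 1) := by
  refine (AutoRel.lt_two_pow_size i).two_mul_add_one.congr fun n v => ?_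
  rw [← Nat.bit_true_apply, Nat.size_bit (by simp)]

theorem autoRel_isNode (p : Node φ₀) (σ : Fin L.c → ι) :
    AutoRel fun n v => L.IsNode p n fun i => v (σ i) := by
  refine AutoRel.forall_finite fun j => ?_
  split_ifs
  · exact (AutoRel.eq_param _).two_mul_add_one
  · exact AutoRel.eq_zero _

theorem autoRel_zero {α : Type} [Finite α] (σ : α → ι) :
    AutoRel fun _ v => ∀ i, v (σ i) = 0 :=
  AutoRel.forall_finite fun _ => AutoRel.eq_zero _

/-- For an atom the kind of the gate depends on the truth of the atom. This is harmless because the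
atom is itself automatic; here the evaluation of atoms is passed on to the uniformity machine. -/
theorem autoRel_nodeTag (p : Node φ₀) (σ : Fin L.c → ι) (t : ConnTag) :
    AutoRel fun n v => L.nodeTag p n (fun i => v (σ i)) = t := by
  obtain ⟨⟨⟨k, φ⟩, hp⟩, b⟩ := p
  cases b
  · simp only [nodeTag, Bool.false_eq_true, if_false]
    cases φ with
    | atom R h =>
      refine AutoRel.congr (R := fun n v => (R n (fun i => v (σ (L.varTrack
        (Fin.castLE (L.le _ hp) i)))) ∧ .and = t) ∨ ((¬ R n fun i => v (σ (L.varTrack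
        (Fin.castLE (L.le _ hp) i)))) ∧ .or = t)) ?_ fun n v => ?_
      · exact ((h.comap _).and (.const _)).or ((h.comap _).not.and (.const _))
      · simp only [MF.tag]
        split_ifs with h' <;> simp [h']
    | input i =>
      refine AutoRel.congr (R := fun n v => (v (σ (L.varTrack (Fin.castLE (L.le _ hp) i))) < n ∧
        .input = t) ∨ ((¬ v (σ (L.varTrack (Fin.castLE (L.le _ hp) i))) < n) ∧ .or = t)) ?_
        fun n v => ?_
      · exact ((AutoRel.lt_param _).and (.const _)).or ((AutoRel.lt_param _).not.and (.const _))
      · simp only [MF.tag]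
        split_ifs with h' <;> simp [h']
    | count d φ θ => exact AutoRel.const (ConnTag.maj = t)
  · exact AutoRel.const (ConnTag.not = t)

theorem autoRel_hasTag (t : ConnTag) (σ : Fin L.c → ι) :
    AutoRel fun n v => L.HasTag t n fun i => v (σ i) :=
  (AutoRel.exists_finite fun p => (L.autoRel_isNode p σ).and (L.autoRel_nodeTag p σ t)).or
    ((AutoRel.forall_finite fun p => (L.autoRel_isNode p σ).not).and (.const _))

/-- The nodes and variables of the fixed formula are finite in number, so quantification over them
is a Boolean combination of comparisons of tracks and the atoms of the formula. -/
theorem autoRel_connRel (t : ConnTag) : AutoRel (L.connRel t) := by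
  refine (AutoRel.forall_finite fun i => AutoRel.lt_two_pow_size_succ i).and ?_
  have key : ∀ t, AutoRel fun n (w : Fin L.c ⊕ Fin L.c → ℕ) =>
      L.HasTag t n (fun i => w (.inl i)) ∧ ∀ i : Fin L.c, w (.inr i) = 0 :=
    fun t => (L.autoRel_hasTag t _).and (autoRel_zero _)
  cases t with
  | output =>
    exact ((L.autoRel_isNode _ _).and (autoRel_zero fun i => Sum.inl (L.varTrack i))).and
      (autoRel_zero _)
  | input =>
    exact AutoRel.exists_finite fun p => AutoRel.exists_finite fun j => (AutoRel.const _).and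
      ((L.autoRel_isNode _ _).and ((AutoRel.lt_param _).and (AutoRel.eq _ _)))
  | child =>
    exact AutoRel.exists_finite fun p => AutoRel.exists_finite fun q => (AutoRel.const _).and
      ((L.autoRel_isNode _ _).and ((L.autoRel_isNode _ _).and (AutoRel.forall_finite fun i =>
        AutoRel.comb (α := Unit) (fun r => p.Fixed i → r ()) fun _ => AutoRel.eq _ _)))
  | not => exact key .not
  | and => exact key .and
  | or => exact key .or
  | maj => exact key .maj

end AutoRel

theorem lt_size_iff {n a : ℕ} : a < L.size n ↔ ∀ i : Fin L.c, track L.c a i < 2 ^ (n.size + 1) :=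
  ⟨fun h i => track_lt (NeZero.pos _) h, fun h => lt_two_pow_of_track_lt (NeZero.pos _)
    fun _ hi => h ⟨_, hi⟩⟩

theorem tag_gateKind {n : ℕ} (a : Fin (L.size n)) (t : ConnTag) :
    (L.gateKind a).tag = t ↔ L.HasTag t n (L.trk a) := by
  unfold gateKind HasTag
  cases h : L.nodeOf a with
  | none =>
    have h' := L.nodeOf_eq_none.1 h
    simp [h', GateKind.tag, eq_comm]
  | some p =>
    have h' := L.nodeOf_eq_some.1 h
    have e : ((if p.2 then .not else p.1.1.2.kind n fun i => L.restrict p (L.vars a) i :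
        GateKind n)).tag = L.nodeTag p n (L.trk a) := by
      unfold nodeTag
      split_ifs
      · rfl
      · exact MF.tag_kind _ _ _
    simp only [e]
    constructor
    · exact fun h => Or.inl ⟨p, h', h⟩
    · rintro (⟨q, hq, h⟩ | ⟨h, -⟩)
      · rwa [L.isNode_inj h' hq]
      · exact absurd h' (h p)

theorem gateKind_eq_input {n : ℕ} (a : Fin (L.size n)) (b : Fin n) :
    L.gateKind a = .input b ↔ ∃ (p : {p : Fm // p ∈ φ₀.subs}) (j : Fin L.V),
      (∃ (k : ℕ) (i : Fin k), p.1 = ⟨k, .input i⟩ ∧ (i : ℕ) = j) ∧ L.IsNode (p, false) n (L.trk a) ∧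
        L.trk a (L.varTrack j) < n ∧ (b : ℕ) = L.trk a (L.varTrack j) := by
  constructor
  · intro h
    unfold gateKind at h
    cases h' : L.nodeOf a with
    | none => simp [h'] at h
    | some p =>
      obtain ⟨⟨⟨k, φ⟩, hp⟩, c⟩ := p
      simp only [h'] at h
      cases c
      · cases φ with
        | atom R hR =>
          simp only [MF.kind, Bool.false_eq_true, if_false] at h
          split_ifs at h
        | input i =>
          simp only [MF.kind, Bool.false_eq_true, if_false] at h
          split_ifs at h with hi
          refine ⟨⟨_, hp⟩, Fin.castLE (L.le _ hp) i, ⟨k, i, rfl, rfl⟩, L.nodeOf_eq_some.1 h', hi, ?_⟩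
          rw [← GateKind.input.inj h]
          rfl
        | count d φ θ => simp [MF.kind] at h
      · simp at h
  · rintro ⟨⟨p, hp⟩, j, ⟨k, i, rfl, hij⟩, h1, h2, h3⟩
    obtain rfl : Fin.castLE (L.le _ hp) i = j := Fin.ext hij
    have e : L.gateKind a = (MF.input i).kind n
        fun i' => L.trk a (L.varTrack (Fin.castLE (L.le _ hp) i')) := by
      unfold gateKind
      rw [L.nodeOf_eq_some.2 h1]
      rfl
    rw [e, MF.kind, dif_pos h2]
    exact congrArg _ (Fin.ext h3.symm)

theorem eq_output_iff {n : ℕ} (a : Fin (L.size n)) : (L.circuit n).output = a ↔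
    L.IsNode (root φ₀) n (L.trk a) ∧ ∀ i, L.trk a (L.varTrack i) = 0 := by
  change L.enc (root φ₀) (fun _ => ⟨0, bnd_pos n⟩) = a ↔ _
  constructor
  · rintro rfl
    exact ⟨L.isNode_enc _ _, fun i => congrArg Fin.val (congrFun (L.vars_enc _ _) i)⟩
  · rintro ⟨h1, h2⟩
    rw [← L.enc_vars (L.nodeOf_eq_some.2 h1)]
    congr 1
    exact funext fun i => Fin.ext (h2 i).symm

theorem child_iff {n : ℕ} (a b : Fin (L.size n)) : L.Child a b ↔
    ∃ p q : Node φ₀, p.Edge q ∧ L.IsNode p n (L.trk a) ∧ L.IsNode q n (L.trk b) ∧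
      ∀ i : Fin L.V, p.Fixed i → L.trk b (L.varTrack i) = L.trk a (L.varTrack i) := by
  simp only [Child, nodeOf_eq_some, Fin.ext_iff]
  constructor
  · rintro ⟨p, q, h1, h2, h3, h4⟩
    exact ⟨p, q, h3, h1, h2, h4⟩
  · rintro ⟨p, q, h3, h1, h2, h4⟩
    exact ⟨p, q, h1, h2, h3, h4⟩

theorem blockTrack_self {c : ℕ} (a : ℕ) (i : Fin c) : blockTrack c a i = track c a i :=
  if_pos i.2

theorem blockTrack_one (b i : ℕ) : blockTrack 1 b i = if i = 0 then b else 0 := by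
  unfold blockTrack
  rcases eq_or_ne i 0 with rfl | h
  · refine (if_pos one_pos).trans (Nat.eq_of_testBit_eq fun j => ?_)
    rw [testBit_track one_pos]
    simp
  · rw [if_neg (by omega), if_neg h]

theorem connTracks_iff {t : ConnTag} {n a b : ℕ} : ConnTracks L.connRel t n a b ↔
    ∃ ha : a < L.size n, (∀ i : Fin L.c, blockTrack (ConnMachine.blockSize L.c t true) b i <
      2 ^ (n.size + 1)) ∧ L.TagRel t n (L.trk ⟨a, ha⟩)
        fun i => blockTrack (ConnMachine.blockSize L.c t true) b i := by
  simp only [ConnTracks, connRel, Sum.forall, Sum.elim_inl, Sum.elim_inr, blockTrack_self]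
  constructor
  · rintro ⟨⟨h1, h2⟩, h3⟩
    exact ⟨L.lt_size_iff.2 h1, h2, h3⟩
  · rintro ⟨h1, h2, h3⟩
    exact ⟨⟨L.lt_size_iff.1 h1, h2⟩, h3⟩

theorem conn_iff (t : ConnTag) (n a b : ℕ) :
    (L.circuit n).Conn t a b ↔ ConnTracks L.connRel t n a b := by
  rw [connTracks_iff]
  refine exists_congr fun ha => ?_
  have hz : (∀ i : Fin L.c, track L.c b i = 0) ↔ b = 0 := by
    constructor
    · intro h
      refine eq_of_track_eq (NeZero.pos L.c) fun i hi => ?_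
      rw [h ⟨i, hi⟩]
      refine (Nat.eq_of_testBit_eq fun j => ?_).symm
      simp [testBit_track (NeZero.pos L.c) 0 i]
    · rintro rfl i
      refine Nat.eq_of_testBit_eq fun j => ?_
      simp [testBit_track (NeZero.pos L.c)]
  have key : ∀ P : Prop, (P ∧ b = 0) ↔ (∀ i : Fin L.c, track L.c b i < 2 ^ (n.size + 1)) ∧
      P ∧ ∀ i : Fin L.c, track L.c b i = 0 := by
    intro P
    rw [hz]
    refine ⟨fun h => ⟨fun i => ?_, h⟩, fun h => h.2⟩
    rw [hz.2 h.2]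
    positivity
  have hk : ∀ (K : GateKind n), (∀ K' : GateKind n, K' = K ↔ K'.tag = K.tag) →
      (((L.circuit n).kind ⟨a, ha⟩ = K ∧ b = 0) ↔
        (∀ i : Fin L.c, track L.c b i < 2 ^ (n.size + 1)) ∧
          L.HasTag K.tag n (L.trk ⟨a, ha⟩) ∧ ∀ i : Fin L.c, track L.c b i = 0) := by
    intro K hK
    rw [← key, ← L.tag_gateKind, ← hK]
  have hb : ∀ t ≠ .input, ConnMachine.blockSize L.c t true = L.c := by
    intro t ht
    simp [ConnMachine.blockSize, ht]
  cases t with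
  | output =>
    simp only [hb .output (by simp), blockTrack_self, TagRel]
    rw [L.eq_output_iff]
    exact key _
  | not =>
    simp only [hb .not (by simp), blockTrack_self, TagRel]
    exact hk .not fun K => by cases K <;> simp [GateKind.tag]
  | and =>
    simp only [hb .and (by simp), blockTrack_self, TagRel]
    exact hk .and fun K => by cases K <;> simp [GateKind.tag]
  | or =>
    simp only [hb .or (by simp), blockTrack_self, TagRel]
    exact hk .or fun K => by cases K <;> simp [GateKind.tag]
  | maj =>
    simp only [hb .maj (by simp), blockTrack_self, TagRel]
    exact hk .maj fun K => by cases K <;> simp [GateKind.tag]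
  | child =>
    simp only [hb .child (by simp), blockTrack_self, TagRel]
    rw [← L.lt_size_iff, ← exists_prop]
    refine exists_congr fun h => ?_
    rw [mem_children, child_iff]
    rfl
  | input =>
    -- The number of an input variable has to equal the value of a variable, which is a single track
    -- of the gate. It is therefore left unsplit and occupies track `0` alone.
    have h1 : ConnMachine.blockSize L.c .input true = 1 := by simp [ConnMachine.blockSize]
    simp only [h1, blockTrack_one, TagRel, Fin.val_zero, if_true]
    constructor
    · rintro ⟨h, h'⟩
      refine ⟨fun i => ?_, (L.gateKind_eq_input _ ⟨b, h⟩).1 h'⟩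
      split_ifs
      · exact h.trans (lt_bnd n)
      · positivity
    · rintro ⟨-, h⟩
      have hb : b < n := by
        obtain ⟨p, j, -, -, h2, h3⟩ := h
        omega
      exact ⟨hb, (L.gateKind_eq_input _ ⟨b, hb⟩).2 h⟩

end Layout

/-- One fixed formula yields the whole family of circuits: the number of tracks and the ranks are
constants, and only the range of the values grows with the input. -/
theorem inDLOGTIMEUniformTC0_of_def {K : Language Bool}
    (h : Def (ι := Empty) fun x _ => x ∈ K) : InDLOGTIMEUniformTC0 K := by
  obtain ⟨φ₀, hφ⟩ := h.exists_rename (Equiv.equivOfIsEmpty Empty (Fin 0))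
  obtain ⟨L⟩ := exists_layout φ₀
  refine ⟨L.circuit, fun x => ?_, L.size_le, L.depth_le, ?_⟩
  · rw [L.eval_output, hφ x Empty.elim]
    congr! 1
  · have e : directConnectionLanguage L.circuit =
        {x | ∃ t a b y, ConnTracks L.connRel t y.length a b ∧ x = connWord t a b y} := by
      simp only [directConnectionLanguage, L.conn_iff]
      rfl
    rw [e]
    exact inDLOGTIME_of_autoRel L.connRel L.autoRel_connRel fun t n v h => h.1

/-! ## Flatness of team semantics -/

section Flatness

variable {L : FirstOrder.Language.{u, v}} {A : Type w} [L.Structure A]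

/-- First-order satisfaction. -/
def FOFormula.Sat : FOFormula L → (ℕ → A) → Prop
  | .eq t₁ t₂, s => t₁.realize s = t₂.realize s
  | .neq t₁ t₂, s => t₁.realize s ≠ t₂.realize s
  | .rel R ts, s => FirstOrder.Language.Structure.RelMap R fun i => (ts i).realize s
  | .nrel R ts, s => ¬ FirstOrder.Language.Structure.RelMap R fun i => (ts i).realize s
  | .and φ ψ, s => φ.Sat s ∧ ψ.Sat s
  | .or φ ψ, s => φ.Sat s ∨ ψ.Sat s
  | .ex x φ, s => ∃ a, φ.Sat (Function.update s x a)
  | .all x φ, s => ∀ a, φ.Sat (Function.update s x a)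

/-- The extension of an assignment by a default value. -/
def extendAssignment {X : Finset ℕ} {A : Type w} (a₀ : A) (s : X → A) (y : ℕ) : A :=
  if h : y ∈ X then s ⟨y, h⟩ else a₀

theorem extendAssignment_update {X : Finset ℕ} (a₀ : A) (s : X → A) (x : ℕ) (a : A) :
    extendAssignment a₀ (updateAssignment s x a) =
      Function.update (extendAssignment a₀ s) x a := by
  funext y
  by_cases hy : y = x
  · subst hy
    simp [extendAssignment, updateAssignment]
  · simp [extendAssignment, updateAssignment, hy, Function.update_of_ne]

theorem termValue_eq_realize {X : Finset ℕ} (a₀ : A) (s : X → A) (t : L.Term ℕ)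
    (h : t.varFinset ⊆ X) : termValue s t h = t.realize (extendAssignment a₀ s) := by
  refine FirstOrder.Language.Term.realize_restrictVar (extendAssignment a₀ s) fun y => ?_
  simp [extendAssignment, h y.2]

/-- Flatness. Overlapping splits and lax choice functions impose no interaction between assignments:
a disjunction is split by the disjunct that holds, and `f s` can be the set of all witnesses for
`s`. The default value `a₀` concerns only variables outside the domain. -/
theorem teamSat_iff (a₀ : A) (φ : FOFormula L) (X : Finset ℕ) (h : φ.freeVars ⊆ X) (T : Team X A) :
    TeamSat A φ X h T ↔ ∀ s ∈ T, φ.Sat (extendAssignment a₀ s) := by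
  induction φ generalizing X with
  | eq t₁ t₂ => simp only [TeamSat, FOFormula.Sat, termValue_eq_realize a₀]
  | neq t₁ t₂ => simp only [TeamSat, FOFormula.Sat, termValue_eq_realize a₀]
  | rel R ts => simp only [TeamSat, FOFormula.Sat, termValue_eq_realize a₀]
  | nrel R ts => simp only [TeamSat, FOFormula.Sat, termValue_eq_realize a₀]
  | and φ ψ ih₁ ih₂ =>
    simp only [TeamSat, FOFormula.Sat, ih₁, ih₂]
    exact ⟨fun h s hs => ⟨h.1 s hs, h.2 s hs⟩, fun h => ⟨fun s hs => (h s hs).1,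
      fun s hs => (h s hs).2⟩⟩
  | or φ ψ ih₁ ih₂ =>
    simp only [TeamSat, FOFormula.Sat, ih₁, ih₂]
    constructor
    · rintro ⟨T₀, T₁, rfl, h₀, h₁⟩ s (hs | hs)
      · exact Or.inl (h₀ s hs)
      · exact Or.inr (h₁ s hs)
    · intro h
      refine ⟨{s ∈ T | φ.Sat (extendAssignment a₀ s)}, {s ∈ T | ψ.Sat (extendAssignment a₀ s)}, ?_,
        fun s hs => hs.2, fun s hs => hs.2⟩
      ext s
      exact ⟨fun hs => hs.elim And.left And.left, fun hs => (h s hs).imp (⟨hs, ·⟩) (⟨hs, ·⟩)⟩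
  | ex x φ ih =>
    simp only [TeamSat, FOFormula.Sat, ih]
    constructor
    · rintro ⟨f, hf, h⟩ s hs
      obtain ⟨a, ha⟩ := hf s hs
      exact ⟨a, extendAssignment_update a₀ s x a ▸ h _ ⟨s, hs, a, ha, rfl⟩⟩
    · intro h
      refine ⟨fun s => {a | φ.Sat (Function.update (extendAssignment a₀ s) x a)}, h, ?_⟩
      rintro _ ⟨s, hs, a, ha, rfl⟩
      rw [extendAssignment_update]
      exact ha
  | all x φ ih =>
    simp only [TeamSat, FOFormula.Sat, ih]
    constructor
    · intro h s hs a
      exact extendAssignment_update a₀ s x a ▸ h _ ⟨s, hs, a, trivial, rfl⟩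
    · rintro h _ ⟨s, hs, a, -, rfl⟩
      rw [extendAssignment_update]
      exact h s hs a

/-- By flatness the satisfying teams are the subsets of one set, and a finite set has subsets of
every size up to its own. -/
theorem hasTeamOfSize_iff [Finite A] (a₀ : A) (φ : FOFormula L) (k : ℕ) : HasTeamOfSize φ A k ↔
    k ≤ {s : φ.freeVars → A | φ.Sat (extendAssignment a₀ s)}.ncard := by
  simp only [HasTeamOfSize, teamSat_iff a₀]
  constructor
  · rintro ⟨T, -, rfl, h⟩
    exact Set.ncard_le_ncard h (Set.toFinite _)
  · intro h
    obtain ⟨T, hT, hk⟩ := Set.exists_subset_card_eq h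
    exact ⟨T, Set.toFinite _, hk, hT⟩

end Flatness

/-! ## Reading an encoded instance -/

theorem eq_append_iff_getElem? {α : Type} (y A B : List α) :
    y = A ++ B ↔ (∀ p < A.length, y[p]? = A[p]?) ∧ y.drop A.length = B := by
  constructor
  · rintro rfl
    exact ⟨fun p hp => List.getElem?_append_left hp, List.drop_left⟩
  · rintro ⟨h, rfl⟩
    refine List.ext_getElem? fun p => ?_
    rcases lt_or_ge p A.length with hp | hp
    · rw [List.getElem?_append_left hp, h p hp]
    · rw [List.getElem?_append_right hp, List.getElem?_drop, Nat.add_sub_cancel' hp]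

theorem length_flatten_ofFn {α : Type} {N : ℕ} (T : Fin N → List α) :
    (List.ofFn T).flatten.length = ∑ i, (T i).length := by
  rw [List.length_flatten, List.map_ofFn, List.sum_ofFn]
  rfl

theorem getElem?_flatten_ofFn {α : Type} {N : ℕ} (T : Fin N → List α) (i : Fin N) (j : ℕ)
    (hj : j < (T i).length) : (List.ofFn T).flatten[
      ∑ i' : Fin i, (T (Fin.castLE i.2.le i')).length + j]? = (T i)[j]? := by
  induction N with
  | zero => exact i.elim0
  | succ N ih =>
    rw [List.ofFn_succ, List.flatten_cons]
    refine Fin.cases (fun hj => ?_) (fun i hj => ?_) i hj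
    · have e : ∑ i' : Fin (0 : Fin (N + 1)), (T (Fin.castLE (0 : Fin (N + 1)).2.le i')).length =
          0 := Finset.sum_eq_zero fun i' _ => Fin.elim0 i'
      rw [e, zero_add, List.getElem?_append_left hj]
    · have e : ∑ i' : Fin (i.succ : Fin (N + 1)), (T (Fin.castLE i.succ.2.le i')).length =
          (T 0).length + ∑ i' : Fin i, (T (Fin.castLE i.2.le i').succ).length :=
        Fin.sum_univ_succ (n := (i : ℕ)) _
      rw [e, List.getElem?_append_right (by omega), ← ih (fun i => T i.succ) i hj]
      congr 1
      omega

theorem forall_getElem?_flatten_ofFn {α : Type} {N : ℕ} (T : Fin N → List α) (y : List α) :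
    (∀ p < (List.ofFn T).flatten.length, y[p]? = (List.ofFn T).flatten[p]?) ↔
      ∀ i, ∀ j < (T i).length,
        y[∑ i' : Fin i, (T (Fin.castLE i.2.le i')).length + j]? = (T i)[j]? := by
  have hb : ∀ i (j : Fin (T i).length), ((finSigmaFinEquiv ⟨i, j⟩ : Fin (∑ i, (T i).length)) : ℕ) =
      ∑ i' : Fin i, (T (Fin.castLE i.2.le i')).length + j := 
    fun i j => finSigmaFinEquiv_apply (n := fun i => (T i).length) ⟨i, j⟩
  constructor
  · intro h i j hj
    rw [h _ (by rw [length_flatten_ofFn, ← hb i ⟨j, hj⟩]; exact Fin.is_lt _),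
      getElem?_flatten_ofFn T i j hj]
  · intro h p hp
    rw [length_flatten_ofFn] at hp
    obtain ⟨⟨i, j⟩, hij⟩ := finSigmaFinEquiv.surjective (⟨p, hp⟩ : Fin (∑ i, (T i).length))
    have e : p = _ := (congrArg Fin.val hij).symm.trans (hb i j)
    rw [e, h i j j.2, getElem?_flatten_ofFn T i j j.2]

theorem length_relationTable (m r : ℕ) (P : (Fin r → Fin m) → Prop) :
    (relationTable m r P).length = m ^ r := by simp [relationTable]

theorem relationTable_getElem? (m r : ℕ) (P : (Fin r → Fin m) → Prop) (a : Fin r → Fin m) :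
    (relationTable m r P)[∑ j, (a j : ℕ) * m ^ (j : ℕ)]? =
      open Classical in some (decide (P a)) := by
  have h : (finFunctionFinEquiv a : ℕ) = ∑ j, (a j : ℕ) * m ^ (j : ℕ) :=
    finFunctionFinEquiv_apply _
  rw [← h, relationTable, List.getElem?_ofFn, dif_pos (Fin.is_lt _)]
  simp

theorem index_lt {m r : ℕ} (a : Fin r → Fin m) : ∑ j, (a j : ℕ) * m ^ (j : ℕ) < m ^ r := by
  have h : (finFunctionFinEquiv a : ℕ) = ∑ j, (a j : ℕ) * m ^ (j : ℕ) :=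
    finFunctionFinEquiv_apply _
  rw [← h]
  exact Fin.is_lt _

theorem forall_getElem?_relationTable {m r : ℕ} (P : (Fin r → Fin m) → Prop) (y : ℕ → Option Bool) :
    (∀ j < (relationTable m r P).length, y j = (relationTable m r P)[j]?) ↔
      ∀ a : Fin r → Fin m, y (∑ j, (a j : ℕ) * m ^ (j : ℕ)) =
        open Classical in some (decide (P a)) := by
  constructor
  · intro h a
    rw [h _ (by rw [length_relationTable]; exact index_lt a), relationTable_getElem?]
  · intro h j hj
    rw [length_relationTable] at hj
    obtain ⟨a, ha⟩ := finFunctionFinEquiv.surjective (⟨j, hj⟩ : Fin (m ^ r))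
    have e : j = ∑ j, (a j : ℕ) * m ^ (j : ℕ) :=
      (congrArg Fin.val ha).symm.trans (finFunctionFinEquiv_apply _)
    rw [e, h, relationTable_getElem?]

/-- The truth of the entry with index `a` in the table at position `p`. -/
def Entry (x : List Bool) (p m : ℕ) {r : ℕ} (a : Fin r → ℕ) : Prop :=
  x[p + ∑ j, a j * m ^ (j : ℕ)]? = some true

namespace SymbolOrder

variable {L : FirstOrder.Language.{u, v}} (e : SymbolOrder L)

def relArity (i : Fin e.numRel) : ℕ := (e.relAt i).1

def funArity (i : Fin e.numFun) : ℕ := (e.funAt i).1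

/-- The position of the table of a relation. -/
def relPos (m : ℕ) (i : Fin e.numRel) : ℕ :=
  m + 1 + ∑ i' : Fin i, m ^ e.relArity (Fin.castLE i.2.le i')

def relEnd (m : ℕ) : ℕ := m + 1 + ∑ i, m ^ e.relArity i

/-- The position of the table of a function. -/
def funPos (m : ℕ) (i : Fin e.numFun) : ℕ :=
  e.relEnd m + ∑ i' : Fin i, m ^ (e.funArity (Fin.castLE i.2.le i') + 1)

/-- The position of the weight. -/
def funEnd (m : ℕ) : ℕ := e.relEnd m + ∑ i, m ^ (e.funArity i + 1)

/-- The tables in the word are those of the structure. -/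
def Compat (x : List Bool) (m : ℕ) (S : L.Structure (Fin m)) : Prop :=
  (∀ i (a : Fin (e.relAt i).1 → Fin m), S.RelMap (e.relAt i).2 a ↔
    Entry x (e.relPos m i) m fun j => (a j : ℕ)) ∧
  ∀ i (a : Fin ((e.funAt i).1 + 1) → Fin m), S.funMap (e.funAt i).2 (Fin.init a) = a (Fin.last _) ↔
    Entry x (e.funPos m i) m fun j => (a j : ℕ)

/-- The word starts with the universe, and the tables fit into it. -/
def Header (x : List Bool) (m : ℕ) : Prop :=
  e.funEnd m ≤ x.length ∧ (∀ p < m, x[p]? = some true) ∧ x[m]? ≠ some true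

theorem sum_castLE_add_lt {N : ℕ} (f : Fin N → ℕ) (i : Fin N) {j : ℕ} (hj : j < f i) :
    ∑ i' : Fin i, f (Fin.castLE i.2.le i') + j < ∑ i, f i := by
  have := (finSigmaFinEquiv ⟨i, ⟨j, hj⟩⟩ : Fin (∑ i, f i)).2
  rwa [finSigmaFinEquiv_apply] at this

/-- Equality with an encoding is split into conditions on single positions, which are definable, and
a condition on the suffix that holds the weight. -/
theorem eq_encodeInstance_iff (x : List Bool) (m : ℕ) (S : L.Structure (Fin m)) (k : ℕ) :
    x = encodeInstance e m k ↔
      (e.Header x m ∧ e.Compat x m S) ∧ x.drop (e.funEnd m) = k.bits := by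
  classical
  have hl1 : (List.ofFn fun i : Fin e.numRel => relationTable m (e.relAt i).1
      fun a => FirstOrder.Language.Structure.RelMap (e.relAt i).2 a).flatten.length =
        ∑ i, m ^ e.relArity i := by
    rw [length_flatten_ofFn]
    simp only [length_relationTable, relArity]
  have hl2 : (List.ofFn fun i : Fin e.numFun => relationTable m ((e.funAt i).1 + 1)
      fun a => FirstOrder.Language.Structure.funMap (e.funAt i).2 (Fin.init a) =
        a (Fin.last _)).flatten.length = ∑ i, m ^ (e.funArity i + 1) := by
    rw [length_flatten_ofFn]
    simp only [length_relationTable, funArity]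
  have hlen : x = encodeInstance e m k → e.funEnd m ≤ x.length := by
    rintro rfl
    simp only [encodeInstance, List.length_append, hl1, hl2, List.length_replicate,
      List.length_singleton, funEnd, relEnd]
    omega
  -- Inside the word a symbol is true or false, so a table entry is right iff its truth agrees with
  -- the relation.
  have hsome : ∀ p < x.length, ∀ P : Prop, x[p]? = some (decide P) ↔ (P ↔ x[p]? = some true) := by
    intro p hp P
    rw [List.getElem?_eq_getElem hp]
    cases x[p] <;> by_cases hP : P <;> simp [hP]
  suffices h : e.funEnd m ≤ x.length → (x = encodeInstance e m k ↔
      (((∀ p < m, x[p]? = some true) ∧ x[m]? ≠ some true) ∧ e.Compat x m S) ∧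
        x.drop (e.funEnd m) = k.bits) by
    constructor
    · intro hx
      obtain ⟨⟨h1, h2⟩, h3⟩ := (h (hlen hx)).1 hx
      exact ⟨⟨⟨hlen hx, h1⟩, h2⟩, h3⟩
    · rintro ⟨⟨⟨h1, h2⟩, h3⟩, h4⟩
      exact (h h1).2 ⟨⟨h2, h3⟩, h4⟩
  intro hle
  rw [encodeInstance, List.append_assoc, List.append_assoc, List.append_assoc,
    eq_append_iff_getElem?, eq_append_iff_getElem?, eq_append_iff_getElem?, eq_append_iff_getElem?,
    forall_getElem?_flatten_ofFn, forall_getElem?_flatten_ofFn, hl1, hl2]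
  simp only [length_relationTable, List.drop_drop, List.length_replicate, List.length_singleton,
    List.getElem?_drop]
  have hend : e.relEnd m ≤ e.funEnd m := Nat.le_add_right _ _
  have hm : m + 1 ≤ e.relEnd m := Nat.le_add_right _ _
  have f1 : (∀ p < m, x[p]? = (List.replicate m true)[p]?) ↔ ∀ p < m, x[p]? = some true :=
    forall₂_congr fun p hp => by rw [List.getElem?_replicate_of_lt hp]
  have f2 : (∀ p < 1, x[m + p]? = [false][p]?) ↔ x[m]? ≠ some true := by
    rw [List.getElem?_eq_getElem (show m < x.length by omega)]
    constructor
    · intro h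
      have := h 0 one_pos
      rw [add_zero, List.getElem?_eq_getElem (show m < x.length by omega)] at this
      simp_all
    · intro h p hp
      obtain rfl : p = 0 := by omega
      rw [add_zero, List.getElem?_eq_getElem (show m < x.length by omega)]
      simpa using h
  have f3 : ∀ (i : Fin e.numRel) (P : (Fin (e.relAt i).1 → Fin m) → Prop),
      (∀ j < m ^ (e.relAt i).1,
        x[m + 1 + (∑ i' : Fin i, m ^ (e.relAt (Fin.castLE i.2.le i')).1 + j)]? =
          (relationTable m (e.relAt i).1 P)[j]?) ↔
      ∀ a, P a ↔ Entry x (e.relPos m i) m fun j => (a j : ℕ) := by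
    intro i P
    have h := forall_getElem?_relationTable P fun j =>
      x[m + 1 + (∑ i' : Fin i, m ^ (e.relAt (Fin.castLE i.2.le i')).1 + j)]?
    rw [length_relationTable] at h
    refine h.trans (forall_congr' fun a => ?_)
    have hlt := sum_castLE_add_lt (fun i => m ^ e.relArity i) i (index_lt a)
    rw [← add_assoc]
    exact hsome _ (lt_of_lt_of_le (by rw [add_assoc]; exact Nat.add_lt_add_left hlt _)
      (hend.trans hle)) _
  have f4 : ∀ (i : Fin e.numFun) (P : (Fin ((e.funAt i).1 + 1) → Fin m) → Prop),
      (∀ j < m ^ ((e.funAt i).1 + 1), x[m + 1 + ∑ i, m ^ e.relArity i +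
        (∑ i' : Fin i, m ^ ((e.funAt (Fin.castLE i.2.le i')).1 + 1) + j)]? =
          (relationTable m ((e.funAt i).1 + 1) P)[j]?) ↔
      ∀ a, P a ↔ Entry x (e.funPos m i) m fun j => (a j : ℕ) := by
    intro i P
    have h := forall_getElem?_relationTable P fun j => x[m + 1 + ∑ i, m ^ e.relArity i +
        (∑ i' : Fin i, m ^ ((e.funAt (Fin.castLE i.2.le i')).1 + 1) + j)]?
    rw [length_relationTable] at h
    refine h.trans (forall_congr' fun a => ?_)
    have hlt := sum_castLE_add_lt (fun i => m ^ (e.funArity i + 1)) i (index_lt a)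
    rw [← add_assoc]
    exact hsome _ (lt_of_lt_of_le (by rw [add_assoc]; exact Nat.add_lt_add_left hlt _) hle) _
  simp only [f1, f2, f3, f4]
  simp only [and_assoc, Compat]
  rfl

/-- The function tables are tables of functions. -/
def Functional (x : List Bool) (m : ℕ) : Prop :=
  ∀ i (a : Fin (e.funAt i).1 → Fin m), ∃ b < m,
    Entry x (e.funPos m i) m (Fin.snoc (fun j => (a j : ℕ)) b : Fin ((e.funAt i).1 + 1) → ℕ) ∧
    ∀ b' < m, Entry x (e.funPos m i) m
      (Fin.snoc (fun j => (a j : ℕ)) b' : Fin ((e.funAt i).1 + 1) → ℕ) → b' = b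

theorem val_snoc {m r : ℕ} (a : Fin r → Fin m) (b : Fin m) :
    (fun j => ((Fin.snoc a b : Fin (r + 1) → Fin m) j : ℕ)) =
      (Fin.snoc (fun j => (a j : ℕ)) b : Fin (r + 1) → ℕ) := by
  funext j
  refine Fin.lastCases ?_ (fun j => ?_) j <;> simp

/-- Any table is the table of a relation, so only the function tables can fail: they must be graphs
of functions. -/
theorem exists_compat_iff (x : List Bool) (m : ℕ) :
    (∃ S, e.Compat x m S) ↔ e.Functional x m := by
  constructor
  · rintro ⟨S, -, h⟩ i a
    have h' : ∀ b : Fin m, S.funMap (e.funAt i).2 a = b ↔ Entry x (e.funPos m i) m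
        (Fin.snoc (fun j => (a j : ℕ)) b : Fin ((e.funAt i).1 + 1) → ℕ) := by
      intro b
      rw [← val_snoc, ← h i]
      simp
    refine ⟨S.funMap (e.funAt i).2 a, Fin.is_lt _, (h' _).1 rfl, fun b' hb' he => ?_⟩
    exact congrArg Fin.val ((h' ⟨b', hb'⟩).2 he).symm
  · intro h
    choose f hf using h
    let S : L.Structure (Fin m) :=
      { funMap := fun {r} F a =>
          ⟨f (e.funAt.symm ⟨r, F⟩) fun j => a (Fin.cast (by rw [Equiv.apply_symm_apply]) j),
            (hf _ _).1⟩
        RelMap := fun {r} R a => Entry x (e.relPos m (e.relAt.symm ⟨r, R⟩)) m fun j => (a j : ℕ) }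
    refine ⟨S, fun i a => ?_, fun i a => ?_⟩
    · change Entry x (e.relPos m (e.relAt.symm (e.relAt i))) m _ ↔ _
      rw [Equiv.symm_apply_apply]
    -- The interpretation is indexed by symbols and `f` by positions; this transports along
    -- `e.funAt.symm (e.funAt i) = i`.
    · have hS : ∀ i' (hi : i' = i), f i' (fun j => Fin.init a
          (Fin.cast (by rw [hi]) j)) = f i (Fin.init a) := by
        rintro _ rfl
        rfl
      rw [Fin.ext_iff]
      change f (e.funAt.symm (e.funAt i)) _ = _ ↔ _
      refine (Eq.congr_left (hS _ (Equiv.symm_apply_apply _ _))).trans ?_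
      obtain ⟨h1, h2, h3⟩ := hf i (Fin.init a)
      have ha : ∀ b : Fin m, Entry x (e.funPos m i) m (Fin.snoc (fun j => (Fin.init a j : ℕ)) b :
          Fin ((e.funAt i).1 + 1) → ℕ) ↔ Entry x (e.funPos m i) m
            fun j => ((Fin.snoc (Fin.init a) b : Fin ((e.funAt i).1 + 1) → Fin m) j : ℕ) :=
        fun b => by rw [val_snoc]
      have ha' := ha (a (Fin.last _))
      rw [Fin.snoc_init_self] at ha'
      rw [← ha']
      exact ⟨fun h => by rw [← h]; exact h2, fun h => (h3 _ (Fin.is_lt _) h).symm⟩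

end SymbolOrder

/-! ## Definability of satisfaction in an encoded structure -/

theorem forall_fin_iff {m N : ℕ} (h : m ≤ N) {κ : Type} (P : (κ → ℕ) → Prop) :
    (∀ a : κ → Fin m, P fun j => a j) ↔
      ∀ u : κ → Fin N, (∀ j, (u j : ℕ) < m) → P fun j => u j :=
  ⟨fun H u hu => H fun j => ⟨u j, hu j⟩, fun H a => H (fun j => Fin.castLE h (a j)) fun j => (a j).2⟩

theorem val_le_bnd {x : List Bool} (a : Val x) : (a : ℕ) ≤ bnd x.length := a.2.le

theorem Def.entry {ι : Type} [Finite ι] {p : (x : List Bool) → (ι → Val x) → ℕ} (hp : DefFun p)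
    (m : ι) {r : ℕ} (g : Fin r → ι) :
    Def fun x (v : ι → Val x) => Entry x (p x v) (v m) fun j => (v (g j) : ℕ) :=
  (hp.add (DefFun.sum Finset.univ fun j _ =>
    (DefFun.var (g j)).mul ((DefFun.var m).pow j))).getElem_eq_true

theorem snoc_val {ι : Type} {x : List Bool} (v : ι → Val x) {r : ℕ} (g : Fin r → ι) (i : ι) :
    (fun j => (v ((Fin.snoc g i : Fin (r + 1) → ι) j) : ℕ)) =
      (Fin.snoc (fun j => (v (g j) : ℕ)) (v i : ℕ) : Fin (r + 1) → ℕ) := by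
  funext j
  refine Fin.lastCases ?_ (fun j => ?_) j <;> simp

theorem Def.entry_snoc {ι : Type} [Finite ι] {p : (x : List Bool) → (ι → Val x) → ℕ}
    (hp : DefFun p) (m : ι) {r : ℕ} (g : Fin r → ι) (i : ι) :
    Def fun x (v : ι → Val x) => Entry x (p x v) (v m)
      (Fin.snoc (fun j => (v (g j) : ℕ)) (v i : ℕ) : Fin (r + 1) → ℕ) :=
  (Def.entry hp m (Fin.snoc g i : Fin (r + 1) → ι)).congr fun x v => by rw [snoc_val]

namespace SymbolOrder

variable {L : FirstOrder.Language.{u, v}} (e : SymbolOrder L) {ι : Type} [Finite ι]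

theorem defFun_relPos (m : ι) (i : Fin e.numRel) :
    DefFun fun x (v : ι → Val x) => e.relPos (v m) i :=
  ((DefFun.var m).add DefFun.one).add (DefFun.sum Finset.univ fun _ _ => (DefFun.var m).pow _)

theorem defFun_relEnd (m : ι) : DefFun fun x (v : ι → Val x) => e.relEnd (v m) :=
  ((DefFun.var m).add DefFun.one).add (DefFun.sum Finset.univ fun _ _ => (DefFun.var m).pow _)

theorem defFun_funPos (m : ι) (i : Fin e.numFun) :
    DefFun fun x (v : ι → Val x) => e.funPos (v m) i :=
  (e.defFun_relEnd m).add (DefFun.sum Finset.univ fun _ _ => (DefFun.var m).pow _)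

theorem defFun_funEnd (m : ι) : DefFun fun x (v : ι → Val x) => e.funEnd (v m) :=
  (e.defFun_relEnd m).add (DefFun.sum Finset.univ fun _ _ => (DefFun.var m).pow _)

theorem def_header (m : ι) : Def fun x (v : ι → Val x) => e.Header x (v m) := by
  refine ((e.defFun_funEnd m).le_length.and ((Def.all (P := fun x v p => (p : ℕ) < v m →
    x[(p : ℕ)]? = some true) ((Def.lt none (some m)).imp (Def.input none))).and
      (Def.input m).not)).congr fun x v => ?_
  refine and_congr Iff.rfl (and_congr ⟨fun h p hp => h p hp, fun h p hp => ?_⟩ Iff.rfl)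
  exact h ⟨p, hp.trans (v m).2⟩ hp

theorem def_functional (m : ι) : Def fun x (v : ι → Val x) => e.Functional x (v m) := by
  refine Def.congr (P := fun x v => ∀ (i : Fin e.numFun) (u : Fin (e.funAt i).1 → Val x),
    (∀ j, (u j : ℕ) < v m) → ∃ b : Val x, (b : ℕ) < v m ∧
      Entry x (e.funPos (v m) i) (v m)
        (Fin.snoc (fun j => (u j : ℕ)) (b : ℕ) : Fin ((e.funAt i).1 + 1) → ℕ) ∧
      ∀ b' : Val x, (b' : ℕ) < v m → Entry x (e.funPos (v m) i) (v m)
        (Fin.snoc (fun j => (u j : ℕ)) (b' : ℕ) : Fin ((e.funAt i).1 + 1) → ℕ) →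
          (b' : ℕ) = b) ?_ fun x v => ?_
  · refine Def.finite_all fun i => Def.alls (Def.imp (Def.finite_all fun j => Def.lt _ _)
      (Def.ex ((Def.lt none (some (Sum.inl m))).and ((Def.entry_snoc (e.defFun_funPos _ i) (some (Sum.inl m))
        (fun j => some (Sum.inr j)) none).and (Def.all ((Def.lt none (some (some (Sum.inl m)))).imp
          ((Def.entry_snoc (e.defFun_funPos _ i) (some (some (Sum.inl m)))
            (fun j => some (some (Sum.inr j))) none).imp (Def.eq none (some none)))))))))
  · refine forall_congr' fun i => (forall_fin_iff (val_le_bnd (v m)) (fun a => ∃ b < (v m : ℕ),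
      Entry x (e.funPos (v m) i) (v m) (Fin.snoc a b : Fin ((e.funAt i).1 + 1) → ℕ) ∧
      ∀ b' < (v m : ℕ), Entry x (e.funPos (v m) i) (v m)
        (Fin.snoc a b' : Fin ((e.funAt i).1 + 1) → ℕ) → b' = b)).trans
      (forall₂_congr fun u hu => ?_)
    constructor
    · rintro ⟨b, h1, h2, h3⟩
      exact ⟨⟨b, h1.trans (v m).2⟩, h1, h2, fun b' => h3 b'⟩
    · rintro ⟨b, h1, h2, h3⟩
      exact ⟨b, h1, h2, fun b' hb' => h3 ⟨b', hb'.trans (v m).2⟩ hb'⟩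

/-- Function values are accessible only through graphs, so a nested term is unfolded by guessing the
values of its arguments. The predicate is chosen before the word and the structure; this uniformity
is what makes it a definition. -/
theorem exists_def_term (t : L.Term ℕ) {ι : Type} [Finite ι] (m : ι) (ρ : ℕ → ι) (b : ι) :
    ∃ P : (x : List Bool) → (ι → Val x) → Prop, Def P ∧
      ∀ (x : List Bool) (v : ι → Val x) (M : ℕ) (S : L.Structure (Fin M)), (v m : ℕ) = M →
        e.Compat x M S → ∀ s : ℕ → Fin M, (∀ y, (v (ρ y) : ℕ) = s y) →
          (P x v ↔ (v b : ℕ) = Fin.val (t.realize s)) := by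
  induction t generalizing ι with
  | var y =>
    refine ⟨_, Def.eq b (ρ y), fun x v M S hM hS s hs => ?_⟩
    rw [hs]
    rfl
  | @func r F ts ih =>
    choose P hP hPs using fun j => ih j (ι := ι ⊕ Fin r) (Sum.inl m) (fun y => .inl (ρ y)) (.inr j)
    obtain ⟨i, hi⟩ := e.funAt.surjective ⟨r, F⟩
    refine ⟨fun x v => ∃ u : Fin r → Val x, (∀ j, P j x (Sum.elim v u)) ∧
      ((v b : ℕ) < v m ∧ Entry x (e.funPos (v m) i) (v m)
        (Fin.snoc (fun j => (u j : ℕ)) (v b : ℕ) : Fin (r + 1) → ℕ)), Def.exs ?_, ?_⟩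
    · refine Def.and (Def.finite_all fun j => (hP j).congr fun x v => ?_)
        ((Def.lt _ _).and (Def.entry_snoc (e.defFun_funPos (Sum.inl m) i) (Sum.inl m) .inr (.inl b)))
      rw [show Sum.elim (fun i => v (.inl i)) (fun j => v (.inr j)) = v from Sum.elim_comp_inl_inr v]
    · intro x v M S hM hS s hs
      have hu : ∀ u : Fin r → Val x, (∀ j, P j x (Sum.elim v u)) ↔
          ∀ j, (u j : ℕ) = Fin.val ((ts j).realize s) := fun u => forall_congr' fun j =>
        hPs j x (Sum.elim v u) M S hM hS s hs
      have hf : ∀ b : Fin M, S.funMap F (fun j => (ts j).realize s) = b ↔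
          Entry x (e.funPos M i) M (Fin.snoc (fun j => Fin.val ((ts j).realize s)) (b : ℕ) :
            Fin (r + 1) → ℕ) := by
        intro b
        have h := hS.2 i
        rw [hi] at h
        have h := h (Fin.snoc (fun j => (ts j).realize s) b : Fin (r + 1) → Fin M)
        rw [val_snoc, Fin.init_snoc, Fin.snoc_last] at h
        exact h
      subst hM
      constructor
      · rintro ⟨u, h1, h2, h3⟩
        rw [hu] at h1
        simp only [h1] at h3
        exact (congrArg Fin.val ((hf ⟨v b, h2⟩).2 h3)).symm
      · intro h
        refine ⟨fun j => Fin.castLE (val_le_bnd (v m)) ((ts j).realize s), (hu _).2 fun j => rfl, ?_⟩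
        rw [h]
        exact ⟨Fin.is_lt _, (hf _).1 rfl⟩

theorem exists_def_terms {r : ℕ} (ts : Fin r → L.Term ℕ) {ι : Type} [Finite ι] (m : ι)
    (ρ : ℕ → ι) {Q : (x : List Bool) → (ι → Val x) → (Fin r → Val x) → Prop}
    (hQ : Def fun x (v : ι ⊕ Fin r → Val x) => Q x (fun i => v (.inl i)) fun j => v (.inr j)) :
    ∃ P : (x : List Bool) → (ι → Val x) → Prop, Def P ∧
      ∀ (x : List Bool) (v : ι → Val x) (M : ℕ) (S : L.Structure (Fin M)) (hM : (v m : ℕ) = M),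
        e.Compat x M S → ∀ s : ℕ → Fin M, (∀ y, (v (ρ y) : ℕ) = s y) →
          (P x v ↔ Q x v fun j => Fin.castLE (hM ▸ val_le_bnd (v m)) ((ts j).realize s)) := by
  choose P hP hPs using fun j => e.exists_def_term (ts j) (ι := ι ⊕ Fin r) (Sum.inl m)
    (fun y => Sum.inl (ρ y)) (Sum.inr j)
  refine ⟨fun x v => ∃ u : Fin r → Val x, (∀ j, P j x (Sum.elim v u)) ∧ Q x v u, Def.exs ?_, ?_⟩
  · refine Def.and (Def.finite_all fun j => (hP j).congr fun x v => ?_) hQ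
    rw [show Sum.elim (fun i => v (.inl i)) (fun j => v (.inr j)) = v from Sum.elim_comp_inl_inr v]
  · intro x v M S hM hS s hs
    have hu : ∀ u : Fin r → Val x, (∀ j, P j x (Sum.elim v u)) ↔
        u = fun j => Fin.castLE (hM ▸ val_le_bnd (v m)) ((ts j).realize s) := by
      intro u
      rw [funext_iff]
      refine forall_congr' fun j => (hPs j x (Sum.elim v u) M S hM hS s hs).trans ?_
      rw [Fin.ext_iff]
      rfl
    simp only [hu, exists_eq_left]

/-- The map `ρ` tells which index holds the value of a first-order variable, and `m` holds the size
of the universe, by which quantifiers are bounded. -/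
theorem exists_def_formula (φ : FOFormula L) {ι : Type} [Finite ι] (m : ι) (ρ : ℕ → ι) :
    ∃ P : (x : List Bool) → (ι → Val x) → Prop, Def P ∧
      ∀ (x : List Bool) (v : ι → Val x) (M : ℕ) (S : L.Structure (Fin M)), (v m : ℕ) = M →
        e.Compat x M S → ∀ s : ℕ → Fin M, (∀ y, (v (ρ y) : ℕ) = s y) → (P x v ↔ φ.Sat s) := by
  have heq : ∀ (t₁ t₂ : L.Term ℕ) {ι : Type} [Finite ι] (m : ι) (ρ : ℕ → ι),
      ∃ P : (x : List Bool) → (ι → Val x) → Prop, Def P ∧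
        ∀ (x : List Bool) (v : ι → Val x) (M : ℕ) (S : L.Structure (Fin M)), (v m : ℕ) = M →
          e.Compat x M S → ∀ s : ℕ → Fin M, (∀ y, (v (ρ y) : ℕ) = s y) →
            (P x v ↔ t₁.realize s = t₂.realize s) := by
    intro t₁ t₂ ι _ m ρ
    obtain ⟨P, hP, h⟩ := e.exists_def_terms ![t₁, t₂] m ρ
      (Q := fun x v u => (u 0 : ℕ) = u 1) (Def.eq _ _)
    refine ⟨P, hP, fun x v M S hM hS s hs => (h x v M S hM hS s hs).trans ?_⟩
    rw [Fin.ext_iff]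
    rfl
  have hrel : ∀ {r : ℕ} (R : L.Relations r) (ts : Fin r → L.Term ℕ) {ι : Type} [Finite ι] (m : ι)
      (ρ : ℕ → ι), ∃ P : (x : List Bool) → (ι → Val x) → Prop, Def P ∧
        ∀ (x : List Bool) (v : ι → Val x) (M : ℕ) (S : L.Structure (Fin M)), (v m : ℕ) = M →
          e.Compat x M S → ∀ s : ℕ → Fin M, (∀ y, (v (ρ y) : ℕ) = s y) →
            (P x v ↔ S.RelMap R fun i => (ts i).realize s) := by
    intro r R ts ι _ m ρ
    obtain ⟨i, hi⟩ := e.relAt.surjective ⟨r, R⟩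
    obtain ⟨P, hP, h⟩ := e.exists_def_terms ts m ρ
      (Q := fun x v u => Entry x (e.relPos (v m) i) (v m) fun j => (u j : ℕ))
      (Def.entry (e.defFun_relPos (Sum.inl m) i) (Sum.inl m) Sum.inr)
    refine ⟨P, hP, fun x v M S hM hS s hs => (h x v M S hM hS s hs).trans ?_⟩
    have h := hS.1 i
    rw [hi] at h
    subst hM
    rw [h]
    rfl
  induction φ generalizing ι with
  | eq t₁ t₂ => exact heq t₁ t₂ m ρ
  | neq t₁ t₂ =>
    obtain ⟨P, hP, h⟩ := heq t₁ t₂ m ρ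
    exact ⟨_, hP.not, fun x v M S hM hS s hs => not_congr (h x v M S hM hS s hs)⟩
  | rel R ts => exact hrel R ts m ρ
  | nrel R ts =>
    obtain ⟨P, hP, h⟩ := hrel R ts m ρ
    exact ⟨_, hP.not, fun x v M S hM hS s hs => not_congr (h x v M S hM hS s hs)⟩
  | and φ ψ ih₁ ih₂ =>
    obtain ⟨P, hP, h⟩ := ih₁ m ρ
    obtain ⟨P', hP', h'⟩ := ih₂ m ρ
    exact ⟨_, hP.and hP', fun x v M S hM hS s hs =>
      and_congr (h x v M S hM hS s hs) (h' x v M S hM hS s hs)⟩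
  | or φ ψ ih₁ ih₂ =>
    obtain ⟨P, hP, h⟩ := ih₁ m ρ
    obtain ⟨P', hP', h'⟩ := ih₂ m ρ
    exact ⟨_, hP.or hP', fun x v M S hM hS s hs =>
      or_congr (h x v M S hM hS s hs) (h' x v M S hM hS s hs)⟩
  | ex y φ ih =>
    -- The quantified variable gets the fresh index `none`; redirecting `ρ` there shadows an earlier
    -- value of the same variable.
    obtain ⟨P, hP, h⟩ := ih (ι := Option ι) (some m) (Function.update (fun z => some (ρ z)) y none)
    refine ⟨fun x v => ∃ a : Val x, (a : ℕ) < v m ∧ P x fun o => o.elim a v, Def.ex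
      ((Def.lt _ _).and (hP.congr fun x v => ?_)), fun x v M S hM hS s hs => ?_⟩
    · rw [show (fun o : Option ι => o.elim (v none) fun i => v (some i)) = v from
        funext fun o => by cases o <;> rfl]
    · have hr : ∀ a : Fin M, P x (fun o => o.elim (Fin.castLE (hM ▸ val_le_bnd (v m)) a) v) ↔
          φ.Sat (Function.update s y a) := by
        intro a
        refine h x _ M S hM hS _ fun z => ?_
        rcases eq_or_ne z y with rfl | hz
        · simp
        · simp [Function.update_of_ne hz, hs]
      subst hM
      exact ⟨fun ⟨a, h1, h2⟩ => ⟨⟨a, h1⟩, (hr ⟨a, h1⟩).1 h2⟩, fun ⟨a, ha⟩ => ⟨_, a.2, (hr a).2 ha⟩⟩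
  | all y φ ih =>
    obtain ⟨P, hP, h⟩ := ih (ι := Option ι) (some m) (Function.update (fun z => some (ρ z)) y none)
    refine ⟨fun x v => ∀ a : Val x, (a : ℕ) < v m → P x fun o => o.elim a v, Def.all
      ((Def.lt _ _).imp (hP.congr fun x v => ?_)), fun x v M S hM hS s hs => ?_⟩
    · rw [show (fun o : Option ι => o.elim (v none) fun i => v (some i)) = v from
        funext fun o => by cases o <;> rfl]
    · have hr : ∀ a : Fin M, P x (fun o => o.elim (Fin.castLE (hM ▸ val_le_bnd (v m)) a) v) ↔
          φ.Sat (Function.update s y a) := by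
        intro a
        refine h x _ M S hM hS _ fun z => ?_
        rcases eq_or_ne z y with rfl | hz
        · simp
        · simp [Function.update_of_ne hz, hs]
      subst hM
      exact ⟨fun H a => (hr a).1 (H _ a.2), fun H a ha => (hr ⟨a, ha⟩).2 (H _)⟩

end SymbolOrder

/-! ## Definability of the weight -/

/-- Comparison of two numbers that are given by their tracks. -/
def TrackLT {D : ℕ} (y z : Fin D → ℕ) : Prop :=
  ∃ j, ∃ i : Fin D, ((y i).testBit j = false ∧ (z i).testBit j = true ∧
    ∀ i' > i, (y i').testBit j = (z i').testBit j) ∧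
      ∀ j' > j, ∀ i', (y i').testBit j' = (z i').testBit j'

theorem Def.trackLT {ι : Type} [Finite ι] {D : ℕ} (σ τ : Fin D → ι) :
    Def fun x (v : ι → Val x) => TrackLT (fun i => (v (σ i) : ℕ)) fun i => (v (τ i) : ℕ) :=
  Def.atom (AutoRel.lt_of_tracks σ τ)

/-- Interleaving identifies the `D`-tuples of `ℓ`-bit values with the numbers below `2 ^ (D * ℓ)`,
of which exactly `k` are less than `k`. Thus the weight becomes a number of tuples that a counting
quantifier can compare. -/
theorem ncard_trackLT {κ : Type} {D ℓ k : ℕ} (hD : 0 < D) (f : κ ≃ Fin D) (hk : k < 2 ^ (D * ℓ)) :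
    {u : κ → Fin (2 ^ ℓ) | TrackLT (fun i => (u (f.symm i) : ℕ)) fun i => track D k i}.ncard =
      k := by
  have key : ∀ u : Fin D → Fin (2 ^ ℓ), TrackLT (fun i => (u i : ℕ)) (fun i => track D k i) ↔
      ((trackEquiv D ℓ hD).symm u : ℕ) < k := by
    intro u
    rw [lt_iff_tracks hD]
    have : ∀ i : Fin D, (u i : ℕ) = track D ((trackEquiv D ℓ hD).symm u : ℕ) i := fun i =>
      (congrArg Fin.val (congrFun ((trackEquiv D ℓ hD).apply_symm_apply u) i)).symm
    simp only [TrackLT, this]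
  refine (Set.ncard_congr (fun u _ => (trackEquiv D ℓ hD).symm fun i => u (f.symm i))
    (fun u hu => (key _).1 hu) (fun u u' _ _ h => ?_) fun a ha => ?_).trans (ncard_fin_lt hk.le)
  · have := (trackEquiv D ℓ hD).symm.injective h
    funext i
    simpa using congrFun this (f i)
  · refine ⟨fun i => trackEquiv D ℓ hD a (f i), (key _).2 ?_, ?_⟩
    · simpa using ha
    · simp

/-- The tracks of the weight, whose bits start at position `T` of the word. -/
def IsWeight (x : List Bool) (T : ℕ) {D : ℕ} (z : Fin D → ℕ) : Prop :=
  (∀ (i : Fin D) (p j : Val x), (p : ℕ) = 2 ^ (j : ℕ) →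
    ((∃ l, (z i).testBit l ∧ (p : ℕ).testBit l) ↔ x[T + (j * D + i)]? = some true)) ∧
  ∀ q : Val x, T ≤ q → x[(q : ℕ)]? = some true →
    ∃ (i : Fin D) (p j : Val x), (p : ℕ) = 2 ^ (j : ℕ) ∧ T + (j * D + i) = q

theorem Def.isWeight {ι : Type} [Finite ι] {T : (x : List Bool) → (ι → Val x) → ℕ}
    (hT : DefFun T) {D : ℕ} (σ : Fin D → ι) :
    Def fun x (v : ι → Val x) => IsWeight x (T x v) fun i => (v (σ i) : ℕ) := by
  have hle : ∀ {ι : Type} [Finite ι] {T : (x : List Bool) → (ι → Val x) → ℕ} (_ : DefFun T)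
      (q : ι), Def fun x v => T x v ≤ v q := fun hT q =>
    hT.subst (P := fun x v a => a ≤ v q) (Def.le none (some q)) fun x v a h => h.trans_lt (v q).2
  have hpos : ∀ {ι' : Type} [Finite ι'] (τ : ι → ι') (i : Fin D) (j : ι'),
      DefFun fun x (v : ι' → Val x) => T x (fun i => v (τ i)) + (v j * D + i) := fun τ i j =>
    (hT.comp τ).add (((DefFun.var j).mul (DefFun.const D)).add (DefFun.const i))
  refine Def.and (Def.finite_all fun i => Def.all (Def.all ((Def.eq_two_pow (some none) none).imp
    ((Def.testBit_common (some (some (σ i))) (some none)).iff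
      (hpos (fun i => some (some i)) i none).getElem_eq_true)))) ?_
  exact Def.all ((hle (hT.comp some) none).imp ((Def.input none).imp (Def.finite_ex fun i =>
    Def.ex (Def.ex ((Def.eq_two_pow (some none) none).and
      ((hpos (fun i => some (some (some i))) i none).eq_var (some (some none))))))))

/-- The first clause matches bit `j` of `z i`, isolated by `2 ^ j`, with bit `j * D + i` of the
weight. The range of `2 ^ j` limits `j` to `x.length.size`, so the second clause, which leaves no
one of the weight uncovered, expresses the bound on `k`. -/
theorem isWeight_iff {x : List Bool} {T k D : ℕ} (hD : 0 < D) (hk : x.drop T = k.bits)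
    (z : Fin D → Val x) : IsWeight x T (fun i => (z i : ℕ)) ↔
      k < 2 ^ (D * (x.length.size + 1)) ∧ ∀ i, (z i : ℕ) = track D k i := by
  have hbit : ∀ q, x[T + q]? = some true ↔ k.testBit q = true := by
    intro q
    rw [testBit_eq_getD_bits, ← hk, List.getD_eq_getElem?_getD, List.getElem?_drop]
    cases x[T + q]? <;> simp
  have hcommon : ∀ a j : ℕ, (∃ l, a.testBit l = true ∧ (2 ^ j).testBit l = true) ↔
      a.testBit j = true := by
    intro a j
    simp [Nat.testBit_two_pow]
  have hexp : ∀ j < x.length.size + 1, ∃ p' j' : Val x, (p' : ℕ) = 2 ^ j ∧ (j' : ℕ) = j := by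
    intro j hj
    have h1 : 2 ^ j < bnd x.length := Nat.pow_lt_pow_right (by norm_num) hj
    exact ⟨⟨2 ^ j, h1⟩, ⟨j, Nat.lt_two_pow_self.trans h1⟩, rfl, rfl⟩
  have hlog : ∀ (p : Val x) (j : ℕ), (p : ℕ) = 2 ^ j → j < x.length.size + 1 := by
    intro p j h
    have := p.2
    rw [h] at this
    exact (Nat.pow_lt_pow_iff_right (by norm_num)).1 this
  constructor
  · rintro ⟨h1, h2⟩
    have hlt : k < 2 ^ (D * (x.length.size + 1)) := by
      refine Nat.lt_pow_two_of_testBit _ fun q hq => ?_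
      by_contra hne
      rw [Bool.not_eq_false, ← hbit] at hne
      have hx : T + q < x.length := (List.getElem?_eq_some_iff.1 hne).1
      obtain ⟨i, p, j, hp, he⟩ := h2 ⟨T + q, hx.trans (lt_bnd _)⟩ (Nat.le_add_right _ _) hne
      have hj := hlog p j hp
      have he : (j : ℕ) * D + i = q := Nat.add_left_cancel he
      have hi := i.2
      have : ((j : ℕ) + 1) * D ≤ (x.length.size + 1) * D := Nat.mul_le_mul_right _ hj
      rw [add_mul, one_mul, mul_comm (x.length.size + 1)] at this
      omega
    refine ⟨hlt, fun i => Nat.eq_of_testBit_eq fun j => ?_⟩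
    rcases lt_or_ge j (x.length.size + 1) with hj | hj
    · obtain ⟨p', j', hp, hj'⟩ := hexp j hj
      have := h1 i p' j' (by rw [hp, hj'])
      rw [hp, hj', hcommon, hbit, ← testBit_track hD] at this
      exact Bool.eq_iff_iff.2 this
    · have h := Nat.pow_le_pow_right (n := 2) (by norm_num) hj
      rw [Nat.testBit_lt_two_pow ((z i).2.trans_le h),
        Nat.testBit_lt_two_pow ((track_lt hD hlt).trans_le h)]
  · rintro ⟨hlt, hz⟩
    refine ⟨fun i p j hp => ?_, fun q hq hx => ?_⟩
    · simp only [hp, hcommon, hbit, ← testBit_track hD, hz]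
    · obtain ⟨r, hr⟩ := Nat.exists_eq_add_of_le hq
      rw [hr, hbit] at hx
      have hr' : r < D * (x.length.size + 1) := by
        by_contra h
        rw [Nat.testBit_lt_two_pow (hlt.trans_le
          (Nat.pow_le_pow_right (by norm_num) (not_lt.1 h)))] at hx
        exact absurd hx (by simp)
      obtain ⟨p', j', hp, hj'⟩ := hexp (r / D) (Nat.div_lt_of_lt_mul hr')
      refine ⟨⟨r % D, Nat.mod_lt _ hD⟩, p', j', by rw [hp, hj'], ?_⟩
      rw [hj', hr, mul_comm, Nat.div_add_mod]

/-- A canonical expansion is empty or ends with a one. -/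
theorem exists_drop_eq_bits_iff {x : List Bool} {T : ℕ} (hT : T ≤ x.length) :
    (∃ k : ℕ, x.drop T = k.bits) ↔
      T = x.length ∨ ∃ p : Val x, (p : ℕ) + 1 = x.length ∧ x[(p : ℕ)]? = some true := by
  simp only [eq_comm (a := x.drop T)]
  rw [exists_bits_eq_iff, List.getLast?_drop]
  split_ifs with h
  · simp [le_antisymm hT h]
  · rw [List.getLast?_eq_getElem?]
    have hl : x.length - 1 < x.length := by omega
    constructor
    · intro hx
      refine Or.inr ⟨⟨x.length - 1, hl.trans (lt_bnd _)⟩, Nat.sub_add_cancel (by omega), ?_⟩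
      rw [List.getElem?_eq_getElem hl] at hx ⊢
      simpa using hx
    · rintro (hx | ⟨p, h1, h2⟩)
      · omega
      · rw [← h1, Nat.add_sub_cancel, h2]
        simp

/-! ## Definability of weighted team definability -/

variable {L : FirstOrder.Language.{u, v}}

/-- The component `none` is forced to be `0` and hence does not change the number of assignments. -/
theorem ncard_assignments {κ : Type} [Finite κ] {m N : ℕ} (hm : 0 < m) (hN : m ≤ N)
    (Q : (κ → Fin m) → Prop) (P : (Option κ → Fin N) → Prop)
    (hPQ : ∀ s, P (fun o => Option.elim o ⟨0, hm.trans_le hN⟩ fun y => Fin.castLE hN (s y)) ↔ Q s) :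
    {u | ((u none : ℕ) = 0 ∧ ∀ y, (u (some y) : ℕ) < m) ∧ P u}.ncard = {s | Q s}.ncard := by
  refine (Set.ncard_congr (fun s _ o => Option.elim o ⟨0, hm.trans_le hN⟩ fun y => Fin.castLE hN (s y))
    ?_ (fun s s' _ _ h => ?_) fun u hu => ?_).symm
  · exact fun s hs => ⟨⟨rfl, fun y => (s y).2⟩, (hPQ s).2 hs⟩
  · funext y
    exact Fin.castLE_injective hN (congrFun h (some y))
  · obtain ⟨⟨h1, h2⟩, h3⟩ := hu
    have e : (fun o : Option κ => o.elim ⟨0, hm.trans_le hN⟩ fun y =>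
        Fin.castLE hN (⟨u (some y), h2 y⟩ : Fin m)) = u := by
      funext o
      cases o with
      | none => exact Fin.ext h1.symm
      | some y => rfl
    exact ⟨fun y => ⟨u (some y), h2 y⟩, (hPQ _).1 (by rw [e]; exact h3), e⟩

/-- The purpose of the dummy component: the number of satisfying assignments is strictly less than
that of all `D`-tuples, so every weight that can succeed fits into `D` tracks. -/
theorem ncard_lt_of_none {κ : Type} [Finite κ] {n D : ℕ} (f : Option κ ≃ Fin D)
    {P : (Option κ → Fin (bnd n)) → Prop} (hP : ∀ u, P u → (u none : ℕ) = 0) :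
    {u | P u}.ncard < 2 ^ (D * (n.size + 1)) := by
  have h1 : 1 < bnd n := Nat.one_lt_two_pow (Nat.succ_ne_zero _)
  have := Set.ncard_lt_ncard (s := {u | P u}) (t := Set.univ)
    (Set.ssubset_univ_iff.2 fun h => by
      have := hP (fun _ => ⟨1, h1⟩) ((Set.ext_iff.1 h _).2 trivial)
      exact absurd this (by simp)) (Set.toFinite _)
  rwa [Set.ncard_univ, Nat.card_fun, Nat.card_congr f, Nat.card_eq_fintype_card,
    Nat.card_eq_fintype_card, Fintype.card_fin, Fintype.card_fin, show bnd n ^ D = 2 ^ (D * (n.size + 1)) by rw [bnd, ← pow_mul, mul_comm]] at this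

theorem def_WT (e : SymbolOrder L) (φ : FOFormula L) :
    Def (ι := Empty) fun x _ => x ∈ WT e φ := by
  classical
  -- One track for each free variable and one for the dummy component, which also ensures `0 < D`
  -- for sentences.
  obtain ⟨D, ⟨f⟩⟩ := Finite.exists_equiv_fin (Option φ.freeVars)
  have hD : 0 < D := (f none).pos
  let ι₁ := Option Empty ⊕ Fin D
  let ι₂ := ι₁ ⊕ Option φ.freeVars
  -- Variables that are not free in `φ` are read from the dummy component. Its value `0` is the
  -- default value with which `extendAssignment` is used below.
  obtain ⟨P, hP, hPs⟩ := e.exists_def_formula φ (ι := ι₂) (Sum.inl (Sum.inl none))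
    fun y => Sum.inr (if h : y ∈ φ.freeVars then some ⟨y, h⟩ else none)
  let Good := fun (x : List Bool) (v : ι₁ → Val x) (u : Option φ.freeVars → Val x) =>
    ((u none : ℕ) = 0 ∧ ∀ y, (u (some y) : ℕ) < v (Sum.inl none)) ∧ P x (Sum.elim v u)
  have hGood : Def fun x (v : ι₂ → Val x) => Good x (fun i => v (.inl i)) fun j => v (.inr j) := by
    refine Def.and ((Def.eq_zero _).and (Def.finite_all fun y => Def.lt _ _))
      (hP.congr fun x v => ?_)
    rw [show Sum.elim (fun i => v (.inl i)) (fun j => v (.inr j)) = v from Sum.elim_comp_inl_inr v]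
  have hdef : Def fun x (_ : Empty → Val x) => ∃ m : Val x,
      ((¬ (m : ℕ) = 0 ∧ e.Header x m ∧ e.Functional x m) ∧ (e.funEnd m = x.length ∨
        ∃ p : Val x, (p : ℕ) + 1 = x.length ∧ x[(p : ℕ)]? = some true)) ∧
      ∃ z : Fin D → Val x, IsWeight x (e.funEnd m) (fun i => (z i : ℕ)) ∧
        {u : Option φ.freeVars → Val x |
          TrackLT (fun i => (u (f.symm i) : ℕ)) fun i => (z i : ℕ)}.ncard ≤
        {u | Good x (Sum.elim (fun _ => m) z) u}.ncard := by
    refine Def.ex (Def.and (Def.and ((Def.eq_zero none).not.and ((e.def_header none).and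
      (e.def_functional none))) ((e.defFun_funEnd none).eq_length.or (Def.ex
        ((((DefFun.var none).add DefFun.one).eq_length).and (Def.input none)))))
      (Def.exs (Def.and (Def.isWeight (e.defFun_funEnd (Sum.inl none)) Sum.inr) ?_)))
    refine (Def.count (ι := ι₁) (Q := fun x v u => TrackLT (fun i => (u (f.symm i) : ℕ))
      fun i => (v (.inr i) : ℕ)) hGood (Def.trackLT (fun i => Sum.inr (f.symm i))
      fun i => Sum.inl (Sum.inr i))).congr fun x v => ?_
    rw [show Sum.elim (fun _ => v (.inl none)) (fun j => v (.inr j)) = v from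
      funext fun i => by rcases i with (_ | i) | i <;> first | rfl | exact i.elim]
  refine hdef.congr fun x _ => ?_
  have key : ∀ (m : Val x) (hm : 0 < (m : ℕ)) (S : L.Structure (Fin m)) (k : ℕ),
      e.Compat x m S → x.drop (e.funEnd m) = k.bits → (HasTeamOfSize φ (Fin m) k ↔
        ∃ z : Fin D → Val x, IsWeight x (e.funEnd m) (fun i => (z i : ℕ)) ∧
          {u : Option φ.freeVars → Val x |
            TrackLT (fun i => (u (f.symm i) : ℕ)) fun i => (z i : ℕ)}.ncard ≤
          {u | Good x (Sum.elim (fun _ => m) z) u}.ncard) := by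
    intro m hm S k hS hk
    rw [hasTeamOfSize_iff (⟨0, hm⟩ : Fin m)]
    have hc : ∀ z : Fin D → Val x, {u | Good x (Sum.elim (fun _ => m) z) u}.ncard =
        {s : φ.freeVars → Fin m | φ.Sat (extendAssignment ⟨0, hm⟩ s)}.ncard := by
      intro z
      refine ncard_assignments hm (val_le_bnd m) _ _ fun s => ?_
      refine hPs x _ m S rfl hS _ fun y => ?_
      simp only [Sum.elim_inr, extendAssignment]
      split_ifs <;> rfl
    constructor
    · intro h
      -- A larger weight has no tracks `z`, but it also exceeds the number of satisfying
      -- assignments, so both sides are false.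
      have hlt : k < 2 ^ (D * (x.length.size + 1)) := by
        rw [← hc fun _ => m] at h
        exact h.trans_lt (ncard_lt_of_none f fun u hu => hu.1.1)
      refine ⟨fun i => ⟨track D k i, track_lt hD hlt⟩, (isWeight_iff hD hk _).2
        ⟨hlt, fun i => rfl⟩, ?_⟩
      rw [hc]
      exact (ncard_trackLT hD f hlt).trans_le h
    · rintro ⟨z, hz, h⟩
      obtain ⟨hlt, hz⟩ := (isWeight_iff hD hk z).1 hz
      simp only [hz] at h
      rw [hc] at h
      exact (ncard_trackLT hD f hlt).symm.trans_le h
  constructor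
  · rintro ⟨m, hm, S, k, hx, h⟩
    obtain ⟨⟨h1, h2⟩, h3⟩ := (e.eq_encodeInstance_iff x m S k).1 hx
    have hml : m < bnd x.length := by
      refine lt_of_le_of_lt ?_ (lt_bnd _)
      have := h1.1
      unfold SymbolOrder.funEnd SymbolOrder.relEnd at this
      omega
    exact ⟨⟨m, hml⟩, ⟨⟨hm.ne', h1, (e.exists_compat_iff x m).1 ⟨S, h2⟩⟩,
      (exists_drop_eq_bits_iff h1.1).1 ⟨k, h3⟩⟩, (key ⟨m, hml⟩ hm S k h2 h3).1 h⟩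
  · rintro ⟨m, ⟨⟨hm, h1, h2⟩, h3⟩, h⟩
    obtain ⟨S, hS⟩ := (e.exists_compat_iff x m).2 h2
    obtain ⟨k, hk⟩ := (exists_drop_eq_bits_iff h1.1).2 h3
    have hm := Nat.pos_of_ne_zero hm
    exact ⟨m, hm, S, k, (e.eq_encodeInstance_iff x m S k).2 ⟨⟨h1, hS⟩, hk⟩,
      (key m hm S k hS hk).2 h⟩

end WeightedTeam

/-- For every first-order formula under team semantics over a finite vocabulary, the weighted team
definability problem is in DLOGTIME-uniform TC⁰. -/
theorem mainTheorem12 (L : FirstOrder.Language.{u, v}) (e : WeightedTeam.SymbolOrder L)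
    (φ : WeightedTeam.FOFormula L) :
    WeightedTeam.InDLOGTIMEUniformTC0 (WeightedTeam.WT e φ) :=
  WeightedTeam.inDLOGTIMEUniformTC0_of_def (WeightedTeam.def_WT e φ)
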